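/- Let $M$ be a closed Kähler manifold (a compact Hausdorff complex manifold without boundary, with complex structure $J$ and a closed real 2-form $\omega$ such that $\omega(Ju,Jv)=\omega(u,v)$ and $\omega(u,Ju)>0$ for $u\neq 0$), and let $w$ be the bivector field inverse to $\omega$, i.e. $(w^{ij})=(\omega_{ij})^{-1}$ for $\omega_{ij}=\omega(e_i,e_j)$ in any local frame $(e_i)$ of $TM$. Put $w\vdash\alpha=\tfrac12\sum_{i,j}w^{ij}\,e_i\vdash(e_j\vdash\alpha)$, where $v\vdash\alpha=\alpha(v,\cdot,\dots,\cdot)$ and $\alpha\dashv v=\alpha(\cdot,\dots,\cdot,v)$, and let $\delta\alpha=w\vdash d\alpha-d(w\vdash\alpha)$ be Koszul's codifferential. On $\Omega^*(M)[h]$, graded with $\deg h=2$, consider the $\mathbb R[h]$-bilinear quantum exterior product $$\alpha\wedge_h\beta=\sum_{n\ge0}\frac{h^n}{n!}\sum w^{i_1j_1}\cdots w^{i_nj_n}\,(\alpha\dashv e_{i_1}\dashv\cdots\dashv e_{i_n})\wedge(e_{j_n}\vdash\cdots\vdash e_{j_1}\vdash\beta)$$ and the $\mathbb R[h]$-linear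 quantum differential $d_h=d-h\delta$. Then: (0) $(\Omega^*(M)[h],\wedge_h,d_h)$ is a differential graded algebra. Its cohomology is the polynomial quantum de Rham cohomology $Q_hH^*_{dR}(M)$. (1) Let $C^{p,q}=h^p\,\Omega^{q-p}(M)$ for $p\ge0$ and $C^{p,q}=0$ for $p<0$, with the two differentials $d:C^{p,q}\to C^{p,q+1}$ and $-h\delta:C^{p,q}\to C^{p+1,q}$, and let $(E_r^{p,q},d_r)$, $d_r:E_r^{p,q}\to E_r^{p+r,q-r+1}$, $r\ge1$, be the spectral sequence of this double complex for the filtration of the total complex by $p$. Its first term is $E_1^{p,q}=h^p\,H^{q-p}_{dR}(M)$ for $p\ge0$ (by $[\alpha]\mapsto[h^p\alpha]$) and $E_1^{p,q}=0$ for $p<0$, and it degenerates at $E_1$: $d_r=0$ for all $r\ge1$. (2) $Q_hH^*_{dR}(M)$ is a graded deformation quantization of $H^*_{dR}(M)$: it is a graded algebra over $\mathbb R[h]$ ($\deg h=2$) that is isomorphic to $H^*_{dR}(M)\otimes_{\mathbb R}\mathbb R[h]$ as a graded $\mathbb R[h]$-module, and $Q_hH^*_{dR}(M)/h\,Q_hH^*_{dR}(M)\cong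 H^*_{dR}(M)$ as algebras, in such a way that the algebra isomorphism takes the class of the image of $a\otimes 1$ to $a$ for every $a\in H^*_{dR}(M)$. -/

import Mathlib

open scoped ContDiff Manifold TensorProduct Polynomial

set_option linter.unusedSectionVars false

namespace QuantumDeRham

/-! ### Linear algebra on a single tangent space -/

section Fiber

variable (E : Type*) [NormedAddCommGroup E] [NormedSpace ℝ E]

/-- The exterior algebra `Λ(E*) = ⨁ₖ Λᵏ(E*)`, a form of degree `k` being an alternating `k`-linear
function. Since `Λᵏ(E*) = 0` for `k > dim E`, the product over all `k` is the direct sum. -/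
abbrev Ext : Type _ := ∀ k : ℕ, E [⋀^Fin k]→L[ℝ] ℝ

variable {E}

instance [FiniteDimensional ℝ E] (k : ℕ) : FiniteDimensional ℝ (E [⋀^Fin k]→L[ℝ] ℝ) :=
  FiniteDimensional.of_injective
    ({ toFun := fun f => f.toMultilinearMap
       map_add' := fun _ _ => rfl
       map_smul' := fun _ _ => rfl } :
      (E [⋀^Fin k]→L[ℝ] ℝ) →ₗ[ℝ] MultilinearMap ℝ (fun _ : Fin k => E) ℝ)
    (fun f g h => by
      ext v
      exact congrArg (fun m : MultilinearMap ℝ (fun _ : Fin k => E) ℝ => m v) h)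

/-- The exterior product `α ∧ β` of an `a`-form and a `b`-form, as an `m`-form where `m = a + b`:
the sum over shuffles `σ` of `sign σ • α (v ∘ σ ∘ inl) * β (v ∘ σ ∘ inr)`. -/
noncomputable def wedgeAlt {a b m : ℕ} (h : a + b = m) (α : E [⋀^Fin a]→L[ℝ] ℝ)
    (β : E [⋀^Fin b]→L[ℝ] ℝ) : E [⋀^Fin m]→ₗ[ℝ] ℝ :=
  ((LinearMap.mul' ℝ ℝ).compAlternatingMap
    (α.toAlternatingMap.domCoprod β.toAlternatingMap)).domDomCongr
      (finSumFinEquiv.trans (finCongr h))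

theorem continuous_wedgeAlt {a b m : ℕ} (h : a + b = m) (α : E [⋀^Fin a]→L[ℝ] ℝ)
    (β : E [⋀^Fin b]→L[ℝ] ℝ) : Continuous (wedgeAlt h α β) := by
  have : ⇑(wedgeAlt h α β) = fun v => ∑ σ : Equiv.Perm.ModSumCongr (Fin a) (Fin b),
      LinearMap.mul' ℝ ℝ (AlternatingMap.domCoprod.summand α.toAlternatingMap β.toAlternatingMap σ
        (fun i => v ((finSumFinEquiv.trans (finCongr h)) i))) := by
    funext v
    simp [wedgeAlt, AlternatingMap.domCoprod]
    rfl
  rw [this]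
  refine continuous_finsetSum _ fun σ _ => ?_
  induction σ using Quotient.inductionOn' with | _ σ
  have h2 : (fun v : Fin m → E => LinearMap.mul' ℝ ℝ
      (AlternatingMap.domCoprod.summand α.toAlternatingMap β.toAlternatingMap (Quotient.mk'' σ)
        (fun i => v ((finSumFinEquiv.trans (finCongr h)) i)))) = fun v =>
      Equiv.Perm.sign σ •
        (α (fun i => v ((finSumFinEquiv.trans (finCongr h)) (σ (Sum.inl i)))) *
         β (fun i => v ((finSumFinEquiv.trans (finCongr h)) (σ (Sum.inr i))))) := by
    funext v
    rw [AlternatingMap.domCoprod.summand_mk'']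
    rcases Int.units_eq_one_or (Equiv.Perm.sign σ) with h | h <;> simp [h]
  rw [h2]
  refine Continuous.const_smul (Continuous.mul ?_ ?_) _
  · exact α.cont.comp (by fun_prop)
  · exact β.cont.comp (by fun_prop)

/-- The exterior product as a bilinear map with values in continuous alternating maps. -/
noncomputable def wedgeHom {a b m : ℕ} (h : a + b = m) :
    (E [⋀^Fin a]→L[ℝ] ℝ) →ₗ[ℝ] (E [⋀^Fin b]→L[ℝ] ℝ) →ₗ[ℝ] (E [⋀^Fin m]→L[ℝ] ℝ) :=
  LinearMap.mk₂ ℝ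
    (fun α β =>
      { toMultilinearMap := (wedgeAlt h α β).toMultilinearMap
        cont := continuous_wedgeAlt h α β
        map_eq_zero_of_eq' := (wedgeAlt h α β).map_eq_zero_of_eq' })
    (fun α₁ α₂ β => by
      ext v
      change wedgeAlt h (α₁ + α₂) β v = wedgeAlt h α₁ β v + wedgeAlt h α₂ β v
      simp only [wedgeAlt, ← AlternatingMap.domCoprod'_apply,
        ContinuousAlternatingMap.toAlternatingMap_add, TensorProduct.add_tmul, map_add]
      simp)
    (fun c α β => by
      ext v
      change wedgeAlt h (c • α) β v = c • wedgeAlt h α β v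
      simp only [wedgeAlt, ← AlternatingMap.domCoprod'_apply,
        ContinuousAlternatingMap.toAlternatingMap_smul, ← TensorProduct.smul_tmul', map_smul]
      simp)
    (fun α β₁ β₂ => by
      ext v
      change wedgeAlt h α (β₁ + β₂) v = wedgeAlt h α β₁ v + wedgeAlt h α β₂ v
      simp only [wedgeAlt, ← AlternatingMap.domCoprod'_apply,
        ContinuousAlternatingMap.toAlternatingMap_add, TensorProduct.tmul_add, map_add]
      simp)
    (fun c α β => by
      ext v
      change wedgeAlt h α (c • β) v = c • wedgeAlt h α β v
      simp only [wedgeAlt, ← AlternatingMap.domCoprod'_apply,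
        ContinuousAlternatingMap.toAlternatingMap_smul, TensorProduct.tmul_smul, map_smul]
      simp)

theorem wedgeHom_comp {a b m : ℕ} (h : a + b = m) (A : E →L[ℝ] E) (α : E [⋀^Fin a]→L[ℝ] ℝ)
    (β : E [⋀^Fin b]→L[ℝ] ℝ) :
    (wedgeHom h α β).compContinuousLinearMap A =
      wedgeHom h (α.compContinuousLinearMap A) (β.compContinuousLinearMap A) := by
  ext v
  change wedgeAlt h α β (A ∘ v) = wedgeAlt h _ _ v
  simp only [wedgeAlt, AlternatingMap.domDomCongr_apply, LinearMap.compAlternatingMap_apply,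
    AlternatingMap.domCoprod_apply, sum_apply]
  congr 1
  refine Finset.sum_congr rfl fun σ _ => ?_
  induction σ using Quotient.inductionOn' with | _ σ
  rfl

/-- The exterior product on `Λ(E*)`. -/
noncomputable def wedge : Ext E →ₗ[ℝ] Ext E →ₗ[ℝ] Ext E :=
  LinearMap.mk₂ ℝ
    (fun α β m => ∑ p : {p : ℕ × ℕ // p ∈ Finset.HasAntidiagonal.antidiagonal m},
      wedgeHom (Finset.HasAntidiagonal.mem_antidiagonal.1 p.2) (α p.1.1) (β p.1.2))
    (fun α₁ α₂ β => by ext1 m; simp [Finset.sum_add_distrib])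
    (fun c α β => by ext1 m; simp [Finset.smul_sum])
    (fun α β₁ β₂ => by ext1 m; simp [Finset.sum_add_distrib])
    (fun c α β => by ext1 m; simp [Finset.smul_sum])

/-- Contraction from the left, `v ⊢ α = α(v, ·, …, ·)`. -/
noncomputable def leftContr : E →ₗ[ℝ] Ext E →ₗ[ℝ] Ext E :=
  LinearMap.mk₂ ℝ (fun v α k => (α (k + 1)).curryLeft v)
    (fun u v α => by ext1 k; simp)
    (fun c v α => by ext1 k; simp)
    (fun v α β => by ext1 k; simp [ContinuousAlternatingMap.curryLeft_add])
    (fun c v α => by ext1 k; simp [ContinuousAlternatingMap.curryLeft_smul])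

/-- Contraction from the right, `α ⊣ v = α(·, …, ·, v)`, which is `(-1)ᵏ v ⊢ α` for `α` of degree
`k + 1`. -/
noncomputable def rightContr : E →ₗ[ℝ] Ext E →ₗ[ℝ] Ext E :=
  LinearMap.mk₂ ℝ (fun v α k => (-1 : ℝ) ^ k • (α (k + 1)).curryLeft v)
    (fun u v α => by ext1 k; simp)
    (fun c v α => by ext1 k; simp [smul_comm c])
    (fun v α β => by ext1 k; simp [ContinuousAlternatingMap.curryLeft_add])
    (fun c v α => by ext1 k; simp [ContinuousAlternatingMap.curryLeft_smul, smul_comm c])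

/-- The pull-back of forms along a linear map. -/
noncomputable def pull (A : E →L[ℝ] E) : Ext E →ₗ[ℝ] Ext E where
  toFun α k := (α k).compContinuousLinearMap A
  map_add' _ _ := by ext; rfl
  map_smul' _ _ := by ext; rfl

theorem wedge_apply (α β : Ext E) (m : ℕ) :
    wedge α β m = ∑ p : {p : ℕ × ℕ // p ∈ Finset.HasAntidiagonal.antidiagonal m},
      wedgeHom (Finset.HasAntidiagonal.mem_antidiagonal.1 p.2) (α p.1.1) (β p.1.2) := rfl

theorem pull_apply (A : E →L[ℝ] E) (α : Ext E) (k : ℕ) :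
    pull A α k = (α k).compContinuousLinearMap A := rfl

theorem pull_wedge (A : E →L[ℝ] E) (α β : Ext E) :
    pull A (wedge α β) = wedge (pull A α) (pull A β) := by
  ext1 m
  have : ∀ f : E [⋀^Fin m]→L[ℝ] ℝ, f.compContinuousLinearMap A =
    ContinuousAlternatingMap.compContinuousLinearMapₗ A f := fun _ => rfl
  rw [pull_apply, wedge_apply, wedge_apply, this, map_sum]
  exact Finset.sum_congr rfl fun p _ => wedgeHom_comp _ A _ _

theorem pull_leftContr (A : E →L[ℝ] E) (v : E) (α : Ext E) :
    pull A (leftContr (A v) α) = leftContr v (pull A α) := by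
  ext1 k
  exact (ContinuousAlternatingMap.curryLeft_compContinuousLinearMap _ _ _).symm

theorem pull_rightContr (A : E →L[ℝ] E) (v : E) (α : Ext E) :
    pull A (rightContr (A v) α) = rightContr v (pull A α) := by
  ext1 k
  change (-1 : ℝ) ^ k • ((α (k + 1)).curryLeft (A v)).compContinuousLinearMap A = _
  rw [← ContinuousAlternatingMap.curryLeft_compContinuousLinearMap]
  rfl

/-- The space `Λ²(E)` of bivectors, as alternating bilinear functions of two covectors. -/
abbrev Bivector (E : Type*) [NormedAddCommGroup E] [NormedSpace ℝ E] : Type _ :=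
  (E →L[ℝ] ℝ) [⋀^Fin 2]→L[ℝ] ℝ

variable [FiniteDimensional ℝ E]

/-- The `i`-th covector `eⁱ` of the basis dual to the basis `(eᵢ) = Module.finBasis ℝ E`. -/
noncomputable def dualVec (i : Fin (Module.finrank ℝ E)) : E →L[ℝ] ℝ :=
  LinearMap.toContinuousLinearMap ((Module.finBasis ℝ E).coord i)

/-- `∑ᵢⱼ wⁱʲ f(eᵢ, eⱼ)`, where `wⁱʲ = w(eⁱ, eʲ)`. For bilinear `f` this does not depend on the
basis. -/
noncomputable def contract {F : Type*} [AddCommMonoid F] [Module ℝ F] (w : Bivector E)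
    (f : E → E → F) : F :=
  ∑ i, ∑ j, w ![dualVec i, dualVec j] • f (Module.finBasis ℝ E i) (Module.finBasis ℝ E j)

/-- Contraction with a bivector, `w ⊢ α = ½ ∑ᵢⱼ wⁱʲ eᵢ ⊢ (eⱼ ⊢ α)`. -/
noncomputable def bivContr (w : Bivector E) : Ext E →ₗ[ℝ] Ext E :=
  (1 / 2 : ℝ) • contract w fun u v => leftContr u ∘ₗ leftContr v

/-- `m(L_wⁿ(α ⊗ β))`, i.e.
`∑ w^{i₁j₁} ⋯ w^{iₙjₙ} (α ⊣ e_{i₁} ⊣ ⋯ ⊣ e_{iₙ}) ∧ (e_{jₙ} ⊢ ⋯ ⊢ e_{j₁} ⊢ β)`. -/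
noncomputable def iterContr (w : Bivector E) : ℕ → Ext E →ₗ[ℝ] Ext E →ₗ[ℝ] Ext E
  | 0 => wedge
  | n + 1 => contract w fun u v =>
      (iterContr w n).compl₁₂ (rightContr u) (leftContr v)

/-- The coefficient of `hⁿ` in `α ∧_h β = m(exp(h L_w)(α ⊗ β))`. -/
noncomputable def wedgeCoeff (w : Bivector E) (n : ℕ) : Ext E →ₗ[ℝ] Ext E →ₗ[ℝ] Ext E :=
  ((n.factorial : ℝ)⁻¹) • iterContr w n

/-- The bivector `(β₀, β₁) ↦ w(β₀ ∘ C, β₁ ∘ C)`, the push-forward of `w` along `C`. -/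
noncomputable def pushBiv (C : E →L[ℝ] E) (w : Bivector E) : Bivector E :=
  w.compContinuousLinearMap ((ContinuousLinearMap.compL ℝ E E ℝ).flip C)

theorem map_contract {F G : Type*} [AddCommMonoid F] [Module ℝ F] [AddCommMonoid G] [Module ℝ G]
    (T : F →ₗ[ℝ] G) (w : Bivector E) (f : E → E → F) :
    T (contract w f) = contract w fun u v => T (f u v) := by
  simp [contract, map_sum]

/-- `w` as a bilinear map of two covectors. -/
noncomputable def bivBilin (w : Bivector E) : (E →L[ℝ] ℝ) →ₗ[ℝ] (E →L[ℝ] ℝ) →ₗ[ℝ] ℝ :=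
  LinearMap.mk₂ ℝ (fun x y => w ![x, y])
    (fun x x' y => by
      simp only [← ContinuousAlternatingMap.curryLeft_apply_apply, map_add]; rfl)
    (fun c x y => by
      simp only [← ContinuousAlternatingMap.curryLeft_apply_apply, map_smul]; rfl)
    (fun x y y' => by
      simp only [← ContinuousAlternatingMap.curryLeft_apply_apply, map_add]; rfl)
    (fun c x y => by
      simp only [← ContinuousAlternatingMap.curryLeft_apply_apply, map_smul]; rfl)

theorem contract_pushBiv {F : Type*} [AddCommMonoid F] [Module ℝ F] (C : E →L[ℝ] E)
    (w : Bivector E) (f : E →ₗ[ℝ] E →ₗ[ℝ] F) :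
    contract (pushBiv C w) (fun u v => f u v) = contract w fun u v => f (C u) (C v) := by
  have hC : ∀ i, (dualVec i : E →L[ℝ] ℝ).comp C =
      ∑ k, (Module.finBasis ℝ E).repr (C (Module.finBasis ℝ E k)) i • dualVec k := by
    intro i
    apply ContinuousLinearMap.coe_injective
    refine (Module.finBasis ℝ E).ext fun l => ?_
    simp [dualVec, Finsupp.single_apply]
  have hw : ∀ i j, pushBiv C w ![dualVec i, dualVec j] =
      bivBilin w ((dualVec i).comp C) ((dualVec j).comp C) := by
    intro i j
    change w _ = w _
    congr 1
    ext t : 1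
    fin_cases t <;> rfl
  have hR : ∀ k, C (Module.finBasis ℝ E k) = ∑ i,
      (Module.finBasis ℝ E).repr (C (Module.finBasis ℝ E k)) i • Module.finBasis ℝ E i :=
    fun k => ((Module.finBasis ℝ E).sum_repr _).symm
  have hr : ∀ k l, f (C (Module.finBasis ℝ E k)) (C (Module.finBasis ℝ E l)) =
      ∑ i, ∑ j, ((Module.finBasis ℝ E).repr (C (Module.finBasis ℝ E k)) i *
        (Module.finBasis ℝ E).repr (C (Module.finBasis ℝ E l)) j) •
          f (Module.finBasis ℝ E i) (Module.finBasis ℝ E j) := by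
    intro k l
    conv_lhs => rw [hR k, hR l]
    simp only [map_sum, map_smul, LinearMap.sum_apply, LinearMap.smul_apply, Finset.smul_sum,
      smul_smul]
    rw [Finset.sum_comm]
    simp only [mul_comm]
  have hbw : ∀ k l, w ![dualVec k, dualVec l] = bivBilin w (dualVec k) (dualVec l) :=
    fun _ _ => rfl
  simp only [contract, hw, hr, hC, hbw, map_sum, map_smul, LinearMap.sum_apply,
    LinearMap.smul_apply, Finset.smul_sum, Finset.sum_smul, smul_smul, smul_eq_mul,
    Finset.mul_sum]
  have e1 : ∀ g : Fin (Module.finrank ℝ E) → Fin (Module.finrank ℝ E) →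
      Fin (Module.finrank ℝ E) → Fin (Module.finrank ℝ E) → F,
      ∑ i, ∑ j, ∑ k, ∑ l, g i j k l = ∑ k, ∑ l, ∑ i, ∑ j, g i j k l := by
    intro g
    calc _ = ∑ i, ∑ k, ∑ j, ∑ l, g i j k l :=
          Finset.sum_congr rfl fun i _ => Finset.sum_comm
      _ = ∑ k, ∑ i, ∑ j, ∑ l, g i j k l := Finset.sum_comm
      _ = ∑ k, ∑ i, ∑ l, ∑ j, g i j k l :=
          Finset.sum_congr rfl fun k _ => Finset.sum_congr rfl fun i _ => Finset.sum_comm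
      _ = _ := Finset.sum_congr rfl fun k _ => Finset.sum_comm
  rw [e1, Finset.sum_comm]
  refine Finset.sum_congr rfl fun i _ => Finset.sum_congr rfl fun j _ => ?_
  refine Finset.sum_congr rfl fun k _ => Finset.sum_congr rfl fun l _ => ?_
  congr 1
  ring

theorem bivContr_apply (w : Bivector E) (α : Ext E) : bivContr w α =
    (1 / 2 : ℝ) • contract w fun u v => leftContr u (leftContr v α) := by
  change LinearMap.applyₗ α (bivContr w) = _
  rw [bivContr, map_smul, map_contract]
  rfl

theorem iterContr_succ_apply (w : Bivector E) (n : ℕ) (α β : Ext E) :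
    iterContr w (n + 1) α β =
      contract w fun u v => iterContr w n (rightContr u α) (leftContr v β) := by
  change LinearMap.applyₗ β (LinearMap.applyₗ α (iterContr w (n + 1))) = _
  rw [iterContr, map_contract, map_contract]
  rfl

theorem pull_bivContr {A C : E →L[ℝ] E} (hAC : A.comp C = .id ℝ E) (w : Bivector E) (α : Ext E) :
    pull A (bivContr w α) = bivContr (pushBiv C w) (pull A α) := by
  have h : ∀ u, A (C u) = u := fun u => congrArg (fun f : E →L[ℝ] E => f u) hAC
  have h2 := contract_pushBiv C w (F := Ext E)
    (leftContr.compl₂ (leftContr.flip (pull A α)))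
  simp only [LinearMap.compl₂_apply, LinearMap.flip_apply] at h2
  rw [bivContr_apply, bivContr_apply, map_smul, map_contract, h2]
  simp only [← pull_leftContr, h]

theorem pull_iterContr {A C : E →L[ℝ] E} (hAC : A.comp C = .id ℝ E) (w : Bivector E) (n : ℕ) :
    ∀ α β : Ext E,
      pull A (iterContr w n α β) = iterContr (pushBiv C w) n (pull A α) (pull A β) := by
  have h : ∀ u, A (C u) = u := fun u => congrArg (fun f : E →L[ℝ] E => f u) hAC
  induction n with
  | zero => exact pull_wedge A
  | succ n ih =>
    intro α β
    have h2 := contract_pushBiv C w (F := Ext E)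
      ((iterContr (pushBiv C w) n).compl₁₂ (rightContr.flip (pull A α))
        (leftContr.flip (pull A β)))
    simp only [LinearMap.compl₁₂_apply, LinearMap.flip_apply] at h2
    rw [iterContr_succ_apply, iterContr_succ_apply, map_contract, h2]
    simp only [← pull_leftContr, ← pull_rightContr, h, ih]

theorem pull_wedgeCoeff {A C : E →L[ℝ] E} (hAC : A.comp C = .id ℝ E) (w : Bivector E) (n : ℕ)
    (α β : Ext E) :
    pull A (wedgeCoeff w n α β) = wedgeCoeff (pushBiv C w) n (pull A α) (pull A β) := by
  simp only [wedgeCoeff, LinearMap.smul_apply, map_smul, pull_iterContr hAC]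

end Fiber

/-! ### Differential forms and bivector fields on a manifold -/

section Manifold

variable {E : Type*} [NormedAddCommGroup E] [NormedSpace ℝ E]
  {M : Type*} [TopologicalSpace M] [ChartedSpace E M]

/-- The coordinate change from the chart at `x₀` to the chart at `x₁`. -/
noncomputable def transition (x₀ x₁ : M) : E → E := chartAt E x₁ ∘ (chartAt E x₀).symm

/-- Its derivative. As for Mathlib's tangent bundle, the tangent space at `x` is identified with
`E` through the preferred chart at `x`; so for `y = chartAt E x₀ x`, the map `jac x₀ x y` takes the
coordinate expression of a tangent vector at `x` in the chart at `x₀` to that vector. -/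
noncomputable def jac (x₀ x₁ : M) (y : E) : E →L[ℝ] E := fderiv ℝ (transition x₀ x₁) y

/-- The coordinate expression in the chart at `x₀` of a (not necessarily smooth) form, i.e. of a
family of elements of `Λ(TₓM*)`. -/
noncomputable def locRep (α : M → Ext E) (x₀ : M) (y : E) : Ext E :=
  pull (jac x₀ ((chartAt E x₀).symm y) y) (α ((chartAt E x₀).symm y))

/-- The coordinate expression in the chart at `x₀` of a family of bivectors. -/
noncomputable def locBiv (w : M → Bivector E) (x₀ : M) (y : E) : Bivector E :=
  pushBiv (jac ((chartAt E x₀).symm y) x₀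
    (chartAt E ((chartAt E x₀).symm y) ((chartAt E x₀).symm y))) (w ((chartAt E x₀).symm y))

variable (E M) in
/-- The space `Ω(M) = ⨁ₖ Ωᵏ(M)` of smooth differential forms: all components are smooth in all
charts. -/
noncomputable def formSubmodule : Submodule ℝ (M → Ext E) where
  carrier := {α | ∀ x₀ k, ContDiffOn ℝ ∞ (fun y => locRep α x₀ y k) (chartAt E x₀).target}
  add_mem' ha hb x₀ k := (ha x₀ k).add (hb x₀ k)
  zero_mem' _ _ := contDiffOn_const (c := 0)
  smul_mem' c _ ha x₀ k := (ha x₀ k).const_smul c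

variable (E M) in
/-- `Ω(M)` as a type. -/
def Form : Type _ := formSubmodule E M

noncomputable instance : AddCommGroup (Form E M) :=
  inferInstanceAs (AddCommGroup (formSubmodule E M))

noncomputable instance : Module ℝ (Form E M) :=
  inferInstanceAs (Module ℝ (formSubmodule E M))

/-- The element `αₓ` of `Λ(TₓM*)`, as a function of `x`. -/
def Form.toFun (α : Form E M) : M → Ext E := Subtype.val (p := (· ∈ formSubmodule E M)) α

theorem Form.smooth (α : Form E M) : α.toFun ∈ formSubmodule E M :=
  Subtype.property (p := (· ∈ formSubmodule E M)) α

variable (E M) in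
/-- Smooth bivector fields on `M`. -/
structure BivectorField where
  toFun : M → Bivector E
  smooth' : ∀ x₀, ContDiffOn ℝ ∞ (locBiv toFun x₀) (chartAt E x₀).target

/-- The exterior derivative: at `x`, Mathlib's exterior derivative of the coordinate expression in
the chart at `x`. -/
noncomputable def dRaw (α : M → Ext E) (x : M) : Ext E
  | 0 => 0
  | k + 1 => extDeriv (fun y => locRep α x y k) (chartAt E x x)

section Coordinates

theorem transition_apply_symm (x₀ : M) (y : E) :
    transition x₀ ((chartAt E x₀).symm y) y =
      chartAt E ((chartAt E x₀).symm y) ((chartAt E x₀).symm y) := rfl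

/-- The part of the target of the chart at `x₀` that lies in the source of the chart at `x₁`. -/
def overlap (x₀ x₁ : M) : Set E :=
  (chartAt E x₀).target ∩ (chartAt E x₀).symm ⁻¹' (chartAt E x₁).source

theorem isOpen_overlap (x₀ x₁ : M) : IsOpen (overlap (E := E) x₀ x₁) :=
  (chartAt E x₀).isOpen_inter_preimage_symm (chartAt E x₁).open_source

theorem mem_overlap_self {x₀ : M} {y : E} (hy : y ∈ (chartAt E x₀).target) :
    y ∈ overlap (E := E) x₀ ((chartAt E x₀).symm y) := ⟨hy, mem_chart_source E _⟩

theorem transition_mem {x₀ x₁ : M} {y : E} (hy : y ∈ overlap x₀ x₁) :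
    transition x₀ x₁ y ∈ overlap (E := E) x₁ x₀ :=
  ⟨(chartAt E x₁).map_source hy.2, by
    simp only [transition, Function.comp, Set.mem_preimage, (chartAt E x₁).left_inv hy.2]
    exact (chartAt E x₀).map_target hy.1⟩

theorem symm_transition {x₀ x₁ : M} {y : E} (hy : y ∈ overlap x₀ x₁) :
    (chartAt E x₁).symm (transition x₀ x₁ y) = (chartAt E x₀).symm y :=
  (chartAt E x₁).left_inv hy.2

theorem transition_self {x₀ : M} {y : E} (hy : y ∈ (chartAt E x₀).target) :
    transition x₀ x₀ y = y := (chartAt E x₀).right_inv hy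

variable [IsManifold 𝓘(ℝ, E) ∞ M]

theorem contDiffOn_transition (x₀ x₁ : M) :
    ContDiffOn ℝ ∞ (transition (E := E) x₀ x₁) (overlap x₀ x₁) := by
  intro y hy
  have := contDiffWithinAt_ext_coord_change (I := 𝓘(ℝ, E)) (n := ∞) x₁ x₀ (y := y)
    (by simpa [overlap] using hy)
  simpa [transition] using this.mono (t := overlap x₀ x₁) (by simp)

theorem contDiffAt_transition {x₀ x₁ : M} {y : E} (hy : y ∈ overlap x₀ x₁) :
    ContDiffAt ℝ ∞ (transition (E := E) x₀ x₁) y :=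
  (contDiffOn_transition x₀ x₁).contDiffAt ((isOpen_overlap x₀ x₁).mem_nhds hy)

theorem jac_self {x₀ : M} {y : E} (hy : y ∈ (chartAt E x₀).target) :
    jac x₀ x₀ y = .id ℝ E := by
  have : transition (E := E) x₀ x₀ =ᶠ[nhds y] id := by
    filter_upwards [(chartAt E x₀).open_target.mem_nhds hy] with z hz using transition_self hz
  rw [jac, this.fderiv_eq, fderiv_id]

theorem jac_comp {x₀ x₁ x₂ : M} {y : E} (h₁ : y ∈ overlap x₀ x₁) (h₂ : y ∈ overlap x₀ x₂) :
    jac x₀ x₂ y = (jac x₁ x₂ (transition x₀ x₁ y)).comp (jac x₀ x₁ y) := by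
  have h₃ : transition x₀ x₁ y ∈ overlap (E := E) x₁ x₂ :=
    ⟨(transition_mem h₁).1, by
      rw [Set.mem_preimage, symm_transition h₁]; exact h₂.2⟩
  have : transition (E := E) x₀ x₂ =ᶠ[nhds y] transition x₁ x₂ ∘ transition x₀ x₁ := by
    filter_upwards [(isOpen_overlap x₀ x₁).mem_nhds h₁] with z hz
    simp only [Function.comp]
    rw [transition, Function.comp, ← symm_transition hz]
    rfl
  rw [jac, this.fderiv_eq, fderiv_comp]
  · rfl
  · exact (contDiffAt_transition h₃).differentiableAt (by simp)
  · exact (contDiffAt_transition h₁).differentiableAt (by simp)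

theorem contDiffOn_jac (x₀ x₁ : M) : ContDiffOn ℝ ∞ (jac (E := E) x₀ x₁) (overlap x₀ x₁) :=
  (contDiffOn_transition x₀ x₁).fderiv_of_isOpen (isOpen_overlap x₀ x₁)
    (m := ∞) (by rfl)

/-- The two coordinate changes between the chart at `x₀` and the one at the point are inverse. -/
theorem jac_comp_inv {x₀ : M} {y : E} (hy : y ∈ (chartAt E x₀).target) :
    (jac x₀ ((chartAt E x₀).symm y) y).comp (jac ((chartAt E x₀).symm y) x₀
      (chartAt E ((chartAt E x₀).symm y) ((chartAt E x₀).symm y))) = .id ℝ E := by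
  have h := transition_mem (mem_overlap_self hy)
  rw [transition_apply_symm] at h
  have h2 : transition ((chartAt E x₀).symm y) x₀
      (chartAt E ((chartAt E x₀).symm y) ((chartAt E x₀).symm y)) = y := by
    simp only [transition, Function.comp]
    rw [(chartAt E _).left_inv (mem_chart_source E _), (chartAt E x₀).right_inv hy]
  have h3 := jac_comp h (x₂ := (chartAt E x₀).symm y)
    ⟨h.1, by
      rw [Set.mem_preimage, (chartAt E _).left_inv (mem_chart_source E _)]
      exact mem_chart_source E _⟩
  rw [h2] at h3
  rw [← h3, jac_self h.1]

theorem jac_inv_comp {x₀ : M} {y : E} (hy : y ∈ (chartAt E x₀).target) :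
    (jac ((chartAt E x₀).symm y) x₀
      (chartAt E ((chartAt E x₀).symm y) ((chartAt E x₀).symm y))).comp
      (jac x₀ ((chartAt E x₀).symm y) y) = .id ℝ E := by
  have h3 := jac_comp (mem_overlap_self hy) (x₂ := x₀) ⟨hy, (chartAt E x₀).map_target hy⟩
  rw [transition_apply_symm] at h3
  rw [← h3, jac_self hy]

theorem pull_comp (A B : E →L[ℝ] E) (α : Ext E) : pull B (pull A α) = pull (A.comp B) α := rfl

theorem locRep_change (α : M → Ext E) {x₀ x₁ : M} {y : E} (hy : y ∈ overlap x₀ x₁) :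
    locRep α x₀ y = pull (jac x₀ x₁ y) (locRep α x₁ (transition x₀ x₁ y)) := by
  rw [locRep, locRep, pull_comp, symm_transition hy, ← jac_comp hy (mem_overlap_self hy.1)]

theorem locRep_dRaw_succ {α : M → Ext E} (hα : α ∈ formSubmodule E M) (x₀ : M) (k : ℕ) {y : E}
    (hy : y ∈ (chartAt E x₀).target) :
    locRep (dRaw α) x₀ y (k + 1) = extDeriv (fun y => locRep α x₀ y k) y := by
  have hx := mem_overlap_self hy
  have h1 : (fun z => locRep α x₀ z k) =ᶠ[nhds y] fun z =>
      (locRep α ((chartAt E x₀).symm y) (transition x₀ ((chartAt E x₀).symm y) z)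
        k).compContinuousLinearMap (fderiv ℝ (transition x₀ ((chartAt E x₀).symm y)) z) := by
    filter_upwards [(isOpen_overlap x₀ ((chartAt E x₀).symm y)).mem_nhds hx] with z hz
    rw [locRep_change α hz]
    rfl
  have h2 : DifferentiableAt ℝ (fun z => locRep α ((chartAt E x₀).symm y) z k)
      (transition x₀ ((chartAt E x₀).symm y) y) :=
    ((hα _ k).contDiffAt ((chartAt E _).open_target.mem_nhds
      (transition_mem hx).1)).differentiableAt (by simp)
  rw [h1.extDeriv_eq, extDeriv_pullback h2 (contDiffAt_transition hx) (r := ∞)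
    (by simp only [minSmoothness_of_isRCLikeNormedField]; exact WithTop.coe_le_coe.2 (le_top : (2 : ℕ∞) ≤ ⊤))]
  rfl

theorem dRaw_mem {α : M → Ext E} (hα : α ∈ formSubmodule E M) : dRaw α ∈ formSubmodule E M := by
  intro x₀ k
  cases k with
  | zero => exact contDiffOn_const (c := 0)
  | succ k =>
    refine ContDiffOn.congr ?_ fun y hy => locRep_dRaw_succ hα x₀ k hy
    exact (ContinuousAlternatingMap.alternatizeUncurryFinCLM ℝ E ℝ).contDiff.comp_contDiffOn
      ((hα x₀ k).fderiv_of_isOpen (chartAt E x₀).open_target (m := ∞) (by rfl))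

end Coordinates

section Smoothness

variable [FiniteDimensional ℝ E]

/-- Smoothness of a family of elements of `Λ(E*)` on a subset of `E`. -/
def SmoothOn (f : E → Ext E) (U : Set E) : Prop := ∀ k, ContDiffOn ℝ ∞ (fun y => f y k) U

variable {f g : E → Ext E} {w : E → Bivector E} {U : Set E}

theorem SmoothOn.leftContr (hf : SmoothOn f U) (v : E) :
    SmoothOn (fun y => leftContr v (f y)) U := fun k =>
  ((ContinuousLinearMap.apply ℝ (E [⋀^Fin k]→L[ℝ] ℝ) v).comp
    (ContinuousAlternatingMap.curryLeftLI (𝕜 := ℝ) (E := E) (F := ℝ)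
      (n := k)).toContinuousLinearMap).contDiff.comp_contDiffOn (hf (k + 1))

theorem SmoothOn.rightContr (hf : SmoothOn f U) (v : E) :
    SmoothOn (fun y => rightContr v (f y)) U := fun k =>
  ((hf.leftContr v) k).const_smul ((-1 : ℝ) ^ k)

theorem SmoothOn.wedge (hf : SmoothOn f U) (hg : SmoothOn g U) :
    SmoothOn (fun y => wedge (f y) (g y)) U := fun m => by
  simp only [wedge_apply]
  refine ContDiffOn.sum fun p _ => ?_
  exact ((wedgeHom (E := E) (Finset.HasAntidiagonal.mem_antidiagonal.1
    p.2)).toContinuousBilinearMap.contDiff.comp_contDiffOn (hf p.1.1)).clm_apply (hg p.1.2)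

theorem SmoothOn.contract (hw : ContDiffOn ℝ ∞ w U) {F : E → E → E → Ext E}
    (hF : ∀ u v, SmoothOn (fun y => F y u v) U) :
    SmoothOn (fun y => contract (w y) (F y)) U := fun k => by
  simp only [QuantumDeRham.contract, Finset.sum_apply, Pi.smul_apply]
  refine ContDiffOn.sum fun i _ => ContDiffOn.sum fun j _ => ?_
  refine ContDiffOn.smul (f := fun y => w y ![dualVec i, dualVec j]) ?_ (hF _ _ k)
  exact (ContinuousAlternatingMap.apply ℝ (E →L[ℝ] ℝ) ℝ
    ![dualVec i, dualVec j]).contDiff.comp_contDiffOn hw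

theorem SmoothOn.bivContr (hw : ContDiffOn ℝ ∞ w U) (hf : SmoothOn f U) :
    SmoothOn (fun y => bivContr (w y) (f y)) U := fun k => by
  simp only [bivContr_apply]
  exact (SmoothOn.contract hw (F := fun y u v => QuantumDeRham.leftContr u
    (QuantumDeRham.leftContr v (f y)))
    (fun u v => (hf.leftContr v).leftContr u) k).const_smul (1 / 2 : ℝ)

theorem SmoothOn.iterContr (hw : ContDiffOn ℝ ∞ w U) (n : ℕ) : ∀ {f g : E → Ext E},
    SmoothOn f U → SmoothOn g U → SmoothOn (fun y => iterContr (w y) n (f y) (g y)) U := by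
  induction n with
  | zero => exact fun hf hg => hf.wedge hg
  | succ n ih =>
    intro f g hf hg
    simp only [iterContr_succ_apply]
    exact SmoothOn.contract hw fun u v => ih (hf.rightContr u) (hg.leftContr v)

theorem SmoothOn.wedgeCoeff (hw : ContDiffOn ℝ ∞ w U) (n : ℕ) (hf : SmoothOn f U)
    (hg : SmoothOn g U) : SmoothOn (fun y => wedgeCoeff (w y) n (f y) (g y)) U := fun k =>
  (SmoothOn.iterContr hw n hf hg k).const_smul ((n.factorial : ℝ)⁻¹)

theorem wedge_mem {α β : M → Ext E} (hα : α ∈ formSubmodule E M) (hβ : β ∈ formSubmodule E M) :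
    (fun x => wedge (α x) (β x)) ∈ formSubmodule E M := fun x₀ => by
  have : locRep (fun x => wedge (α x) (β x)) x₀ =
      fun y => wedge (locRep α x₀ y) (locRep β x₀ y) := funext fun y => pull_wedge _ _ _
  rw [this]
  exact SmoothOn.wedge (hα x₀) (hβ x₀)

variable [IsManifold 𝓘(ℝ, E) ∞ M]

theorem bivContr_mem (w : BivectorField E M) {α : M → Ext E} (hα : α ∈ formSubmodule E M) :
    (fun x => bivContr (w.toFun x) (α x)) ∈ formSubmodule E M := fun x₀ k => by
  refine (SmoothOn.bivContr (w.smooth' x₀) (hα x₀) k).congr fun y hy => ?_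
  exact congrFun (pull_bivContr (jac_comp_inv hy) _ _) k

theorem wedgeCoeff_mem (w : BivectorField E M) (n : ℕ) {α β : M → Ext E} (hα : α ∈ formSubmodule E M)
    (hβ : β ∈ formSubmodule E M) : (fun x => wedgeCoeff (w.toFun x) n (α x) (β x)) ∈ formSubmodule E M :=
  fun x₀ k => by
  refine (SmoothOn.wedgeCoeff (w.smooth' x₀) n (hα x₀) (hβ x₀) k).congr fun y hy => ?_
  exact congrFun (pull_wedgeCoeff (jac_comp_inv hy) _ n _ _) k

end Smoothness

/-! ### The operators on `Ω(M)` -/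

section Operators

/-- The constant function `1`, as a form. -/
noncomputable def oneForm : Form E M :=
  ⟨fun _ k => match k with
    | 0 => ContinuousAlternatingMap.constOfIsEmpty ℝ E (Fin 0) 1
    | _ + 1 => 0, fun _ k => match k with
    | 0 => contDiffOn_const (c := ContinuousAlternatingMap.constOfIsEmpty ℝ E (Fin 0) 1)
    | _ + 1 => contDiffOn_const (c := 0)⟩

variable (E M) in
/-- The subspace `Ωⁿ(M)` of `Ω(M)`, which is zero for `n < 0`. -/
def formDeg (n : ℤ) : Submodule ℝ (Form E M) where
  carrier := {α | ∀ x (k : ℕ), (k : ℤ) ≠ n → α.toFun x k = 0}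
  add_mem' {a b} ha hb x k hk := by
    change a.toFun x k + b.toFun x k = 0
    rw [ha x k hk, hb x k hk, add_zero]
  zero_mem' _ _ _ := rfl
  smul_mem' c a ha x k hk := by
    change c • a.toFun x k = 0
    rw [ha x k hk, smul_zero]

/-- The parity involution `α ↦ (-1)^{|α|} α`. -/
noncomputable def parity : Form E M →ₗ[ℝ] Form E M where
  toFun α := ⟨fun x k => (-1 : ℝ) ^ k • α.toFun x k,
    fun x₀ k => (α.smooth x₀ k).const_smul ((-1 : ℝ) ^ k)⟩
  map_add' _ _ := Subtype.ext <| funext fun _ => funext fun _ => smul_add _ _ _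
  map_smul' c α := Subtype.ext <| funext fun x => funext fun k =>
    smul_comm ((-1 : ℝ) ^ k) c (α.toFun x k)

variable [FiniteDimensional ℝ E]

/-- The exterior product of forms. -/
noncomputable def formWedge : Form E M →ₗ[ℝ] Form E M →ₗ[ℝ] Form E M :=
  LinearMap.mk₂ ℝ (fun α β => ⟨fun x => wedge (α.toFun x) (β.toFun x), wedge_mem α.smooth β.smooth⟩)
    (fun _ _ _ => Subtype.ext <| funext fun _ => LinearMap.map_add₂ _ _ _ _)
    (fun _ _ _ => Subtype.ext <| funext fun _ => LinearMap.map_smul₂ _ _ _ _)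
    (fun _ _ _ => Subtype.ext <| funext fun _ => map_add _ _ _)
    (fun c _ _ => Subtype.ext <| funext fun _ => map_smul _ c _)

variable [IsManifold 𝓘(ℝ, E) ∞ M]

/-- The exterior derivative `d` on `Ω(M)`. -/
noncomputable def extDer : Form E M →ₗ[ℝ] Form E M where
  toFun α := ⟨dRaw α.toFun, dRaw_mem α.smooth⟩
  map_add' α β := by
    refine Subtype.ext <| funext fun x => funext fun k => ?_
    cases k with
    | zero => exact (add_zero _).symm
    | succ k =>
      exact extDeriv_add (ω₁ := fun y => locRep α.toFun x y k) (ω₂ := fun y => locRep β.toFun x y k)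
        (((α.smooth x k).contDiffAt ((chartAt E x).open_target.mem_nhds
          (mem_chart_target E x))).differentiableAt (by simp))
        (((β.smooth x k).contDiffAt ((chartAt E x).open_target.mem_nhds
          (mem_chart_target E x))).differentiableAt (by simp))
  map_smul' c α := by
    refine Subtype.ext <| funext fun x => funext fun k => ?_
    cases k with
    | zero => exact (smul_zero c).symm
    | succ k => exact extDeriv_smul c (fun y => locRep α.toFun x y k)

/-- Contraction of forms with a bivector field. -/
noncomputable def formContr (w : BivectorField E M) : Form E M →ₗ[ℝ] Form E M where
  toFun α := ⟨fun x => bivContr (w.toFun x) (α.toFun x), bivContr_mem w α.smooth⟩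
  map_add' _ _ := Subtype.ext <| funext fun _ => map_add _ _ _
  map_smul' c _ := Subtype.ext <| funext fun _ => map_smul _ c _

/-- Koszul's codifferential `δα = w ⊢ dα - d(w ⊢ α)`. -/
noncomputable def codiff (w : BivectorField E M) : Form E M →ₗ[ℝ] Form E M :=
  formContr w ∘ₗ extDer - extDer ∘ₗ formContr w

/-- The coefficient of `hⁿ` in the fibrewise quantum exterior product `α ∧_h β`. -/
noncomputable def formWedgeCoeff (w : BivectorField E M) (n : ℕ) :
    Form E M →ₗ[ℝ] Form E M →ₗ[ℝ] Form E M :=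
  LinearMap.mk₂ ℝ (fun α β => ⟨fun x => wedgeCoeff (w.toFun x) n (α.toFun x) (β.toFun x),
      wedgeCoeff_mem w n α.smooth β.smooth⟩)
    (fun _ _ _ => Subtype.ext <| funext fun _ => LinearMap.map_add₂ _ _ _ _)
    (fun _ _ _ => Subtype.ext <| funext fun _ => LinearMap.map_smul₂ _ _ _ _)
    (fun _ _ _ => Subtype.ext <| funext fun _ => map_add _ _ _)
    (fun c _ _ => Subtype.ext <| funext fun _ => map_smul _ c _)

/-! ### The quantum de Rham complex `Ω(M)[h]`, where `h` is the variable `X` of `ℝ[X]` -/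

variable (E M) in
/-- `Ω(M)[h] = ℝ[h] ⊗ Ω(M)`. -/
abbrev QForm : Type _ := ℝ[X] ⊗[ℝ] Form E M

/-- `α ∧_h β = ∑ₙ hⁿ ⊗ (n-th coefficient)` for `α, β ∈ Ω(M)`; the coefficients with `n > dim E`
vanish. -/
noncomputable def qWedgeAux (w : BivectorField E M) :
    Form E M →ₗ[ℝ] Form E M →ₗ[ℝ] QForm E M :=
  ∑ n ∈ Finset.range (Module.finrank ℝ E + 1),
    (formWedgeCoeff w n).compr₂ (TensorProduct.mk ℝ ℝ[X] (Form E M) (Polynomial.X ^ n))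

/-- The quantum exterior product `∧_h` on `Ω(M)[h]`: the `ℝ[h]`-bilinear extension. -/
noncomputable def qWedge (w : BivectorField E M) :
    QForm E M →ₗ[ℝ[X]] QForm E M →ₗ[ℝ[X]] QForm E M :=
  LinearMap.liftBaseChange ℝ[X]
    ((LinearMap.liftBaseChangeEquiv ℝ[X]).toLinearMap.restrictScalars ℝ ∘ₗ qWedgeAux w)

/-- The quantum exterior differential `d_h = d - h δ`. -/
noncomputable def qD (w : BivectorField E M) : QForm E M →ₗ[ℝ[X]] QForm E M :=
  extDer.baseChange ℝ[X] - (Polynomial.X : ℝ[X]) • (codiff w).baseChange ℝ[X]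

variable (E M) in
/-- The double complex `C^{p,q} = hᵖ Ω^{q-p}(M)` for `p ≥ 0`, and `C^{p,q} = 0` for `p < 0`. -/
noncomputable def dblComplex (p q : ℤ) : Submodule ℝ (QForm E M) :=
  if 0 ≤ p then (formDeg E M (q - p)).map
    (TensorProduct.mk ℝ ℝ[X] (Form E M) (Polynomial.X ^ p.toNat)) else ⊥

end Operators

end Manifold

/-! ### Kähler manifolds -/

section Kahler

section Sharp

variable {E : Type*} [NormedAddCommGroup E] [NormedSpace ℝ E] [FiniteDimensional ℝ E]

/-- The linear map `v ↦ σ(·, v)` from vectors to covectors. -/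
noncomputable def flat : (E [⋀^Fin 2]→L[ℝ] ℝ) →ₗ[ℝ] E →L[ℝ] E →L[ℝ] ℝ where
  toFun σ := (LinearMap.mk₂ ℝ (fun v u => σ ![u, v])
    (fun v v' u => by
      simp only [← ContinuousAlternatingMap.curryLeft_apply_apply, map_add]; rfl)
    (fun c v u => by
      simp only [← ContinuousAlternatingMap.curryLeft_apply_apply, map_smul]; rfl)
    (fun v u u' => by
      simp only [← ContinuousAlternatingMap.curryLeft_apply_apply, map_add]; rfl)
    (fun c v u => by
      simp only [← ContinuousAlternatingMap.curryLeft_apply_apply, map_smul]; rfl)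
    ).toContinuousBilinearMap
  map_add' _ _ := by ext; rfl
  map_smul' _ _ := by ext; rfl

theorem flat_apply (σ : E [⋀^Fin 2]→L[ℝ] ℝ) (v u : E) : flat σ v u = σ ![u, v] := rfl

theorem inverse_flat_self (σ : E [⋀^Fin 2]→L[ℝ] ℝ) (β : E →L[ℝ] ℝ) :
    β ((flat σ).inverse β) = 0 := by
  by_cases h : (flat σ).IsInvertible
  · obtain ⟨e, he⟩ := h
    rw [← he, ContinuousLinearMap.inverse_equiv]
    have h1 : β = flat σ (e.symm β) := by rw [← he]; simp
    calc β (e.symm β) = flat σ (e.symm β) (e.symm β) := by rw [← h1]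
      _ = 0 := by
        rw [flat_apply]
        exact σ.map_eq_zero_of_eq _ (i := 0) (j := 1) rfl (by decide)
  · rw [ContinuousLinearMap.inverse_of_not_isInvertible h]; simp

/-- For `S : E* → E`, the alternating function `½ (β₀(S β₁) - β₁(S β₀))` of two covectors. -/
noncomputable def altOf : ((E →L[ℝ] ℝ) →L[ℝ] E) →ₗ[ℝ] Bivector E where
  toFun S :=
    { toFun := fun β => (1 / 2 : ℝ) * (β 0 (S (β 1)) - β 1 (S (β 0)))
      map_update_add' := fun β i x y => by
        fin_cases i <;> simp [Function.update] <;> ring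
      map_update_smul' := fun β i c x => by
        fin_cases i <;> simp [Function.update] <;> ring
      map_eq_zero_of_eq' := fun β i j h hij => by
        fin_cases i <;> fin_cases j <;> simp_all
      cont := by fun_prop }
  map_add' S T := by
    ext β
    change (1 / 2 : ℝ) * (β 0 (S (β 1) + T (β 1)) - β 1 (S (β 0) + T (β 0))) =
      (1 / 2 : ℝ) * (β 0 (S (β 1)) - β 1 (S (β 0))) +
      (1 / 2 : ℝ) * (β 0 (T (β 1)) - β 1 (T (β 0)))
    rw [map_add, map_add]
    ring
  map_smul' c S := by
    ext β
    change (1 / 2 : ℝ) * (β 0 (c • S (β 1)) - β 1 (c • S (β 0))) =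
      c * ((1 / 2 : ℝ) * (β 0 (S (β 1)) - β 1 (S (β 0))))
    rw [map_smul, map_smul, smul_eq_mul, smul_eq_mul]
    ring

theorem contDiff_of_linear {X Y : Type*} [NormedAddCommGroup X] [NormedSpace ℝ X]
    [FiniteDimensional ℝ X] [NormedAddCommGroup Y] [NormedSpace ℝ Y] (f : X →ₗ[ℝ] Y) :
    ContDiff ℝ ∞ f := by
  have h := ContinuousLinearMap.contDiff (n := ∞) (LinearMap.toContinuousLinearMap f)
  exact h

theorem contDiff_altOf : ContDiff ℝ ∞ (altOf (E := E)) :=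
  contDiff_of_linear (X := (E →L[ℝ] ℝ) →L[ℝ] E) (Y := Bivector E) altOf

theorem contDiff_flat : ContDiff ℝ ∞ (flat (E := E)) :=
  contDiff_of_linear (X := E [⋀^Fin 2]→L[ℝ] ℝ) (Y := E →L[ℝ] E →L[ℝ] ℝ) flat

/-- The bivector `w` inverse to a nondegenerate 2-form `σ`: with `σ(v, β^♯) = β(v)`, it is
`w(β₀, β₁) = β₀(β₁^♯)`, so that the matrix `wⁱʲ = w(eⁱ, eʲ)` is the inverse of the matrix
`σᵢⱼ = σ(eᵢ, eⱼ)`. -/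
noncomputable def invBiv (σ : E [⋀^Fin 2]→L[ℝ] ℝ) : Bivector E where
  toFun β := β 0 ((flat σ).inverse (β 1))
  map_update_add' β i x y := by fin_cases i <;> simp [Function.update]
  map_update_smul' β i c x := by fin_cases i <;> simp [Function.update]
  map_eq_zero_of_eq' β i j h hij := by
    have h01 : β 0 = β 1 := by
      fin_cases i <;> fin_cases j <;> simp_all
    rw [h01]
    exact inverse_flat_self σ _
  cont := by fun_prop

theorem invBiv_eq (σ : E [⋀^Fin 2]→L[ℝ] ℝ) : invBiv σ = altOf (flat σ).inverse := by
  ext β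
  have h : ∀ x y : E →L[ℝ] ℝ, x ((flat σ).inverse y) = - y ((flat σ).inverse x) := by
    intro x y
    have := inverse_flat_self σ (x + y)
    simp only [map_add, add_apply, inverse_flat_self] at this
    linarith
  change β 0 ((flat σ).inverse (β 1)) =
    (1 / 2 : ℝ) * (β 0 ((flat σ).inverse (β 1)) - β 1 ((flat σ).inverse (β 0)))
  rw [h (β 1) (β 0)]
  ring

theorem flat_comp (σ : E [⋀^Fin 2]→L[ℝ] ℝ) (A : E →L[ℝ] E) (v u : E) :
    flat (σ.compContinuousLinearMap A) v u = flat σ (A v) (A u) := by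
  rw [flat_apply, flat_apply, ContinuousAlternatingMap.compContinuousLinearMap_apply]
  congr 1
  ext t : 1
  fin_cases t <;> rfl

theorem isInvertible_of_nondegenerate {σ : E [⋀^Fin 2]→L[ℝ] ℝ}
    (h : ∀ v, (∀ u, σ ![u, v] = 0) → v = 0) : (flat σ).IsInvertible := by
  have hi : Function.Injective (flat σ) :=
    (injective_iff_map_eq_zero _).2 fun v hv => h v fun u => by
      rw [← flat_apply, hv]; rfl
  have hd : Module.finrank ℝ E = Module.finrank ℝ (E →L[ℝ] ℝ) := by
    rw [← (LinearMap.toContinuousLinearMap (𝕜 := ℝ) (E := E) (F' := ℝ)).finrank_eq]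
    exact (Subspace.dual_finrank_eq).symm
  exact ⟨(LinearEquiv.ofInjectiveOfFinrankEq (flat σ).toLinearMap hi
    hd).toContinuousLinearEquiv, by ext; rfl⟩

theorem pushBiv_invBiv {σ : E [⋀^Fin 2]→L[ℝ] ℝ} (hσ : (flat σ).IsInvertible)
    {A C : E →L[ℝ] E} (hAC : A.comp C = .id ℝ E) (hCA : C.comp A = .id ℝ E) :
    (flat (σ.compContinuousLinearMap A)).IsInvertible ∧
      pushBiv C (invBiv σ) = invBiv (σ.compContinuousLinearMap A) := by
  have h1 : ∀ u, A (C u) = u := fun u => congrArg (fun f : E →L[ℝ] E => f u) hAC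
  have h2 : ∀ u, C (A u) = u := fun u => congrArg (fun f : E →L[ℝ] E => f u) hCA
  obtain ⟨e, he⟩ := hσ
  have h3 : ∀ v u, σ ![u, v] = e v u := fun v u => by rw [← flat_apply, ← he]; rfl
  have hi : (flat (σ.compContinuousLinearMap A)).IsInvertible := by
    refine isInvertible_of_nondegenerate fun v hv => ?_
    have : e (A v) = 0 := by
      ext u
      have := hv (C u)
      rw [← flat_apply, flat_comp, h1, flat_apply, h3] at this
      exact this
    rw [← h2 v, (map_eq_zero_iff e e.injective).1 this, map_zero]
  refine ⟨hi, ?_⟩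
  ext β
  change (β 0) (C ((flat σ).inverse ((β 1).comp C))) =
    β 0 ((flat (σ.compContinuousLinearMap A)).inverse (β 1))
  congr 1
  obtain ⟨e', he'⟩ := hi
  rw [← he', ContinuousLinearMap.inverse_equiv, ← he, ContinuousLinearMap.inverse_equiv]
  apply e'.injective
  change e' _ = e' (e'.symm (β 1))
  rw [e'.apply_symm_apply]
  ext u
  have h4 : ∀ v, (e' : E →L[ℝ] E →L[ℝ] ℝ) v u = σ ![A u, A v] := fun v => by
    rw [he', flat_comp, flat_apply]
  refine (h4 _).trans ?_
  rw [h1, h3]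
  change (e (e.symm ((β 1).comp C))) (A u) = _
  rw [e.apply_symm_apply]
  change β 1 (C (A u)) = _
  rw [h2]

end Sharp

variable {E : Type*} [NormedAddCommGroup E] [NormedSpace ℂ E]
  {M : Type*} [TopologicalSpace M] [ChartedSpace E M]

/-- A complex manifold (an atlas with holomorphic coordinate changes) is a smooth manifold. -/
instance [IsManifold 𝓘(ℂ, E) ∞ M] : IsManifold 𝓘(ℝ, E) ∞ M := by
  refine isManifold_of_contDiffOn 𝓘(ℝ, E) ∞ M fun e e' he he' => ?_
  have h := HasGroupoid.compatible (G := contDiffGroupoid ∞ 𝓘(ℂ, E)) he he'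
  have h' := ((contDiffGroupoid ∞ 𝓘(ℂ, E)).mem_iff_of_eqOnSource (Setoid.refl _)).1 h
  rw [contDiffGroupoid, mem_groupoid_of_pregroupoid] at h'
  have h'' := h'.1
  simp only [contDiffPregroupoid] at h''
  exact ContDiffOn.restrict_scalars ℝ (by simpa using h'')

variable (E M) in
/-- A Kähler structure on the complex manifold `M`, given by its Kähler form: a smooth closed real
2-form `σ` such that `σ(Ju, Jv) = σ(u, v)` and `σ(u, Ju) > 0` for `u ≠ 0`. The tangent space at `x`
is identified with `E` through the chart at `x`, and as all coordinate changes are holomorphic,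
its complex structure `J` is multiplication by `i` on `E`. -/
structure KahlerForm [FiniteDimensional ℂ E] [IsManifold 𝓘(ℂ, E) ∞ M] where
  form : Form E M
  deg_two : form ∈ formDeg E M 2
  closed : extDer form = 0
  invariant : ∀ (x : M) (u v : E),
    form.toFun x 2 ![Complex.I • u, Complex.I • v] = form.toFun x 2 ![u, v]
  pos : ∀ (x : M) (u : E), u ≠ 0 → 0 < form.toFun x 2 ![u, Complex.I • u]

variable [FiniteDimensional ℂ E] [IsManifold 𝓘(ℂ, E) ∞ M]

theorem KahlerForm.isInvertible (σ : KahlerForm E M) (x : M) :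
    (flat (σ.form.toFun x 2)).IsInvertible := by
  refine isInvertible_of_nondegenerate fun v hv => ?_
  by_contra hne
  have h1 := σ.pos x v hne
  have h2 := hv (Complex.I • v)
  have h3 := (σ.form.toFun x 2).map_swap ![v, Complex.I • v] (i := 0) (j := 1) (by decide)
  have h4 : ![v, Complex.I • v] ∘ Equiv.swap (0 : Fin 2) 1 = ![Complex.I • v, v] := by
    ext t : 1
    fin_cases t <;> rfl
  rw [h4] at h3
  change σ.form.toFun x 2 ![Complex.I • v, v] = - σ.form.toFun x 2 ![v, Complex.I • v] at h3
  rw [h2] at h3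
  linarith

/-- The Poisson bivector field `w` of a Kähler manifold, the inverse of its Kähler form. -/
noncomputable def KahlerForm.bivector (σ : KahlerForm E M) : BivectorField E M where
  toFun x := invBiv (σ.form.toFun x 2)
  smooth' x₀ := by
    have key : ∀ y ∈ (chartAt E x₀).target,
        (flat (locRep σ.form.toFun x₀ y 2)).IsInvertible ∧
          locBiv (fun x => invBiv (σ.form.toFun x 2)) x₀ y = invBiv (locRep σ.form.toFun x₀ y 2) :=
      fun y hy => pushBiv_invBiv (σ.isInvertible _) (jac_comp_inv hy) (jac_inv_comp hy)
    refine ContDiffOn.congr ?_ fun y hy => (key y hy).2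
    simp only [invBiv_eq]
    refine contDiff_altOf.comp_contDiffOn ?_
    intro y hy
    obtain ⟨e, he⟩ := (key y hy).1
    have h1 : ContDiffWithinAt ℝ ∞ (fun y => flat (locRep σ.form.toFun x₀ y 2))
        (chartAt E x₀).target y :=
      (contDiff_flat.comp_contDiffOn (σ.form.smooth x₀ 2)) y hy
    have h2 : ContDiffAt ℝ ∞ ContinuousLinearMap.inverse (flat (locRep σ.form.toFun x₀ y 2)) := by
      rw [← he]
      exact contDiffAt_map_inverse e
    exact h2.comp_contDiffWithinAt y h1

end Kahler

/-! ### Differential graded algebras and their cohomology -/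

section DGA

variable {k R K : Type*} [Field k] [CommRing R] [Algebra k R] [AddCommGroup K] [Module k K]
  [Module R K] [IsScalarTower k R K]

variable (k) in
/-- `(K, D, mul)` is a differential graded `R`-algebra with unit `one` and grading `gr` (by
subspaces over `k ⊆ R`; the scalars in `R` need not have degree 0). The map `s` is the parity
involution of the grading. -/
structure IsDGA (gr : ℤ → Submodule k K) (D : K →ₗ[R] K) (mul : K →ₗ[R] K →ₗ[R] K) (one : K)
    (s : K →ₗ[R] K) : Prop where
  internal : DirectSum.IsInternal gr
  one_mem : one ∈ gr 0
  mul_mem : ∀ {i j : ℤ} {x y : K}, x ∈ gr i → y ∈ gr j → mul x y ∈ gr (i + j)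
  one_mul : ∀ x, mul one x = x
  mul_one : ∀ x, mul x one = x
  mul_assoc : ∀ x y z, mul (mul x y) z = mul x (mul y z)
  D_mem : ∀ {n : ℤ} {x : K}, x ∈ gr n → D x ∈ gr (n + 1)
  D_D : ∀ x, D (D x) = 0
  s_apply : ∀ {n : ℤ} {x : K}, x ∈ gr n → s x = ((-1 : k) ^ n) • x
  leibniz : ∀ x y, D (mul x y) = mul (D x) y + mul (s x) (D y)

namespace IsDGA

variable {gr : ℤ → Submodule k K} {D : K →ₗ[R] K} {mul : K →ₗ[R] K →ₗ[R] K} {one : K}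
  {s : K →ₗ[R] K}

theorem D_one (h : IsDGA k gr D mul one s) : D one = 0 := by
  have h1 := h.leibniz one one
  rw [h.s_apply h.one_mem, h.mul_one, h.mul_one, zpow_zero, one_smul, h.one_mul] at h1
  simpa using h1

theorem D_s (h : IsDGA k gr D mul one s) (x : K) : D (s x) = - s (D x) := by
  have hx : x ∈ ⨆ n, gr n := by rw [h.internal.submodule_iSup_eq_top]; trivial
  induction hx using Submodule.iSup_induction' with
  | mem n x hx =>
    rw [h.s_apply hx, h.s_apply (h.D_mem hx), D.map_smul_of_tower, zpow_add₀ (by simp), zpow_one,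
      mul_neg, _root_.mul_one, neg_smul, neg_neg]
  | zero => simp
  | add x y _ _ hx hy => rw [map_add, map_add, map_add, map_add, hx, hy, neg_add]

theorem mul_cocycle (h : IsDGA k gr D mul one s) {x y : K} (hx : D x = 0) (hy : D y = 0) :
    D (mul x y) = 0 := by
  rw [h.leibniz, hx, hy]; simp

theorem mul_D (h : IsDGA k gr D mul one s) {x : K} (hx : D x = 0) (y : K) :
    D (mul (s x) y) = mul (s (s x)) (D y) := by
  rw [h.leibniz, h.D_s, hx]; simp

theorem s_s (h : IsDGA k gr D mul one s) (x : K) : s (s x) = x := by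
  have hx : x ∈ ⨆ n, gr n := by rw [h.internal.submodule_iSup_eq_top]; trivial
  induction hx using Submodule.iSup_induction' with
  | mem n x hx =>
    rw [h.s_apply hx, s.map_smul_of_tower, h.s_apply hx, smul_smul, ← zpow_add₀ (by simp),
      Even.neg_one_zpow ⟨n, rfl⟩, one_smul]
  | zero => simp
  | add x y _ _ hx hy => rw [map_add, map_add, hx, hy]

/-- The cohomology algebra `ker D / im D`. -/
def Cohomology (_ : IsDGA k gr D mul one s) : Type _ :=
  LinearMap.ker D ⧸ (LinearMap.range D).submoduleOf (LinearMap.ker D)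

variable (h : IsDGA k gr D mul one s)

noncomputable instance : AddCommGroup h.Cohomology :=
  inferInstanceAs (AddCommGroup (LinearMap.ker D ⧸ (LinearMap.range D).submoduleOf _))

noncomputable instance : Module k h.Cohomology :=
  inferInstanceAs (Module k (LinearMap.ker D ⧸ (LinearMap.range D).submoduleOf _))

noncomputable instance : Module R h.Cohomology :=
  inferInstanceAs (Module R (LinearMap.ker D ⧸ (LinearMap.range D).submoduleOf _))

instance : IsScalarTower k R h.Cohomology :=
  inferInstanceAs (IsScalarTower k R (LinearMap.ker D ⧸ (LinearMap.range D).submoduleOf _))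

/-- The cohomology class of a cocycle. -/
noncomputable def cls : LinearMap.ker D →ₗ[R] h.Cohomology :=
  ((LinearMap.range D).submoduleOf (LinearMap.ker D)).mkQ

theorem cls_surjective : Function.Surjective h.cls := Submodule.mkQ_surjective _

theorem cls_eq_zero {x : LinearMap.ker D} : h.cls x = 0 ↔ ∃ y, D y = x :=
  Submodule.Quotient.mk_eq_zero _

/-- The product of two cocycles. -/
noncomputable def mulCocycle : LinearMap.ker D →ₗ[R] LinearMap.ker D →ₗ[R] LinearMap.ker D :=
  LinearMap.mk₂ R (fun x y => ⟨mul x y, h.mul_cocycle x.2 y.2⟩)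
    (fun _ _ _ => Subtype.ext (by simp)) (fun _ _ _ => Subtype.ext (by simp))
    (fun _ _ _ => Subtype.ext (by simp)) (fun _ _ _ => Subtype.ext (by simp))

theorem coe_mulCocycle (x y : LinearMap.ker D) : (h.mulCocycle x y : K) = mul x y := rfl

/-- The product of a cocycle with a cohomology class. -/
noncomputable def mulAux (x : LinearMap.ker D) : h.Cohomology →ₗ[R] h.Cohomology :=
  Submodule.liftQ ((LinearMap.range D).submoduleOf (LinearMap.ker D)) (h.cls ∘ₗ h.mulCocycle x) (by
    rintro y ⟨z, hz⟩
    refine h.cls_eq_zero.2 ⟨mul (s x) z, ?_⟩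
    rw [h.mul_D x.2, h.s_s, hz]
    rfl)

theorem mulAux_cls (x y : LinearMap.ker D) : h.mulAux x (h.cls y) = h.cls (h.mulCocycle x y) := rfl

/-- The product of cohomology classes, `[x] [y] = [x y]`. -/
noncomputable def mulHom : h.Cohomology →ₗ[R] h.Cohomology →ₗ[R] h.Cohomology :=
  Submodule.liftQ ((LinearMap.range D).submoduleOf (LinearMap.ker D))
    { toFun := h.mulAux
      map_add' := fun x y => by
        ext z
        obtain ⟨z, rfl⟩ := h.cls_surjective z
        simp [mulAux_cls]
      map_smul' := fun c x => by
        ext z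
        obtain ⟨z, rfl⟩ := h.cls_surjective z
        simp [mulAux_cls] }
    (by
      rintro y ⟨z, hz⟩
      ext x
      obtain ⟨x, rfl⟩ := h.cls_surjective x
      refine h.cls_eq_zero.2 ⟨mul z x, ?_⟩
      have hx : D x = 0 := x.2
      rw [h.leibniz, hx, hz]
      simp [coe_mulCocycle])

noncomputable instance : Ring h.Cohomology :=
  { (inferInstance : AddCommGroup h.Cohomology) with
    mul := fun x y => h.mulHom x y
    one := h.cls ⟨one, h.D_one⟩
    left_distrib := fun x y z => map_add (h.mulHom x) y z
    right_distrib := fun x y z => LinearMap.map_add₂ h.mulHom x y z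
    zero_mul := fun x => LinearMap.map_zero₂ h.mulHom x
    mul_zero := fun x => map_zero (h.mulHom x)
    mul_assoc := fun x y z => by
      obtain ⟨x, rfl⟩ := h.cls_surjective x
      obtain ⟨y, rfl⟩ := h.cls_surjective y
      obtain ⟨z, rfl⟩ := h.cls_surjective z
      exact congrArg h.cls (Subtype.ext (h.mul_assoc x y z))
    one_mul := fun x => by
      obtain ⟨x, rfl⟩ := h.cls_surjective x
      exact congrArg h.cls (Subtype.ext (h.one_mul x))
    mul_one := fun x => by
      obtain ⟨x, rfl⟩ := h.cls_surjective x
      exact congrArg h.cls (Subtype.ext (h.mul_one x)) }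

noncomputable instance : Algebra R h.Cohomology :=
  Algebra.ofModule (fun r x y => LinearMap.map_smul₂ h.mulHom r x y)
    (fun r x y => map_smul (h.mulHom x) r y)

/-- The classes of the cocycles of degree `n`. -/
noncomputable def deg (n : ℤ) : Submodule k h.Cohomology :=
  ((gr n).comap ((LinearMap.ker D).subtype.restrictScalars k)).map (h.cls.restrictScalars k)

end IsDGA

end DGA

/-! ### The spectral sequence of a double complex -/

section SpectralSequence

variable {k K : Type*} [Field k] [AddCommGroup K] [Module k K]

/-- The filtration by columns `Fᵖ Kⁿ = ⨁_{p' ≥ p} C^{p', n - p'}` of the total complex `K` of a double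
complex `C`. -/
def filt (C : ℤ → ℤ → Submodule k K) (p n : ℤ) : Submodule k K :=
  ⨆ (p' : ℤ) (_ : p ≤ p'), C p' (n - p')

variable (C : ℤ → ℤ → Submodule k K) (D : K →ₗ[k] K)

/-- `Z_r^{p,q} = {x ∈ Fᵖ K^{p+q} | D x ∈ F^{p+r} K^{p+q+1}}`. -/
def cycles (r p q : ℤ) : Submodule k K :=
  filt C p (p + q) ⊓ (filt C (p + r) (p + q + 1)).comap D

/-- `Z_{r-1}^{p+1,q-1} + D Z_{r-1}^{p-r+1,q+r-2}`. -/
def boundaries (r p q : ℤ) : Submodule k K :=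
  cycles C D (r - 1) (p + 1) (q - 1) ⊔ (cycles C D (r - 1) (p - r + 1) (q + r - 2)).map D

/-- The term `E_r^{p,q}`, for `r ≥ 1`, of the spectral sequence of the double complex `C` with total
differential `D`, filtered by columns. -/
abbrev page (r p q : ℤ) : Type _ :=
  cycles C D r p q ⧸ (boundaries C D r p q).submoduleOf (cycles C D r p q)

variable {D}

theorem D_mem_cycles (hD : ∀ x, D (D x) = 0) {r p q : ℤ} {x : K} (hx : x ∈ cycles C D r p q) :
    D x ∈ cycles C D r (p + r) (q - r + 1) := by
  refine ⟨?_, ?_⟩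
  · rw [show p + r + (q - r + 1) = p + q + 1 by ring]
    exact hx.2
  · change D (D x) ∈ filt C _ _
    rw [hD]
    exact zero_mem _

theorem D_mem_boundaries (hD : ∀ x, D (D x) = 0) {r p q : ℤ} {x : K}
    (hx : x ∈ boundaries C D r p q) : D x ∈ boundaries C D r (p + r) (q - r + 1) := by
  obtain ⟨y, hy, z, ⟨t, _, rfl⟩, rfl⟩ := Submodule.mem_sup.1 hx
  rw [map_add, hD, add_zero]
  refine Submodule.mem_sup_right ⟨y, ?_, rfl⟩
  rw [show p + r - r + 1 = p + 1 by ring, show q - r + 1 + r - 2 = q - 1 by ring]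
  exact hy

/-- The differential `d_r : E_r^{p,q} → E_r^{p+r,q-r+1}`, induced by `D`. -/
def pageD (hD : ∀ x, D (D x) = 0) (r p q : ℤ) :
    page C D r p q →ₗ[k] page C D r (p + r) (q - r + 1) :=
  Submodule.mapQ _ _ (D.restrict fun _ hx => D_mem_cycles C hD hx)
    fun _ hx => D_mem_boundaries C hD hx

end SpectralSequence

/-! ### Deformation quantization -/

section DeformationQuantization

open Polynomial in
/-- The graded algebra `(B, ℬ)` over `k[h]` (with `h = X` of degree 2) is a graded deformation
quantization of the graded `k`-algebra `(A, 𝒜)`: there are an isomorphism `Φ : A[h] → B` of graded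
`k[h]`-modules and an isomorphism of `k`-algebras `B / hB → A`, here given as a surjective
homomorphism `π : B → A` with kernel `hB`, that are compatible. -/
structure IsGradedDeformationQuantization {k A B : Type*} [Field k] [Ring A] [Algebra k A]
    [Ring B] [Algebra k[X] B] [Module k B] [IsScalarTower k k[X] B]
    (𝒜 : ℤ → Submodule k A) (ℬ : ℤ → Submodule k B) : Prop where
  internal_A : DirectSum.IsInternal 𝒜
  graded_A : SetLike.GradedMonoid 𝒜
  internal_B : DirectSum.IsInternal ℬ
  graded_B : SetLike.GradedMonoid ℬ
  X_smul_mem : ∀ {i : ℤ} {b : B}, b ∈ ℬ i → (X : k[X]) • b ∈ ℬ (i + 2)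
  exists_equiv : ∃ (Φ : (k[X] ⊗[k] A) ≃ₗ[k[X]] B) (π : B →+* A),
    (∀ {i : ℤ} (p : ℕ) {a : A}, a ∈ 𝒜 i → Φ ((X ^ p : k[X]) ⊗ₜ a) ∈ ℬ (i + 2 * p)) ∧
    Function.Surjective π ∧
    (∀ (f : k[X]) (b : B), π (f • b) = f.coeff 0 • π b) ∧
    (∀ b : B, π b = 0 ↔ ∃ b' : B, b = (X : k[X]) • b') ∧
    ∀ a : A, π (Φ (1 ⊗ₜ a)) = a

end DeformationQuantization

section Quantum

variable {E : Type*} [NormedAddCommGroup E] [NormedSpace ℝ E]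
  {M : Type*} [TopologicalSpace M] [ChartedSpace E M]

/-- The unit of `Ω(M)[h]`. -/
noncomputable def qOne : QForm E M := 1 ⊗ₜ oneForm

/-- The parity involution of `Ω(M)[h]`; as `h` has degree 2, it is that of `Ω(M)`. -/
noncomputable def qParity : QForm E M →ₗ[ℝ[X]] QForm E M := parity.baseChange ℝ[X]

variable (E M) in
/-- The elements of `Ω(M)[h]` of total degree `n`, i.e. `⨁_{p + q = n} C^{p,q}`; here `h` has
degree 2. -/
noncomputable def qDeg (n : ℤ) : Submodule ℝ (QForm E M) := ⨆ p : ℤ, dblComplex E M p (n - p)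

end Quantum

end QuantumDeRham

open QuantumDeRham

/-! Write `Λ` for contraction with `w`, so that Koszul's codifferential is the commutator `[Λ, d]`.
The operator `hΛ` is nilpotent, has degree zero and preserves the filtration by powers of `h`, so
`exp(hΛ)` is an automorphism of the filtered graded `ℝ[h]`-module `Ω(M)[h]`, equal to the identity
modulo `h`. This automorphism carries the quantum structure to the undeformed one: `d_h = exp(-hΛ) d
exp(hΛ)` (`qD_eq_conj`) and `α ∧_h β = exp(-hΛ)(exp(hΛ)α ∧ exp(hΛ)β)` (`qWedge_eq_conj`). All
conclusions follow from these two identities.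

For the product, `Λ` is a second order operator: its failure to be a derivation of `∧` is minus the
pairing of the two factors through `w` (`bivContr_wedge`). That pairing commutes with contraction by
`w`, which gives the recursion `formWedgeCoeff_succ` for the coefficients of `∧_h`. Its solution is
an exponential of commuting operators acting on the two arguments and on the value
(`sum_bilin_eq_exp`).

For the differential, `[Λ, [Λ, d]] = 0` is needed, and then `exp(hΛ)(d - hδ) = d exp(hΛ)`
(`exp_mul_sub_lie`). With `L` the exterior product by the symplectic form, `[Λ, L]` acts on
`k`-forms as `½ dim - k`. Under commutators, `d` is killed by `L` because the form is closed, and it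
has weight one, so it generates a two-dimensional representation of `sl₂`; this forces the second
bracket with `Λ` to vanish (`lie_lie_eq_zero_of_weight_one`).

The differential graded algebra axioms are then transported from `Ω(M)[h]` with `d` and `∧`
(`isDGA_qForm`). The spectral sequence degenerates because `d` acts on each coefficient of a power
of `h` separately, so that low powers can be cut off after conjugation (`pageD_eq_zero`). In
cohomology, `[α] ↦ [exp(-hΛ)α]` extends to the required isomorphism (`quantumMap`), and setting `h =
0` gives the algebra map to de Rham cohomology (`classicalLimit`).

The linear algebra underneath rests on contraction by a vector being an antiderivation
(`leftContr_wedge`): a component of positive degree is determined by its contractions, so identities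
reduce by induction to degree zero. -/

namespace QuantumDeRham

section Antiderivation

/-! ### Contraction is an antiderivation of the exterior product -/

/-- The antisymmetrization `∑ σ, sign σ • f (v ∘ σ)`. -/
noncomputable def antisym {V : Type*} {m : ℕ} (f : (Fin m → V) → ℝ) (v : Fin m → V) : ℝ :=
  ∑ σ : Equiv.Perm (Fin m), ((Equiv.Perm.sign σ : ℤ) : ℝ) * f (v ∘ σ)

/-- Permutations of `Fin (m + 1)` are determined by the preimage of `0` and a permutation of the
rest. -/
theorem bijective_decomposeFin_mul_cycleRange (m : ℕ) :
    Function.Bijective fun q : Fin (m + 1) × Equiv.Perm (Fin m) =>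
      Equiv.Perm.decomposeFin.symm (0, q.2) * q.1.cycleRange := by
  rw [Fintype.bijective_iff_injective_and_card]
  refine ⟨?_, Fintype.card_congr Equiv.Perm.decomposeFin.symm⟩
  rintro ⟨p, τ⟩ ⟨p', τ'⟩ h
  have key : ∀ (p : Fin (m + 1)) (τ : Equiv.Perm (Fin m)),
      (Equiv.Perm.decomposeFin.symm (0, τ) * p.cycleRange) p = 0 := by
    intro p τ
    simp
  have hp : p = p' := by
    have h1 := key p τ
    have h2 := key p' τ'
    simp only at h
    rw [h] at h1
    exact (Equiv.injective _ (h1.trans h2.symm))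
  subst hp
  have := mul_right_cancel h
  have := Equiv.Perm.decomposeFin.symm.injective this
  simp only [Prod.mk.injEq, true_and] at this
  rw [this]

/-- Laplace expansion: permutations are sorted by the slot `p` that receives `x`, and the cycle
taking `p` to `0` has sign `(-1)ᵖ`. -/
theorem antisym_cons {V : Type*} {m : ℕ} (f : (Fin (m + 1) → V) → ℝ) (x : V) (y : Fin m → V) :
    antisym f (Matrix.vecCons x y) =
      ∑ p : Fin (m + 1), (-1) ^ (p : ℕ) * antisym (fun z => f (p.insertNth x z)) y := by
  rw [antisym, ← Function.Bijective.sum_comp (bijective_decomposeFin_mul_cycleRange m),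
    Fintype.sum_prod_type]
  refine Finset.sum_congr rfl fun p _ => ?_
  rw [antisym, Finset.mul_sum]
  refine Finset.sum_congr rfl fun τ _ => ?_
  have h1 : Matrix.vecCons x y ∘ ⇑(Equiv.Perm.decomposeFin.symm (0, τ) * p.cycleRange) =
      p.insertNth x (y ∘ τ) := by
    rw [← Fin.cons_comp_cycleRange, Equiv.Perm.coe_mul, ← Function.comp_assoc]
    congr 1
    funext i
    refine Fin.cases ?_ (fun i => ?_) i
    · simp [Matrix.vecCons]
    · simp [Matrix.vecCons]
  rw [h1]
  simp
  ring

variable {E : Type*} [NormedAddCommGroup E] [NormedSpace ℝ E]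

/-- The function `v ↦ α(v₁, …, v_a) β(v_{a+1}, …, v_{a+b})`. -/
def splitMul {a b m : ℕ} (h : a + b = m) (α : E [⋀^Fin a]→L[ℝ] ℝ) (β : E [⋀^Fin b]→L[ℝ] ℝ)
    (z : Fin m → E) : ℝ :=
  α (fun i => z (finCongr h (finSumFinEquiv (Sum.inl i)))) *
    β (fun i => z (finCongr h (finSumFinEquiv (Sum.inr i))))

/-- Each shuffle class consists of `a! b!` permutations that contribute equally, since both factors
are alternating. Clearing the factorials replaces the sum over a quotient by one over all
permutations. -/
theorem factorial_mul_wedgeAlt {a b m : ℕ} (h : a + b = m) (α : E [⋀^Fin a]→L[ℝ] ℝ)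
    (β : E [⋀^Fin b]→L[ℝ] ℝ) (v : Fin m → E) :
    ((a.factorial * b.factorial : ℕ) : ℝ) * wedgeAlt h α β v =
      antisym (splitMul h α β) v := by
  have h1 := MultilinearMap.domCoprod_alternization_eq α.toAlternatingMap β.toAlternatingMap
  have h2 := congrArg (fun f => LinearMap.mul' ℝ ℝ
    (f (fun i => v ((finSumFinEquiv.trans (finCongr h)) i)))) h1
  simp only [Fintype.card_fin] at h2
  rw [AlternatingMap.smul_apply, map_nsmul, nsmul_eq_mul] at h2
  refine h2.symm.trans ?_
  rw [MultilinearMap.alternatization_apply, map_sum, antisym,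
    ← Equiv.sum_comp (Equiv.permCongr (finSumFinEquiv.trans (finCongr h)))]
  refine Finset.sum_congr rfl fun σ _ => ?_
  rw [Equiv.Perm.sign_permCongr]
  rcases Int.units_eq_one_or (Equiv.Perm.sign σ) with hσ | hσ <;>
    simp [splitMul, hσ, MultilinearMap.domCoprod_apply, Equiv.permCongr_apply]

theorem antisym_const_mul {V : Type*} {m : ℕ} (c : ℝ) (f : (Fin m → V) → ℝ) (v : Fin m → V) :
    antisym (fun z => c * f z) v = c * antisym f v := by
  rw [antisym, antisym, Finset.mul_sum]
  exact Finset.sum_congr rfl fun σ _ => by ring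

/-- Moving `x` from slot `i` to the front of `α` costs `(-1)ⁱ`, which cancels the sign of the
expansion. The `a + 1` summands are therefore equal, and they turn `a!` into `(a + 1)!`. -/
theorem sum_inl_antisym {a b m : ℕ} (h : a + 1 + b = m + 1) (h' : a + b = m)
    (α : E [⋀^Fin (a + 1)]→L[ℝ] ℝ) (β : E [⋀^Fin b]→L[ℝ] ℝ) (x : E) (y : Fin m → E) :
    ∑ i : Fin (a + 1), (-1) ^ (finCongr h (finSumFinEquiv (Sum.inl i)) : ℕ) *
      antisym (fun z => splitMul h α β
          ((finCongr h (finSumFinEquiv (Sum.inl i))).insertNth x z)) y =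
      (((a + 1).factorial * b.factorial : ℕ) : ℝ) * wedgeAlt h' (α.curryLeft x) β y := by
  have key : ∀ i : Fin (a + 1), (-1) ^ (finCongr h (finSumFinEquiv (Sum.inl i)) : ℕ) *
      antisym (fun z => splitMul h α β
          ((finCongr h (finSumFinEquiv (Sum.inl i))).insertNth x z)) y =
      ((a.factorial * b.factorial : ℕ) : ℝ) * wedgeAlt h' (α.curryLeft x) β y := by
    intro i
    rw [factorial_mul_wedgeAlt, ← antisym_const_mul]
    congr 1
    funext z
    have e1 : (fun k => (finCongr h (finSumFinEquiv (Sum.inl i))).insertNth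
        (α := fun _ => E) x z (finCongr h (finSumFinEquiv (Sum.inl k)))) =
        i.insertNth (α := fun _ => E) x fun k => z (finCongr h' (finSumFinEquiv (Sum.inl k))) := by
      refine Fin.eq_insertNth_iff.2 ⟨by simp, ?_⟩
      funext k
      have : finCongr h (finSumFinEquiv (Sum.inl (i.succAbove k))) =
        (finCongr h (finSumFinEquiv (Sum.inl i))).succAbove
          (finCongr h' (finSumFinEquiv (Sum.inl k))) := by
        ext
        simp only [Fin.succAbove, finSumFinEquiv_apply_left, finCongr_apply, Fin.lt_def,
          Fin.val_castSucc, Fin.val_cast, Fin.val_castAdd]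
        split_ifs <;> simp
      rw [Fin.removeNth, this, Fin.insertNth_apply_succAbove]
    have e2 : (fun k => (finCongr h (finSumFinEquiv (Sum.inl i))).insertNth
        (α := fun _ => E) x z (finCongr h (finSumFinEquiv (Sum.inr k)))) =
        fun k => z (finCongr h' (finSumFinEquiv (Sum.inr k))) := by
      funext k
      have : finCongr h (finSumFinEquiv (Sum.inr k)) =
        (finCongr h (finSumFinEquiv (Sum.inl i))).succAbove
          (finCongr h' (finSumFinEquiv (Sum.inr k))) := by
        ext
        simp only [Fin.succAbove, finSumFinEquiv_apply_left, finSumFinEquiv_apply_right,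
          finCongr_apply, Fin.lt_def, Fin.val_castSucc, Fin.val_cast, Fin.val_castAdd,
          Fin.val_natAdd]
        split_ifs <;> simp <;> omega
      rw [this, Fin.insertNth_apply_succAbove]
    simp only [splitMul, e1, e2]
    have h3 := α.neg_one_pow_smul_map_insertNth i x
      fun k => z (finCongr h' (finSumFinEquiv (Sum.inl k)))
    rw [ContinuousAlternatingMap.curryLeft_apply_apply, ← h3]
    simp [mul_assoc]
  rw [Finset.sum_congr rfl fun i _ => key i]
  simp [Nat.factorial_succ]
  ring

/-- Here the slot has position `a + i`. Moving `x` to the front of `β` cancels only `(-1)ⁱ`, and the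
remaining `(-1)ᵃ` is the sign of the antiderivation rule. -/
theorem sum_inr_antisym {a b m : ℕ} (h : a + (b + 1) = m + 1) (h' : a + b = m)
    (α : E [⋀^Fin a]→L[ℝ] ℝ) (β : E [⋀^Fin (b + 1)]→L[ℝ] ℝ) (x : E) (y : Fin m → E) :
    ∑ i : Fin (b + 1), (-1) ^ (finCongr h (finSumFinEquiv (Sum.inr i)) : ℕ) *
      antisym (fun z => splitMul h α β
          ((finCongr h (finSumFinEquiv (Sum.inr i))).insertNth x z)) y =
      ((a.factorial * (b + 1).factorial : ℕ) : ℝ) *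
        ((-1) ^ a * wedgeAlt h' α (β.curryLeft x) y) := by
  have key : ∀ i : Fin (b + 1), (-1) ^ (finCongr h (finSumFinEquiv (Sum.inr i)) : ℕ) *
      antisym (fun z => splitMul h α β
          ((finCongr h (finSumFinEquiv (Sum.inr i))).insertNth x z)) y =
      (-1) ^ a * (((a.factorial * b.factorial : ℕ) : ℝ) * wedgeAlt h' α (β.curryLeft x) y) := by
    intro i
    rw [factorial_mul_wedgeAlt, ← antisym_const_mul, ← antisym_const_mul]
    congr 1
    funext z
    have e1 : (fun k => (finCongr h (finSumFinEquiv (Sum.inr i))).insertNth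
        (α := fun _ => E) x z (finCongr h (finSumFinEquiv (Sum.inr k)))) =
        i.insertNth (α := fun _ => E) x fun k => z (finCongr h' (finSumFinEquiv (Sum.inr k))) := by
      refine Fin.eq_insertNth_iff.2 ⟨by simp, ?_⟩
      funext k
      have : finCongr h (finSumFinEquiv (Sum.inr (i.succAbove k))) =
        (finCongr h (finSumFinEquiv (Sum.inr i))).succAbove
          (finCongr h' (finSumFinEquiv (Sum.inr k))) := by
        ext
        simp only [Fin.succAbove, finSumFinEquiv_apply_right, finCongr_apply, Fin.lt_def,
          Fin.val_castSucc, Fin.val_cast, Fin.val_natAdd]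
        split_ifs <;> simp <;> omega
      rw [Fin.removeNth, this, Fin.insertNth_apply_succAbove]
    have e2 : (fun k => (finCongr h (finSumFinEquiv (Sum.inr i))).insertNth
        (α := fun _ => E) x z (finCongr h (finSumFinEquiv (Sum.inl k)))) =
        fun k => z (finCongr h' (finSumFinEquiv (Sum.inl k))) := by
      funext k
      have : finCongr h (finSumFinEquiv (Sum.inl k)) =
        (finCongr h (finSumFinEquiv (Sum.inr i))).succAbove
          (finCongr h' (finSumFinEquiv (Sum.inl k))) := by
        ext
        simp only [Fin.succAbove, finSumFinEquiv_apply_left, finSumFinEquiv_apply_right,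
          finCongr_apply, Fin.lt_def, Fin.val_castSucc, Fin.val_cast, Fin.val_castAdd,
          Fin.val_natAdd]
        split_ifs with hlt
        · simp
        · exact absurd (k.isLt.trans_le (Nat.le_add_right _ _)) hlt
      rw [this, Fin.insertNth_apply_succAbove]
    simp only [splitMul, e1, e2]
    have h3 := β.neg_one_pow_smul_map_insertNth i x
      fun k => z (finCongr h' (finSumFinEquiv (Sum.inr k)))
    rw [ContinuousAlternatingMap.curryLeft_apply_apply, ← h3]
    simp [pow_add]
    ring
  rw [Finset.sum_congr rfl fun i _ => key i]
  simp [Nat.factorial_succ]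
  ring

theorem factorial_mul_wedgeAlt_cons {a b m : ℕ} (h : a + b = m + 1) (α : E [⋀^Fin a]→L[ℝ] ℝ)
    (β : E [⋀^Fin b]→L[ℝ] ℝ) (x : E) (y : Fin m → E) :
    ((a.factorial * b.factorial : ℕ) : ℝ) * wedgeAlt h α β (Matrix.vecCons x y) =
      (∑ i : Fin a, (-1) ^ (finCongr h (finSumFinEquiv (Sum.inl i)) : ℕ) *
      antisym (fun z => splitMul h α β
          ((finCongr h (finSumFinEquiv (Sum.inl i))).insertNth x z)) y) +
      ∑ i : Fin b, (-1) ^ (finCongr h (finSumFinEquiv (Sum.inr i)) : ℕ) *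
      antisym (fun z => splitMul h α β
          ((finCongr h (finSumFinEquiv (Sum.inr i))).insertNth x z)) y := by
  rw [factorial_mul_wedgeAlt, antisym_cons, ← Fintype.sum_sum_type (fun s =>
    (-1) ^ (finCongr h (finSumFinEquiv s) : ℕ) *
      antisym (fun z => splitMul h α β
          ((finCongr h (finSumFinEquiv s)).insertNth x z)) y),
    ← (finSumFinEquiv.trans (finCongr h)).sum_comp]
  rfl

/-- The factorials on the two sides now agree and cancel. Bidegrees containing a zero are treated
separately because a factor of degree zero has nothing to contract and its term is absent. -/
theorem curryLeft_wedgeHom_succ_succ {a b m : ℕ} (h : a + 1 + (b + 1) = m + 1)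
    (α : E [⋀^Fin (a + 1)]→L[ℝ] ℝ) (β : E [⋀^Fin (b + 1)]→L[ℝ] ℝ) (x : E) :
    (wedgeHom h α β).curryLeft x =
      wedgeHom (show a + (b + 1) = m by omega) (α.curryLeft x) β +
        (-1 : ℝ) ^ (a + 1) • wedgeHom (show a + 1 + b = m by omega) α (β.curryLeft x) := by
  ext y
  have h1 := factorial_mul_wedgeAlt_cons h α β x y
  rw [sum_inl_antisym h (by omega), sum_inr_antisym h (by omega), ← mul_add] at h1
  exact mul_left_cancel₀ (by positivity) h1

theorem curryLeft_wedgeHom_zero_succ {b m : ℕ} (h : 0 + (b + 1) = m + 1)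
    (α : E [⋀^Fin 0]→L[ℝ] ℝ) (β : E [⋀^Fin (b + 1)]→L[ℝ] ℝ) (x : E) :
    (wedgeHom h α β).curryLeft x = wedgeHom (show 0 + b = m by omega) α (β.curryLeft x) := by
  ext y
  have h1 := factorial_mul_wedgeAlt_cons h α β x y
  rw [sum_inr_antisym h (by omega), Finset.univ_eq_empty, Finset.sum_empty, zero_add, pow_zero,
    one_mul] at h1
  exact mul_left_cancel₀ (by positivity) h1

theorem curryLeft_wedgeHom_succ_zero {a m : ℕ} (h : a + 1 + 0 = m + 1)
    (α : E [⋀^Fin (a + 1)]→L[ℝ] ℝ) (β : E [⋀^Fin 0]→L[ℝ] ℝ) (x : E) :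
    (wedgeHom h α β).curryLeft x = wedgeHom (show a + 0 = m by omega) (α.curryLeft x) β := by
  ext y
  have h1 := factorial_mul_wedgeAlt_cons h α β x y
  rw [sum_inl_antisym h (by omega)] at h1
  rw [Finset.univ_eq_empty (α := Fin 0), Finset.sum_empty, add_zero] at h1
  exact mul_left_cancel₀ (by positivity) h1

/-- The parity involution of `Λ(E*)`. -/
noncomputable def extParity : Ext E →ₗ[ℝ] Ext E where
  toFun α k := (-1 : ℝ) ^ k • α k
  map_add' _ _ := funext fun _ => smul_add _ _ _
  map_smul' c α := funext fun k => smul_comm ((-1 : ℝ) ^ k) c (α k)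

theorem extParity_apply (α : Ext E) (k : ℕ) : extParity α k = (-1 : ℝ) ^ k • α k := rfl

theorem leftContr_apply (v : E) (α : Ext E) (k : ℕ) :
    leftContr v α k = (α (k + 1)).curryLeft v := rfl

/-- The component of `wedge α β` in bidegree `(a, b)`. -/
noncomputable def wedgeBi (α β : Ext E) (m a b : ℕ) : E [⋀^Fin m]→L[ℝ] ℝ :=
  if h : a + b = m then wedgeHom h (α a) (β b) else 0

theorem wedge_eq_sum_wedgeBi (α β : Ext E) (m : ℕ) :
    wedge α β m = ∑ p ∈ Finset.HasAntidiagonal.antidiagonal m, wedgeBi α β m p.1 p.2 := by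
  rw [wedge_apply, ← Finset.sum_coe_sort (Finset.HasAntidiagonal.antidiagonal m)]
  refine Finset.sum_congr rfl fun p _ => ?_
  rw [wedgeBi, dif_pos (Finset.HasAntidiagonal.mem_antidiagonal.1 p.2)]

theorem wedge_apply_zero (α β : Ext E) :
    wedge α β 0 = wedgeHom (zero_add 0) (α 0) (β 0) := by
  rw [wedge_eq_sum_wedgeBi, Finset.Nat.antidiagonal_zero, Finset.sum_singleton, wedgeBi, dif_pos]

/-- This graded Leibniz rule is the one fact about the shuffle product on which the identities in
positive degree rest. -/
theorem leftContr_wedge (v : E) (α β : Ext E) :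
    leftContr v (wedge α β) =
      wedge (leftContr v α) β + wedge (extParity α) (leftContr v β) := by
  ext1 m
  have hc : ∀ f : E [⋀^Fin (m + 1)]→L[ℝ] ℝ, f.curryLeft v =
    (ContinuousLinearMap.apply ℝ (E [⋀^Fin m]→L[ℝ] ℝ) v).comp
    (ContinuousAlternatingMap.curryLeftLI (𝕜 := ℝ) (E := E) (F := ℝ)
      (n := m)).toContinuousLinearMap f := fun _ => rfl
  have hcs : ∀ (s : Finset (ℕ × ℕ)) (g : ℕ × ℕ → E [⋀^Fin (m + 1)]→L[ℝ] ℝ),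
      (∑ p ∈ s, g p).curryLeft v = ∑ p ∈ s, (g p).curryLeft v := by
    intro s g
    rw [hc, map_sum]
    rfl
  rw [leftContr_apply, wedge_eq_sum_wedgeBi, hcs, Pi.add_apply, wedge_eq_sum_wedgeBi,
    wedge_eq_sum_wedgeBi]
  -- Both sums on the right are reindexed over bidegrees of total degree `m + 1`, with a zero
  -- inserted at the end that has no predecessor, so that the identity can be checked bidegree by
  -- bidegree.
  have hL : ∑ p ∈ Finset.HasAntidiagonal.antidiagonal m, wedgeBi (leftContr v α) β m p.1 p.2 =
      ∑ p ∈ Finset.HasAntidiagonal.antidiagonal (m + 1), Nat.casesOn p.1 0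
        (fun a => wedgeBi (leftContr v α) β m a p.2) := by
    rw [Finset.Nat.antidiagonal_succ, Finset.sum_cons]
    simp
  have hR : ∑ p ∈ Finset.HasAntidiagonal.antidiagonal m, wedgeBi (extParity α) (leftContr v β) m p.1 p.2 =
      ∑ p ∈ Finset.HasAntidiagonal.antidiagonal (m + 1), Nat.casesOn p.2 0
        (fun b => wedgeBi (extParity α) (leftContr v β) m p.1 b) := by
    rw [Finset.Nat.antidiagonal_succ', Finset.sum_cons]
    simp
  rw [hL, hR, ← Finset.sum_add_distrib]
  refine Finset.sum_congr rfl ?_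
  rintro ⟨a, b⟩ hp
  have h : a + b = m + 1 := Finset.HasAntidiagonal.mem_antidiagonal.1 hp
  rw [wedgeBi, dif_pos h]
  rcases a with _ | a <;> rcases b with _ | b
  · omega
  · simp only
    rw [wedgeBi, dif_pos (show 0 + b = m by omega), curryLeft_wedgeHom_zero_succ, extParity_apply,
      pow_zero, one_smul]
    exact (zero_add _).symm
  · simp only
    rw [wedgeBi, dif_pos (show a + 0 = m by omega), curryLeft_wedgeHom_succ_zero]
    exact (add_zero _).symm
  · simp only
    rw [wedgeBi, dif_pos (show a + (b + 1) = m by omega), wedgeBi,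
      dif_pos (show a + 1 + b = m by omega), curryLeft_wedgeHom_succ_succ, extParity_apply,
      map_smul, LinearMap.smul_apply]
    rfl

end Antiderivation

section ExteriorAlgebra

/-! ### The exterior algebra of covectors -/

variable {E : Type*} [NormedAddCommGroup E] [NormedSpace ℝ E]

theorem ext_curryLeft {m : ℕ} {f g : E [⋀^Fin (m + 1)]→L[ℝ] ℝ}
    (h : ∀ v, f.curryLeft v = g.curryLeft v) : f = g := by
  ext y
  have h1 := congrArg (fun F => F (Matrix.vecTail y)) (h (Matrix.vecHead y))
  simpa [ContinuousAlternatingMap.curryLeft_apply_apply] using h1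

/-- This is the induction step for identities in `Λ(E*)`: together with `leftContr_wedge` it lowers
the degree by one, until only products of scalars remain. -/
theorem apply_succ_eq {m : ℕ} {α β : Ext E} (h : ∀ v, leftContr v α m = leftContr v β m) :
    α (m + 1) = β (m + 1) := ext_curryLeft h

theorem leftContr_leftContr_self (v : E) (α : Ext E) : leftContr v (leftContr v α) = 0 := by
  ext1 k
  exact ContinuousAlternatingMap.curryLeft_same _ _

/-- Polarization of the vanishing of the square of a contraction. -/
theorem leftContr_comm (u v : E) (α : Ext E) :
    leftContr u (leftContr v α) = - leftContr v (leftContr u α) := by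
  have h := leftContr_leftContr_self (u + v) α
  simp only [map_add, LinearMap.add_apply, leftContr_leftContr_self] at h
  rw [zero_add, add_zero] at h
  exact eq_neg_of_add_eq_zero_right h

theorem extParity_extParity (α : Ext E) : extParity (extParity α) = α := by
  ext1 k
  rw [extParity_apply, extParity_apply, smul_smul, ← mul_pow]
  simp

theorem leftContr_extParity (v : E) (α : Ext E) :
    leftContr v (extParity α) = - extParity (leftContr v α) := by
  ext1 k
  rw [leftContr_apply, extParity_apply, Pi.neg_apply, extParity_apply, pow_succ, leftContr_apply,
    ContinuousAlternatingMap.curryLeft_smul]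
  simp

theorem rightContr_eq (v : E) (α : Ext E) : rightContr v α = extParity (leftContr v α) := rfl

theorem extParity_wedge (α β : Ext E) :
    extParity (wedge α β) = wedge (extParity α) (extParity β) := by
  ext1 m
  rw [extParity_apply, wedge_apply, wedge_apply, Finset.smul_sum]
  refine Finset.sum_congr rfl fun p _ => ?_
  have h := Finset.HasAntidiagonal.mem_antidiagonal.1 p.2
  rw [extParity_apply, extParity_apply, map_smul, map_smul, LinearMap.smul_apply, smul_smul,
    ← pow_add]
  exact congrArg (fun n => (-1 : ℝ) ^ n • wedgeHom h (α p.1.1) (β p.1.2))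
    (h.symm.trans (add_comm _ _))

theorem wedgeHom_zero_apply (α β : E [⋀^Fin 0]→L[ℝ] ℝ) (v : Fin 0 → E) :
    wedgeHom (zero_add 0) α β v = α v * β v := by
  have h := factorial_mul_wedgeAlt (zero_add 0) α β v
  rw [Nat.factorial_zero, mul_one, Nat.cast_one, one_mul] at h
  refine h.trans ?_
  rw [antisym, Fintype.sum_subsingleton _ (1 : Equiv.Perm (Fin 0))]
  simp only [splitMul, Equiv.Perm.sign_one, Units.val_one, Int.cast_one, one_mul]
  congr 2
  exact Subsingleton.elim _ _

theorem wedge_apply_zero_apply (α β : Ext E) (v : Fin 0 → E) :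
    wedge α β 0 v = α 0 v * β 0 v := by
  rw [wedge_apply_zero, wedgeHom_zero_apply]

/-- Contracting either side gives the same three terms, one for each factor that is contracted, with
`extParity` on the factors passed over. -/
theorem wedge_assoc (α β γ : Ext E) : wedge (wedge α β) γ = wedge α (wedge β γ) := by
  ext1 m
  induction m generalizing α β γ with
  | zero =>
    ext v
    simp only [wedge_apply_zero_apply, mul_assoc]
  | succ m ih =>
    refine apply_succ_eq fun v => ?_
    simp only [leftContr_wedge, map_add, LinearMap.add_apply, Pi.add_apply, extParity_wedge, ih,
      add_assoc]

variable (E) in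
/-- The unit of `Λ(E*)`. -/
noncomputable def extOne : Ext E
  | 0 => ContinuousAlternatingMap.constOfIsEmpty ℝ E (Fin 0) 1
  | _ + 1 => 0

theorem leftContr_extOne (v : E) : leftContr v (extOne E) = 0 := by
  ext1 k
  ext y
  rfl

theorem extParity_extOne : extParity (extOne E) = extOne E := by
  ext1 k
  rw [extParity_apply]
  cases k with
  | zero => rw [pow_zero, one_smul]
  | succ k => exact smul_zero _

theorem extOne_wedge (α : Ext E) : wedge (extOne E) α = α := by
  ext1 m
  induction m generalizing α with
  | zero =>
    ext v
    rw [wedge_apply_zero_apply]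
    exact one_mul _
  | succ m ih =>
    refine apply_succ_eq fun v => ?_
    rw [leftContr_wedge, leftContr_extOne, extParity_extOne, map_zero, LinearMap.zero_apply,
      zero_add, ih]

theorem wedge_extOne (α : Ext E) : wedge α (extOne E) = α := by
  ext1 m
  induction m generalizing α with
  | zero =>
    ext v
    rw [wedge_apply_zero_apply]
    exact mul_one _
  | succ m ih =>
    refine apply_succ_eq fun v => ?_
    rw [leftContr_wedge, leftContr_extOne, map_zero, add_zero, ih]

/-- A covector, as an element of `Λ(E*)`. -/
noncomputable def extCovector (φ : E →L[ℝ] ℝ) : Ext E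
  | 0 => 0
  | 1 => ContinuousAlternatingMap.ofSubsingleton ℝ E ℝ (0 : Fin 1) φ
  | _ + 2 => 0

theorem leftContr_extCovector (v : E) (φ : E →L[ℝ] ℝ) :
    leftContr v (extCovector φ) = φ v • extOne E := by
  ext1 k
  rw [leftContr_apply]
  cases k with
  | zero =>
    ext y
    rw [ContinuousAlternatingMap.curryLeft_apply_apply]
    change φ v = φ v • (1 : ℝ)
    simp
  | succ k =>
    ext y
    exact (mul_zero (φ v)).symm

theorem extParity_extCovector (φ : E →L[ℝ] ℝ) : extParity (extCovector φ) = - extCovector φ := by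
  ext1 k
  rw [extParity_apply, Pi.neg_apply]
  match k with
  | 0 => exact (smul_zero _).trans neg_zero.symm
  | 1 =>
    rw [pow_one]
    ext v
    exact neg_one_mul (extCovector φ 1 v)
  | _ + 2 => exact (smul_zero _).trans neg_zero.symm

theorem extCovector_apply_zero (φ : E →L[ℝ] ℝ) : extCovector φ 0 = 0 := rfl

theorem leftContr_extCovector_wedge (v : E) (φ : E →L[ℝ] ℝ) (α : Ext E) :
    leftContr v (wedge (extCovector φ) α) = φ v • α - wedge (extCovector φ) (leftContr v α) := by
  rw [leftContr_wedge, leftContr_extCovector, map_smul, LinearMap.smul_apply, extOne_wedge,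
    extParity_extCovector, map_neg, LinearMap.neg_apply, sub_eq_add_neg]

/-- The case of graded commutativity that produces the sign in the Leibniz rule for `d`, where `eʲ`
has to pass the first factor. -/
theorem extCovector_wedge_comm (φ : E →L[ℝ] ℝ) (α : Ext E) :
    wedge (extCovector φ) α = wedge (extParity α) (extCovector φ) := by
  ext1 m
  induction m generalizing α with
  | zero =>
    ext v
    rw [wedge_apply_zero_apply, wedge_apply_zero_apply, extCovector_apply_zero]
    simp
  | succ m ih =>
    refine apply_succ_eq fun v => ?_
    rw [leftContr_extCovector_wedge, leftContr_wedge, leftContr_extCovector, leftContr_extParity,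
      extParity_extParity, map_smul, wedge_extOne, map_neg, LinearMap.neg_apply, Pi.sub_apply,
      Pi.add_apply, Pi.neg_apply, ih]
    abel

variable [FiniteDimensional ℝ E]

/-- The antisymmetrization `∑ⱼ eʲ ∧ T(eⱼ)` of a linear map into `Λ(E*)`. -/
noncomputable def extUncurry (T : E →ₗ[ℝ] Ext E) : Ext E
  | 0 => 0
  | k + 1 => ContinuousAlternatingMap.alternatizeUncurryFin
      (LinearMap.toContinuousLinearMap (LinearMap.proj k ∘ₗ T))

theorem extUncurry_succ_apply (T : E →ₗ[ℝ] Ext E) (k : ℕ) (v : Fin (k + 1) → E) :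
    extUncurry T (k + 1) v = ∑ i : Fin (k + 1), (-1) ^ (i : ℕ) • T (v i) k (i.removeNth v) := by
  exact ContinuousAlternatingMap.alternatizeUncurryFin_apply _ _

/-- The summand `i = 0` differentiates along `v` itself. The others keep `v` in front, and their
indices shift by one, whence the minus sign. -/
theorem leftContr_extUncurry (v : E) (T : E →ₗ[ℝ] Ext E) :
    leftContr v (extUncurry T) = T v - extUncurry (leftContr v ∘ₗ T) := by
  ext k y
  rw [leftContr_apply, ContinuousAlternatingMap.curryLeft_apply_apply, extUncurry_succ_apply,
    Fin.sum_univ_succ, Pi.sub_apply, ContinuousAlternatingMap.sub_apply, sub_eq_add_neg]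
  congr 1
  · simp [Matrix.vecCons]
  · cases k with
    | zero => simp [extUncurry]
    | succ k =>
      rw [extUncurry_succ_apply, ← Finset.sum_neg_distrib]
      refine Finset.sum_congr rfl fun i _ => ?_
      have : i.succ.removeNth (Matrix.vecCons v y) = Matrix.vecCons v (i.removeNth y) := by
        funext j
        refine Fin.cases ?_ (fun j => ?_) j <;> simp [Fin.removeNth, Matrix.vecCons]
      rw [this]
      simp [pow_succ, leftContr_apply]

theorem sum_dualVec_smul (v : E) : ∑ j, dualVec j v • Module.finBasis ℝ E j = v :=
  (Module.finBasis ℝ E).sum_repr v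

/-- Both sides satisfy the same recursion under contraction. Applied to a derivative this is `d = ∑ⱼ
eʲ ∧ ∂ⱼ`; applied to contraction it gives the Euler identity. -/
theorem extUncurry_eq_sum (T : E →ₗ[ℝ] Ext E) :
    extUncurry T = ∑ j, wedge (extCovector (dualVec j)) (T (Module.finBasis ℝ E j)) := by
  ext1 m
  induction m generalizing T with
  | zero =>
    ext v
    rw [Finset.sum_apply, ContinuousAlternatingMap.sum_apply]
    simp only [wedge_apply_zero_apply, extCovector_apply_zero]
    simp [extUncurry]
  | succ m ih =>
    refine apply_succ_eq fun v => ?_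
    rw [leftContr_extUncurry, map_sum]
    simp only [leftContr_extCovector_wedge, Finset.sum_sub_distrib, Pi.sub_apply, ih]
    congr 2
    conv_lhs => rw [← sum_dualVec_smul v, map_sum]
    simp only [map_smul]

/-- The Euler identity: `∑ⱼ eʲ ∧ (eⱼ ⊢ α) = k α` in degree `k`. -/
theorem sum_extCovector_wedge_leftContr (α : Ext E) (k : ℕ) :
    (∑ j, wedge (extCovector (dualVec j)) (leftContr (Module.finBasis ℝ E j) α)) k =
      (k : ℝ) • α k := by
  have h := extUncurry_eq_sum (leftContr.flip α)
  simp only [LinearMap.flip_apply] at h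
  rw [← h]
  cases k with
  | zero => rw [Nat.cast_zero, zero_smul]; rfl
  | succ k =>
    rw [Nat.cast_smul_eq_nsmul]
    exact ContinuousAlternatingMap.alternatizeUncurryFin_curryLeft (α (k + 1))

end ExteriorAlgebra

section BivectorContraction

/-! ### Contraction with a bivector -/

variable {E : Type*} [NormedAddCommGroup E] [NormedSpace ℝ E] [FiniteDimensional ℝ E]
  {F : Type*} [AddCommGroup F] [Module ℝ F]

theorem contract_add (w : Bivector E) (f g : E → E → F) :
    contract w (fun u v => f u v + g u v) = contract w f + contract w g := by
  simp only [contract, smul_add, Finset.sum_add_distrib]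

theorem contract_neg (w : Bivector E) (f : E → E → F) :
    contract w (fun u v => - f u v) = - contract w f := by
  simp only [contract, smul_neg, Finset.sum_neg_distrib]

theorem contract_swap (w : Bivector E) (f : E → E → F) :
    contract w (fun u v => f v u) = - contract w f := by
  have hw : ∀ i j : Fin (Module.finrank ℝ E),
      w ![dualVec j, dualVec i] = - w ![dualVec i, dualVec j] := by
    intro i j
    have h := w.map_swap ![dualVec i, dualVec j] (i := 0) (j := 1) (by decide)
    have hv : ![dualVec j, dualVec i] =
        ![dualVec i, dualVec j] ∘ Equiv.swap (0 : Fin 2) (1 : Fin 2) := by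
      funext t
      fin_cases t <;> rfl
    rw [hv]
    exact h
  rw [contract, Finset.sum_comm, contract, ← Finset.sum_neg_distrib]
  refine Finset.sum_congr rfl fun i _ => ?_
  rw [← Finset.sum_neg_distrib]
  refine Finset.sum_congr rfl fun j _ => ?_
  rw [hw i j, neg_smul]

/-- Contraction with a bivector is an even operator: passing two vectors produces two signs, which
cancel. -/
theorem bivContr_leftContr (w : Bivector E) (v : E) (α : Ext E) :
    bivContr w (leftContr v α) = leftContr v (bivContr w α) := by
  rw [bivContr_apply, bivContr_apply, map_smul, map_contract]
  congr 2
  funext u u'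
  rw [leftContr_comm u' v, map_neg, leftContr_comm u v, neg_neg]

theorem bivContr_extParity (w : Bivector E) (α : Ext E) :
    bivContr w (extParity α) = extParity (bivContr w α) := by
  rw [bivContr_apply, bivContr_apply, map_smul, map_contract]
  congr 2
  funext u u'
  rw [leftContr_extParity, map_neg, leftContr_extParity, neg_neg]

theorem bivContr_rightContr (w : Bivector E) (v : E) (α : Ext E) :
    bivContr w (rightContr v α) = rightContr v (bivContr w α) := by
  rw [rightContr_eq, bivContr_extParity, bivContr_leftContr, rightContr_eq]

theorem bivContr_extOne (w : Bivector E) : bivContr w (extOne E) = 0 := by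
  rw [bivContr_apply]
  simp [leftContr_extOne, contract]

theorem leftContr_leftContr_wedge (u v : E) (α β : Ext E) :
    leftContr u (leftContr v (wedge α β)) =
      (wedge (leftContr u (leftContr v α)) β + wedge α (leftContr u (leftContr v β))) +
      (wedge (rightContr v α) (leftContr u β) + - wedge (rightContr u α) (leftContr v β)) := by
  simp only [leftContr_wedge, map_add, rightContr_eq, leftContr_extParity, extParity_extParity,
    map_neg, LinearMap.neg_apply]
  abel

/-- The two mixed terms of the double Leibniz rule are exchanged, up to sign, by swapping `u` and
`v`. Antisymmetry of `w` makes their contributions equal, and the resulting factor two cancels the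
`½` in `bivContr`. -/
theorem bivContr_wedge (w : Bivector E) (α β : Ext E) :
    bivContr w (wedge α β) =
      wedge (bivContr w α) β + wedge α (bivContr w β) - iterContr w 1 α β := by
  have h1 : wedge (contract w fun u v => leftContr u (leftContr v α)) β =
      contract w fun u v => wedge (leftContr u (leftContr v α)) β :=
    map_contract (wedge.flip β) w _
  have h1' : wedge α (contract w fun u v => leftContr u (leftContr v β)) =
      contract w fun u v => wedge α (leftContr u (leftContr v β)) :=
    map_contract (wedge α) w _
  have h2 := contract_swap w fun u v => wedge (rightContr u α) (leftContr v β)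
  simp only [bivContr_apply, leftContr_leftContr_wedge, contract_add, contract_neg, h2, map_smul,
    LinearMap.smul_apply, h1, h1', iterContr_succ_apply]
  rw [show iterContr w 0 = wedge from rfl]
  module

/-- Contraction with `w` commutes with the contractions by vectors that make up the pairing, so the
case `n = 0` passes through any number of pairings. -/
theorem bivContr_iterContr (w : Bivector E) (n : ℕ) (α β : Ext E) :
    bivContr w (iterContr w n α β) =
      iterContr w n (bivContr w α) β + iterContr w n α (bivContr w β) -
        iterContr w (n + 1) α β := by
  induction n generalizing α β with
  | zero => exact bivContr_wedge w α β
  | succ n ih =>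
    rw [iterContr_succ_apply, map_contract]
    simp only [ih, bivContr_leftContr, bivContr_rightContr, sub_eq_add_neg, contract_add,
      contract_neg]
    rw [iterContr_succ_apply w n, iterContr_succ_apply w n, iterContr_succ_apply w (n + 1)]

theorem extCovector_add (φ ψ : E →L[ℝ] ℝ) :
    extCovector (φ + ψ) = extCovector φ + extCovector ψ := by
  funext k
  match k with
  | 0 => exact (add_zero _).symm
  | 1 => ext v; rfl
  | _ + 2 => exact (add_zero _).symm

theorem extCovector_smul (c : ℝ) (φ : E →L[ℝ] ℝ) :
    extCovector (c • φ) = c • extCovector φ := by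
  funext k
  match k with
  | 0 => exact (smul_zero c).symm
  | 1 => ext v; rfl
  | _ + 2 => exact (smul_zero c).symm

variable (E) in
/-- Covectors as elements of `Λ(E*)`, linearly. -/
noncomputable def extCovectorHom : (E →L[ℝ] ℝ) →ₗ[ℝ] Ext E where
  toFun := extCovector
  map_add' := extCovector_add
  map_smul' := extCovector_smul

/-- The sign appears because `flat` puts `v` in the last slot, whereas contraction puts it in the
first. -/
theorem leftContr_of_deg_two {s : Ext E} (hs : ∀ k, k ≠ 2 → s k = 0) (v : E) :
    leftContr v s = - extCovector (flat (s 2) v) := by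
  funext k
  rw [leftContr_apply, Pi.neg_apply]
  match k with
  | 0 =>
    rw [hs _ (by decide), extCovector_apply_zero, neg_zero]
    ext; rfl
  | 1 =>
    ext y
    have h := (s 2).map_swap ![v, y 0] (i := 0) (j := 1) (by decide)
    have h1 : Matrix.vecCons v y = ![v, y 0] := by
      funext t
      fin_cases t <;> rfl
    have h2 : ![v, y 0] ∘ Equiv.swap (0 : Fin 2) 1 = ![y 0, v] := by
      funext t
      fin_cases t <;> rfl
    rw [ContinuousAlternatingMap.curryLeft_apply_apply, h1]
    rw [h2] at h
    change s 2 ![v, y 0] = - s 2 ![y 0, v]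
    exact (neg_eq_iff_eq_neg.2 h).symm
  | k + 2 =>
    rw [hs _ (by omega)]
    refine Eq.trans ?_ neg_zero.symm
    ext; rfl

/-- The coefficients are the coordinates of the vector dual to `eʲ` under `τ`, and `flat` takes that
vector back to `eʲ`. -/
theorem sum_invBiv_smul_flat {τ : E [⋀^Fin 2]→L[ℝ] ℝ} (hτ : (flat τ).IsInvertible)
    (j : Fin (Module.finrank ℝ E)) :
    ∑ i, invBiv τ ![dualVec i, dualVec j] • flat τ (Module.finBasis ℝ E i) = dualVec j := by
  have h : ∑ i, dualVec i ((flat τ).inverse (dualVec j)) • flat τ (Module.finBasis ℝ E i) =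
      flat τ ((flat τ).inverse (dualVec j)) := by
    conv_rhs => rw [← sum_dualVec_smul ((flat τ).inverse (dualVec j)), map_sum]
    simp only [map_smul]
  refine h.trans ?_
  obtain ⟨e, he⟩ := hτ
  rw [← he, ContinuousLinearMap.inverse_equiv]
  exact e.apply_symm_apply _

/-- Since `w` is inverse to `s`, contracting `s` in the first index of `w` gives `eʲ`. The pairing
with `s` thus becomes the Euler operator. -/
theorem iterContr_one_of_deg_two {s : Ext E} (hs : ∀ k, k ≠ 2 → s k = 0)
    (hi : (flat (s 2)).IsInvertible) (α : Ext E) (k : ℕ) :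
    iterContr (invBiv (s 2)) 1 s α k = (k : ℝ) • α k := by
  rw [← sum_extCovector_wedge_leftContr, iterContr_succ_apply,
    show iterContr (invBiv (s 2)) 0 = wedge from rfl]
  refine congrFun ?_ k
  rw [contract, Finset.sum_comm]
  refine Finset.sum_congr rfl fun j _ => ?_
  have h : extCovectorHom E (dualVec j) = _ :=
    congrArg (extCovectorHom E) (sum_invBiv_smul_flat hi j).symm
  rw [show extCovector (dualVec j) = extCovectorHom E (dualVec j) from rfl, h, map_sum, map_sum,
    LinearMap.sum_apply]
  refine Finset.sum_congr rfl fun i _ => ?_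
  rw [map_smul, map_smul, LinearMap.smul_apply, rightContr_eq, leftContr_of_deg_two hs, map_neg,
    extParity_extCovector, neg_neg]
  rfl

/-- The double contraction of a form with its inverse is the trace of the identity, halved by the
normalization of `bivContr`. -/
theorem bivContr_of_deg_two {s : Ext E} (hs : ∀ k, k ≠ 2 → s k = 0)
    (hi : (flat (s 2)).IsInvertible) :
    bivContr (invBiv (s 2)) s = ((Module.finrank ℝ E : ℝ) / 2) • extOne E := by
  have h : ∑ j, ∑ i, invBiv (s 2) ![dualVec i, dualVec j] *
      flat (s 2) (Module.finBasis ℝ E i) (Module.finBasis ℝ E j) = Module.finrank ℝ E := by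
    have : ∀ j, ∑ i, invBiv (s 2) ![dualVec i, dualVec j] *
      flat (s 2) (Module.finBasis ℝ E i) (Module.finBasis ℝ E j) = 1 := by
      intro j
      have h1 := congrArg (fun φ => φ (Module.finBasis ℝ E j)) (sum_invBiv_smul_flat hi j)
      simpa [dualVec] using h1
    simp [this]
  have hc := contract_swap (invBiv (s 2)) fun u v => leftContr v (leftContr u s)
  rw [bivContr_apply, hc]
  simp only [leftContr_of_deg_two hs, map_neg, leftContr_extCovector, contract_neg, neg_neg]
  rw [contract, Finset.sum_comm]
  simp only [smul_smul, ← Finset.sum_smul, h]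
  congr 1
  ring

/-- The commutator of contraction with `σ⁻¹` and exterior multiplication by `σ` is
`½ dim E - deg`. -/
theorem bivContr_wedge_of_deg_two {s : Ext E} (hs : ∀ k, k ≠ 2 → s k = 0)
    (hi : (flat (s 2)).IsInvertible) (α : Ext E) (k : ℕ) :
    bivContr (invBiv (s 2)) (wedge s α) k =
      wedge s (bivContr (invBiv (s 2)) α) k + ((Module.finrank ℝ E : ℝ) / 2 - k) • α k := by
  rw [bivContr_wedge, bivContr_of_deg_two hs hi, map_smul, LinearMap.smul_apply, extOne_wedge,
    Pi.sub_apply, Pi.add_apply, iterContr_one_of_deg_two hs hi, Pi.smul_apply,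
    sub_smul (M := E [⋀^Fin k]→L[ℝ] ℝ)]
  abel

/-! ### Degrees -/

theorem apply_eq_zero_of_finrank_lt {k : ℕ} (hk : Module.finrank ℝ E < k)
    (f : E [⋀^Fin k]→L[ℝ] ℝ) : f = 0 := by
  ext v
  refine f.toAlternatingMap.map_linearDependent v fun hv => ?_
  have := hv.fintype_card_le_finrank
  rw [Fintype.card_fin] at this
  omega

/-- A bound on the degrees that occur drops by two with each contraction. As degrees are bounded by
the dimension, this yields nilpotency. -/
theorem bivContr_pow_apply (w : Bivector E) {α : Ext E} {a : ℕ} (hα : ∀ k, a ≤ k → α k = 0)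
    (k : ℕ) (hk : a ≤ k + 2) : bivContr w α k = 0 := by
  rw [bivContr_apply, Pi.smul_apply, contract]
  simp only [Finset.sum_apply, Pi.smul_apply, leftContr_apply, hα _ hk]
  refine (smul_eq_zero.2 (Or.inr ?_))
  refine Finset.sum_eq_zero fun i _ => Finset.sum_eq_zero fun j _ => ?_
  exact smul_eq_zero.2 (Or.inr (by ext; rfl))

/-- Each pairing uses up one degree of the first factor. For this reason the finite sum in
`qWedgeAux` loses no terms. -/
theorem iterContr_eq_zero (w : Bivector E) {n a : ℕ} {α β : Ext E}
    (hα : ∀ k, a ≤ k → α k = 0) (hn : a ≤ n) : iterContr w n α β = 0 := by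
  induction n generalizing α β a with
  | zero =>
    have : α = 0 := funext fun k => hα k (by omega)
    rw [this, map_zero, LinearMap.zero_apply]
  | succ n ih =>
    rw [iterContr_succ_apply, contract]
    refine Finset.sum_eq_zero fun i _ => Finset.sum_eq_zero fun j _ => ?_
    rw [ih (a := a - 1) (fun k hk => ?_) (by omega), smul_zero]
    rw [rightContr_eq, extParity_apply, leftContr_apply, hα _ (by omega)]
    refine smul_eq_zero.2 (Or.inr (by ext; rfl))

theorem iterContr_eq_zero_of_finrank_lt (w : Bivector E) {n : ℕ} (hn : Module.finrank ℝ E < n)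
    (α β : Ext E) : iterContr w n α β = 0 :=
  iterContr_eq_zero w (a := Module.finrank ℝ E + 1)
    (fun k hk => apply_eq_zero_of_finrank_lt (by omega) (α k)) hn

end BivectorContraction

section GradedModules

/-! ### Internal direct sums -/

/-- A criterion for a family of submodules to be an internal direct sum: they span, and there are
submodules separating each of them from the others. -/
theorem isInternal_of_submodule {k K : Type*} [Field k] [AddCommGroup K] [Module k K]
    (gr P : ℤ → Submodule k K) (h0 : ∀ m n, m ≠ n → ∀ x ∈ gr m, x ∈ P n)
    (hinj : ∀ n, ∀ x ∈ gr n, x ∈ P n → x = 0) (htop : ∀ x, x ∈ ⨆ n, gr n) :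
    DirectSum.IsInternal gr := by
  rw [DirectSum.isInternal_submodule_iff_iSupIndep_and_iSup_eq_top]
  refine ⟨fun n => ?_, eq_top_iff.2 fun x _ => htop x⟩
  rw [Submodule.disjoint_def]
  intro x hx hx'
  have : ⨆ m, ⨆ (_ : m ≠ n), gr m ≤ P n := iSup₂_le fun m hm y hy => h0 m n hm y hy
  exact hinj n x hx (this hx')

/-- A criterion for a family of submodules to be an internal direct sum: they span, and there are
linear maps separating each of them from the others. -/
theorem isInternal_of_separating {k K K' : Type*} [Field k] [AddCommGroup K] [Module k K]
    [AddCommGroup K'] [Module k K'] (gr : ℤ → Submodule k K) (π : ℤ → K →ₗ[k] K')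
    (h0 : ∀ m n, m ≠ n → ∀ x ∈ gr m, π n x = 0) (hinj : ∀ n, ∀ x ∈ gr n, π n x = 0 → x = 0)
    (htop : ∀ x, x ∈ ⨆ n, gr n) : DirectSum.IsInternal gr :=
  isInternal_of_submodule gr (fun n => LinearMap.ker (π n)) h0 hinj htop

end GradedModules

section FormDGA

/-! ### The de Rham algebra -/

variable {E : Type*} [NormedAddCommGroup E] [NormedSpace ℝ E]
  {M : Type*} [TopologicalSpace M] [ChartedSpace E M]

theorem Form.ext {α β : Form E M} (h : ∀ x, α.toFun x = β.toFun x) : α = β :=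
  Subtype.ext (funext h)

theorem Form.toFun_add (α β : Form E M) (x : M) : (α + β).toFun x = α.toFun x + β.toFun x := rfl

theorem Form.toFun_sub (α β : Form E M) (x : M) : (α - β).toFun x = α.toFun x - β.toFun x := rfl

theorem Form.toFun_smul (c : ℝ) (α : Form E M) (x : M) : (c • α).toFun x = c • α.toFun x := rfl

theorem oneForm_toFun (x : M) : (oneForm (E := E) (M := M)).toFun x = extOne E := by
  ext1 k
  cases k <;> rfl

theorem parity_toFun (α : Form E M) (x : M) : (parity α).toFun x = extParity (α.toFun x) := rfl

/-- The component of degree `n` of a form. -/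
noncomputable def formComp (n : ℤ) : Form E M →ₗ[ℝ] Form E M where
  toFun α := ⟨fun x k => if (k : ℤ) = n then α.toFun x k else 0, fun x₀ k => by
    by_cases h : (k : ℤ) = n
    · refine (α.smooth x₀ k).congr fun y _ => ?_
      simp only [locRep, pull_apply, if_pos h]
    · refine (contDiffOn_const (c := 0)).congr fun y _ => ?_
      simp only [locRep, pull_apply, if_neg h]
      rfl⟩
  map_add' α β := Form.ext fun x => funext fun k => by
    change (if (k : ℤ) = n then α.toFun x k + β.toFun x k else 0) =
      (if (k : ℤ) = n then α.toFun x k else 0) + if (k : ℤ) = n then β.toFun x k else 0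
    split_ifs
    · rfl
    · exact (add_zero _).symm
  map_smul' c α := Form.ext fun x => funext fun k => by
    change (if (k : ℤ) = n then c • α.toFun x k else 0) =
      c • if (k : ℤ) = n then α.toFun x k else 0
    split_ifs
    · rfl
    · exact (smul_zero _).symm

theorem formComp_toFun (n : ℤ) (α : Form E M) (x : M) (k : ℕ) :
    (formComp n α).toFun x k = if (k : ℤ) = n then α.toFun x k else 0 := rfl

theorem formComp_mem (n : ℤ) (α : Form E M) : formComp n α ∈ formDeg E M n :=
  fun _ _ hk => if_neg hk

theorem formComp_of_mem {n : ℤ} {α : Form E M} (h : α ∈ formDeg E M n) : formComp n α = α :=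
  Form.ext fun x => funext fun k => by
    rw [formComp_toFun]
    split_ifs with hk
    · rfl
    · exact (h x k hk).symm

theorem formComp_of_mem_ne {m n : ℤ} (hmn : m ≠ n) {α : Form E M} (h : α ∈ formDeg E M m) :
    formComp n α = 0 :=
  Form.ext fun x => funext fun k => by
    rw [formComp_toFun]
    split_ifs with hk
    · exact h x k (by omega)
    · rfl

variable [FiniteDimensional ℝ E]

theorem sum_formComp (α : Form E M) :
    ∑ k ∈ Finset.range (Module.finrank ℝ E + 1), formComp (k : ℤ) α = α := by
  refine Form.ext fun x => funext fun k => ?_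
  have hs : ∀ (s : Finset ℕ) (f : ℕ → Form E M),
      (∑ i ∈ s, f i).toFun x k = ∑ i ∈ s, (f i).toFun x k := by
    intro s f
    classical
    induction s using Finset.induction_on with
    | empty => rfl
    | insert a s ha ih =>
      rw [Finset.sum_insert ha, Finset.sum_insert ha, ← ih]
      rfl
  rw [hs]
  simp only [formComp_toFun, Nat.cast_inj]
  rw [Finset.sum_ite_eq]
  split_ifs with hk
  · rfl
  · rw [Finset.mem_range] at hk
    exact (apply_eq_zero_of_finrank_lt (by omega) _).symm

theorem isInternal_formDeg : DirectSum.IsInternal (formDeg E M) := by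
  refine isInternal_of_separating _ (fun n => formComp n)
    (fun m n hmn x hx => formComp_of_mem_ne hmn hx)
    (fun n x hx h => (formComp_of_mem hx).symm.trans h) fun x => ?_
  rw [← sum_formComp x]
  exact Submodule.sum_mem _ fun k _ => Submodule.mem_iSup_of_mem (k : ℤ) (formComp_mem _ _)

theorem formWedge_toFun (α β : Form E M) (x : M) :
    (formWedge α β).toFun x = wedge (α.toFun x) (β.toFun x) := rfl

theorem formWedge_mem {i j : ℤ} {α β : Form E M} (hα : α ∈ formDeg E M i)
    (hβ : β ∈ formDeg E M j) : formWedge α β ∈ formDeg E M (i + j) := by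
  intro x k hk
  rw [formWedge_toFun, wedge_apply]
  refine Finset.sum_eq_zero fun p _ => ?_
  have hp := Finset.HasAntidiagonal.mem_antidiagonal.1 p.2
  by_cases h1 : (p.1.1 : ℤ) = i
  · rw [hβ x p.1.2 (by omega), map_zero]
  · rw [hα x _ h1, map_zero, LinearMap.zero_apply]

theorem parity_of_mem {n : ℤ} {α : Form E M} (hα : α ∈ formDeg E M n) :
    parity α = ((-1 : ℝ) ^ n) • α := by
  refine Form.ext fun x => funext fun k => ?_
  rw [parity_toFun, extParity_apply, Form.toFun_smul, Pi.smul_apply]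
  by_cases hk : (k : ℤ) = n
  · rw [← hk, zpow_natCast]
  · rw [hα x k hk, smul_zero, smul_zero]

/-- The derivative of a function with values in `Λ(E*)`. -/
noncomputable def extFDeriv (f : E → Ext E) (y : E) : E →ₗ[ℝ] Ext E :=
  LinearMap.pi fun k => (fderiv ℝ (fun y => f y k) y).toLinearMap

theorem extFDeriv_apply (f : E → Ext E) (y v : E) (k : ℕ) :
    extFDeriv f y v k = fderiv ℝ (fun y => f y k) y v := rfl

theorem dRaw_eq (α : M → Ext E) (x : M) :
    dRaw α x = extUncurry (extFDeriv (locRep α x) (chartAt E x x)) := by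
  ext1 k
  cases k <;> rfl

theorem extFDeriv_wedge {f g : E → Ext E} {y : E}
    (hf : ∀ k, DifferentiableAt ℝ (fun y => f y k) y)
    (hg : ∀ k, DifferentiableAt ℝ (fun y => g y k) y) (v : E) :
    extFDeriv (fun y => wedge (f y) (g y)) y v =
      wedge (extFDeriv f y v) (g y) + wedge (f y) (extFDeriv g y v) := by
  ext1 m
  rw [extFDeriv_apply, Pi.add_apply, wedge_apply, wedge_apply, ← Finset.sum_add_distrib]
  have h : ∀ p : {p : ℕ × ℕ // p ∈ Finset.HasAntidiagonal.antidiagonal m},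
      HasFDerivAt (fun y => wedgeHom (Finset.HasAntidiagonal.mem_antidiagonal.1 p.2)
        (f y p.1.1) (g y p.1.2)) _ y := fun p =>
    ((wedgeHom (E := E) (Finset.HasAntidiagonal.mem_antidiagonal.1
      p.2)).toContinuousBilinearMap).hasFDerivAt_of_bilinear
        (hf p.1.1).hasFDerivAt (hg p.1.2).hasFDerivAt
  have h2 := HasFDerivAt.fun_sum (u := Finset.univ) fun p _ => h p
  simp only [wedge_apply]
  rw [h2.fderiv, sum_apply]
  refine Finset.sum_congr rfl fun p _ => ?_
  rw [add_comm]
  rfl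

/-- With `d = ∑ⱼ eʲ ∧ ∂ⱼ` this is the ordinary product rule, followed by moving `eʲ` past `f` in the
second term. -/
theorem extUncurry_extFDeriv_wedge {f g : E → Ext E} {y : E}
    (hf : ∀ k, DifferentiableAt ℝ (fun y => f y k) y)
    (hg : ∀ k, DifferentiableAt ℝ (fun y => g y k) y) :
    extUncurry (extFDeriv (fun y => wedge (f y) (g y)) y) =
      wedge (extUncurry (extFDeriv f y)) (g y) +
        wedge (extParity (f y)) (extUncurry (extFDeriv g y)) := by
  simp only [extUncurry_eq_sum, extFDeriv_wedge hf hg, map_add, map_sum, LinearMap.sum_apply,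
    ← Finset.sum_add_distrib]
  refine Finset.sum_congr rfl fun j _ => ?_
  rw [← wedge_assoc, ← wedge_assoc, extCovector_wedge_comm _ (f y), wedge_assoc,
    wedge_assoc (extParity (f y))]

theorem extDeriv_zero_fun {k : ℕ} (y : E) :
    extDeriv (fun _ : E => (0 : E [⋀^Fin k]→L[ℝ] ℝ)) y = 0 := by
  simp only [extDeriv, fderiv_fun_const, Pi.zero_apply]
  exact map_zero (ContinuousAlternatingMap.alternatizeUncurryFinCLM ℝ E ℝ)

/-- The tangent space at `x` is identified with `E` by the chart in which `d` is computed at `x`, so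
undifferentiated factors in the local Leibniz rule are the actual values. -/
theorem locRep_self (α : M → Ext E) (x : M) [IsManifold 𝓘(ℝ, E) ∞ M] :
    locRep α x (chartAt E x x) = α x := by
  have h := (chartAt E x).left_inv (mem_chart_source E x)
  rw [locRep, h, jac_self (mem_chart_target E x)]
  ext k v
  rfl

theorem locRep_wedge (α β : M → Ext E) (x : M) :
    locRep (fun x => wedge (α x) (β x)) x = fun y => wedge (locRep α x y) (locRep β x y) :=
  funext fun _ => pull_wedge _ _ _

variable [IsManifold 𝓘(ℝ, E) ∞ M]

theorem Form.differentiableAt_locRep (α : Form E M) (x : M) (k : ℕ) :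
    DifferentiableAt ℝ (fun y => locRep α.toFun x y k) (chartAt E x x) :=
  ((α.smooth x k).contDiffAt ((chartAt E x).open_target.mem_nhds
    (mem_chart_target E x))).differentiableAt (by simp)

theorem extDer_toFun (α : Form E M) (x : M) : (extDer α).toFun x = dRaw α.toFun x := rfl

theorem extDer_formWedge (α β : Form E M) :
    extDer (formWedge α β) = formWedge (extDer α) β + formWedge (parity α) (extDer β) := by
  refine Form.ext fun x => ?_
  rw [Form.toFun_add, formWedge_toFun, formWedge_toFun, extDer_toFun, extDer_toFun, extDer_toFun,
    parity_toFun, dRaw_eq, dRaw_eq, dRaw_eq]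
  have h := extUncurry_extFDeriv_wedge (α.differentiableAt_locRep x)
    (β.differentiableAt_locRep x)
  rw [locRep_self, locRep_self] at h
  rw [← h, ← locRep_wedge]
  rfl

theorem extDer_extDer (α : Form E M) : extDer (extDer α) = 0 := by
  refine Form.ext fun x => funext fun k => ?_
  have hy := mem_chart_target E x
  have hev := (chartAt E x).open_target.mem_nhds hy
  match k with
  | 0 => rfl
  | 1 =>
    change extDeriv (fun y => locRep (dRaw α.toFun) x y 0) (chartAt E x x) = 0
    have : (fun y => locRep (dRaw α.toFun) x y 0) = fun _ : E => (0 : E [⋀^Fin 0]→L[ℝ] ℝ) := rfl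
    rw [this]
    exact extDeriv_zero_fun _
  | k + 2 =>
    change extDeriv (fun y => locRep (dRaw α.toFun) x y (k + 1)) (chartAt E x x) = 0
    -- The definition of `dα` uses a chart that changes from point to point. Naturality of the
    -- exterior derivative expresses it near `x` in the single chart at `x`, where the square of the
    -- derivative vanishes.
    have : (fun y => locRep (dRaw α.toFun) x y (k + 1)) =ᶠ[nhds (chartAt E x x)]
        extDeriv fun y => locRep α.toFun x y k := by
      filter_upwards [hev] with z hz using locRep_dRaw_succ α.smooth x k hz
    rw [this.extDeriv_eq]
    exact extDeriv_extDeriv_apply ((α.smooth x k).contDiffAt hev) (by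
      simp only [minSmoothness_of_isRCLikeNormedField]
      exact WithTop.coe_le_coe.2 (le_top : (2 : ℕ∞) ≤ ⊤))

theorem extDer_mem {n : ℤ} {α : Form E M} (hα : α ∈ formDeg E M n) :
    extDer α ∈ formDeg E M (n + 1) := by
  intro x k hk
  rw [extDer_toFun]
  cases k with
  | zero => rfl
  | succ k =>
    change extDeriv (fun y => locRep α.toFun x y k) (chartAt E x x) = 0
    have : (fun y => locRep α.toFun x y k) = fun _ => 0 := by
      funext y
      rw [locRep, pull_apply, hα _ k (by omega)]
      rfl
    rw [this]
    exact extDeriv_zero_fun _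

variable (E M) in
/-- The de Rham algebra is a differential graded algebra. -/
theorem isDGA_form : IsDGA ℝ (formDeg E M) extDer formWedge oneForm parity where
  internal := isInternal_formDeg
  one_mem x k hk := by
    cases k with
    | zero => exact absurd rfl hk
    | succ k => rfl
  mul_mem := formWedge_mem
  one_mul α := Form.ext fun x => by rw [formWedge_toFun, oneForm_toFun, extOne_wedge]
  mul_one α := Form.ext fun x => by rw [formWedge_toFun, oneForm_toFun, wedge_extOne]
  mul_assoc α β γ := Form.ext fun x => by simp only [formWedge_toFun, wedge_assoc]
  D_mem := extDer_mem
  D_D := extDer_extDer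
  s_apply := parity_of_mem
  leibniz := extDer_formWedge

/-! ### The operators on forms given by a bivector field -/

theorem formContr_toFun (w : BivectorField E M) (α : Form E M) (x : M) :
    (formContr w α).toFun x = bivContr (w.toFun x) (α.toFun x) := rfl

theorem formContr_mem (w : BivectorField E M) {n : ℤ} {α : Form E M} (hα : α ∈ formDeg E M n) :
    formContr w α ∈ formDeg E M (n - 2) := by
  intro x k hk
  rw [formContr_toFun, bivContr_apply, Pi.smul_apply, contract]
  have : ∀ u v : E, leftContr u (leftContr v (α.toFun x)) k = 0 := by
    intro u v
    rw [leftContr_apply, leftContr_apply, hα x (k + 1 + 1) (by push_cast; omega)]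
    ext; rfl
  simp only [Finset.sum_apply, Pi.smul_apply, this]
  simp

theorem formContr_oneForm (w : BivectorField E M) : formContr w oneForm = 0 :=
  Form.ext fun x => by rw [formContr_toFun, oneForm_toFun, bivContr_extOne]; rfl

theorem formContr_parity (w : BivectorField E M) (α : Form E M) :
    formContr w (parity α) = parity (formContr w α) :=
  Form.ext fun _ => bivContr_extParity _ _

theorem formContr_pow_eq_zero (w : BivectorField E M) :
    (formContr w) ^ (Module.finrank ℝ E + 1) = 0 := by
  -- Contraction lowers the top degree by two, but counting one degree per step is enough and keeps
  -- the bound simple.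
  have h : ∀ (j : ℕ) (α : Form E M) (x : M) (k : ℕ), Module.finrank ℝ E + 1 ≤ j + k →
      ((formContr w ^ j) α).toFun x k = 0 := by
    intro j
    induction j with
    | zero => exact fun α x k hk => apply_eq_zero_of_finrank_lt (by omega) _
    | succ j ih =>
      intro α x k hk
      rw [pow_succ', Module.End.mul_apply, formContr_toFun]
      exact bivContr_pow_apply _ (a := Module.finrank ℝ E + 1 - j)
        (fun k' hk' => ih α x k' (by omega)) k (by omega)
  ext1 α
  exact Form.ext fun _ => funext fun _ => h _ α _ _ (by omega)

/-- The coefficient of `hⁿ / n!` in the quantum exterior product of forms. -/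
theorem formWedgeCoeff_toFun (w : BivectorField E M) (n : ℕ) (α β : Form E M) (x : M) :
    (formWedgeCoeff w n α β).toFun x =
      ((n.factorial : ℝ)⁻¹) • iterContr (w.toFun x) n (α.toFun x) (β.toFun x) := rfl

theorem formWedgeCoeff_zero (w : BivectorField E M) : formWedgeCoeff w 0 = formWedge := by
  ext1 α
  ext1 β
  refine Form.ext fun x => ?_
  rw [formWedgeCoeff_toFun, Nat.factorial_zero, Nat.cast_one, inv_one, one_smul]
  rfl

/-- The factor `1 / n!` turns `bivContr_iterContr` into the recursion for the Taylor coefficients of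
an exponential in `h`. -/
theorem formWedgeCoeff_succ (w : BivectorField E M) (n : ℕ) (α β : Form E M) :
    ((n + 1 : ℕ) : ℝ) • formWedgeCoeff w (n + 1) α β =
      formWedgeCoeff w n (formContr w α) β + formWedgeCoeff w n α (formContr w β) -
        formContr w (formWedgeCoeff w n α β) := by
  refine Form.ext fun x => ?_
  rw [Form.toFun_sub, Form.toFun_add, Form.toFun_smul, formContr_toFun]
  simp only [formWedgeCoeff_toFun, formContr_toFun, map_smul, bivContr_iterContr, ← smul_add,
    ← smul_sub, smul_smul]
  rw [sub_sub_cancel, Nat.factorial_succ]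
  congr 1
  push_cast
  field_simp

theorem formWedgeCoeff_eq_zero (w : BivectorField E M) {n : ℕ} (hn : Module.finrank ℝ E < n) :
    formWedgeCoeff w n = 0 := by
  ext1 α
  ext1 β
  refine Form.ext fun x => ?_
  rw [formWedgeCoeff_toFun, iterContr_eq_zero_of_finrank_lt _ hn, smul_zero]
  rfl

end FormDGA

section SlTwo

attribute [local instance] LieRing.ofAssociativeRing

/-! ### The commutator of contraction with Koszul's codifferential -/

/-- In a representation of `sl₂` with `f` nilpotent, a highest weight vector `d` of weight 1 satisfies
`[f, [f, d]] = 0`; here the representation is by commutators. -/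
theorem lie_lie_eq_zero_of_weight_one {A : Type*} [Ring A] [Algebra ℝ A] {L Λ H d : A}
    (hH : ⁅Λ, L⁆ = H) (hL : ⁅L, d⁆ = 0) (hd : ⁅H, d⁆ = -d) (hΛ : ⁅H, Λ⁆ = (2 : ℝ) • Λ)
    (hN : IsNilpotent Λ) : ⁅Λ, ⁅Λ, d⁆⁆ = 0 := by
  set v : ℕ → A := fun k => ((LieAlgebra.ad ℝ A Λ) ^ k) d with hv
  have v_succ : ∀ k, v (k + 1) = ⁅Λ, v k⁆ := fun k => by
    simp only [hv, pow_succ', Module.End.mul_apply, LieAlgebra.ad_apply]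
  have v_zero : v 0 = d := rfl
  have hHv : ∀ k, ⁅H, v k⁆ = (2 * k - 1 : ℝ) • v k := by
    intro k
    induction k with
    | zero => rw [v_zero, hd]; simp
    | succ k ih =>
      rw [v_succ, leibniz_lie, hΛ, ih, smul_lie, lie_smul, ← v_succ, ← add_smul]
      congr 1
      push_cast
      ring
  -- The coefficient is minus the sum of the weights `2j - 1` for `0 ≤ j ≤ k`.
  have hLv : ∀ k : ℕ, ⁅L, v (k + 1)⁆ = (1 - (k : ℝ) ^ 2) • v k := by
    intro k
    induction k with
    | zero =>
      rw [v_succ, leibniz_lie, v_zero, hL, ← lie_skew L Λ, hH, neg_lie, hd]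
      simp
    | succ k ih =>
      rw [v_succ, leibniz_lie, ih, ← lie_skew L Λ, hH, neg_lie, hHv, lie_smul, ← v_succ,
        ← neg_smul, ← add_smul]
      congr 1
      push_cast
      ring
  -- The coefficient `1 - (k + 2)²` is nonzero, so vanishing descends. It stops at `v 2`, because
  -- the coefficient linking `v 2` to `v 1` is zero.
  have hdown : ∀ k, v (k + 3) = 0 → v (k + 2) = 0 := by
    intro k hk
    have h := hLv (k + 2)
    rw [hk, lie_zero] at h
    refine (smul_eq_zero.1 h.symm).resolve_left ?_
    push_cast
    nlinarith [Nat.cast_nonneg (α := ℝ) k]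
  obtain ⟨n, hn⟩ := LieAlgebra.ad_nilpotent_of_nilpotent (R := ℝ) hN
  have hall : ∀ k, v (k + 2) = 0 → v 2 = 0 := by
    intro k
    induction k with
    | zero => exact id
    | succ k ih => exact fun h => ih (hdown k h)
  have h2 : v 2 = 0 := hall n (by simp only [hv, add_comm n, pow_add, hn, mul_zero]; rfl)
  rwa [v_succ, v_succ, v_zero] at h2

end SlTwo

/-! ### The `sl₂` action on the forms of a symplectic manifold -/

section SymplecticForm

variable {E : Type*} [NormedAddCommGroup E] [NormedSpace ℝ E] [FiniteDimensional ℝ E]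
  {M : Type*} [TopologicalSpace M] [ChartedSpace E M] [IsManifold 𝓘(ℝ, E) ∞ M]

/-- Linear maps on forms agree if they agree on homogeneous forms. -/
theorem form_hom_ext {F : Type*} [AddCommGroup F] [Module ℝ F] {S T : Form E M →ₗ[ℝ] F}
    (h : ∀ (n : ℤ), ∀ α ∈ formDeg E M n, S α = T α) : S = T := by
  ext1 α
  rw [← sum_formComp α, map_sum, map_sum]
  exact Finset.sum_congr rfl fun k _ => h k _ (formComp_mem _ _)

/-- For a closed non-degenerate 2-form `σ` and `w = σ⁻¹`, contraction with `w` commutes with Koszul's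
codifferential. -/
theorem commute_formContr_codiff {τ : Form E M} (hτ : τ ∈ formDeg E M 2) (hcl : extDer τ = 0)
    (hi : ∀ x, (flat (τ.toFun x 2)).IsInvertible) {w : BivectorField E M}
    (hw : ∀ x, w.toFun x = invBiv (τ.toFun x 2)) :
    Commute (formContr w) (codiff w) := by
  have hs : ∀ x k, k ≠ 2 → τ.toFun x k = 0 := fun x k hk => hτ x k (by exact_mod_cast hk)
  -- The bracket of `Λ` and `L` acts by a scalar on each degree, so its brackets with homogeneous
  -- operators only record the shift of degree: `d` shifts by `1` and `Λ` by `-2`.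
  have hH : ∀ (n : ℤ), ∀ α ∈ formDeg E M n,
      ⁅formContr w, formWedge τ⁆ α = ((Module.finrank ℝ E : ℝ) / 2 - n) • α := by
    intro n α hα
    refine Form.ext fun x => funext fun k => ?_
    change (bivContr (w.toFun x) (wedge (τ.toFun x) (α.toFun x)) -
      wedge (τ.toFun x) (bivContr (w.toFun x) (α.toFun x))) k =
        ((Module.finrank ℝ E : ℝ) / 2 - n) • α.toFun x k
    rw [Pi.sub_apply, hw, bivContr_wedge_of_deg_two (hs x) (hi x), add_sub_cancel_left]
    by_cases hk : (k : ℤ) = n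
    · rw [← hk, Int.cast_natCast]
    · rw [hα x k hk, smul_zero, smul_zero]
  have hpar : parity τ = τ := by
    rw [parity_of_mem hτ]
    simp
  have h := lie_lie_eq_zero_of_weight_one (A := Module.End ℝ (Form E M)) (L := formWedge τ)
    (Λ := formContr w) (d := extDer) rfl ?_ ?_ ?_ ⟨_, formContr_pow_eq_zero w⟩
  · exact commute_iff_lie_eq.2 h
  -- Exterior multiplication by `τ` commutes with `d` because `τ` is closed and of even degree.
  · ext1 α
    change formWedge τ (extDer α) - extDer (formWedge τ α) = 0
    rw [extDer_formWedge, hcl, hpar, map_zero, LinearMap.zero_apply, zero_add, sub_self]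
  · refine form_hom_ext fun n α hα => ?_
    change ⁅formContr w, formWedge τ⁆ (extDer α) - extDer (⁅formContr w, formWedge τ⁆ α) =
      - extDer α
    rw [hH _ _ (extDer_mem hα), hH _ _ hα, map_smul]
    push_cast
    module
  · refine form_hom_ext fun n α hα => ?_
    change ⁅formContr w, formWedge τ⁆ (formContr w α) - formContr w (⁅formContr w, formWedge τ⁆ α) =
      (2 : ℝ) • formContr w α
    rw [hH _ _ (formContr_mem w hα), hH _ _ hα, map_smul]
    push_cast
    module

end SymplecticForm

section Exponential

/-! ### Exponentials of nilpotent elements -/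

variable {A : Type*} [Ring A] [Module ℚ A]

/-- If `N` commutes with `[N, d] = c`, then `e^N (d - c) = d e^N`. -/
theorem exp_mul_sub_lie {N d c : A} (hN : IsNilpotent N) (hc : N * d - d * N = c)
    (hcN : Commute N c) : IsNilpotent.exp N * (d - c) = d * IsNilpotent.exp N := by
  obtain ⟨K, hK⟩ := hN
  have hpow : ∀ n : ℕ, N ^ (n + 1) * d = d * N ^ (n + 1) + ((n + 1 : ℕ) : A) * (N ^ n * c) := by
    intro n
    induction n with
    | zero => rw [← hc]; simp
    | succ n ih =>
      rw [pow_succ', mul_assoc, ih, mul_add, ← mul_assoc, eq_add_of_sub_eq hc, add_mul,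
        mul_assoc d, ← pow_succ', ((Nat.cast_commute (n + 1) N).symm).left_comm, ← mul_assoc N,
        ← pow_succ', (hcN.pow_left (n + 1)).eq.symm]
      push_cast
      noncomm_ring
  have hK1 : N ^ (K + 1) = 0 := by rw [pow_succ, hK, zero_mul]
  -- Commuting `d` past `Nⁿ` lowers the power next to `c` by one, so the last sum has one term
  -- fewer. Since `N ^ K = 0`, both lengths give the full exponential.
  have hsum : (∑ n ∈ Finset.range (K + 1), (n.factorial : ℚ)⁻¹ • N ^ n) * d =
      d * (∑ n ∈ Finset.range (K + 1), (n.factorial : ℚ)⁻¹ • N ^ n) +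
        (∑ n ∈ Finset.range K, (n.factorial : ℚ)⁻¹ • N ^ n) * c := by
    rw [Finset.sum_range_succ', add_mul, mul_add, Finset.sum_mul, Finset.sum_mul, Finset.mul_sum,
      add_right_comm, ← Finset.sum_add_distrib]
    congr 1
    · refine Finset.sum_congr rfl fun n _ => ?_
      rw [smul_mul_assoc, hpow, smul_add, mul_smul_comm, smul_mul_assoc]
      congr 1
      rw [← nsmul_eq_mul, ← Nat.cast_smul_eq_nsmul ℚ, smul_smul, Nat.factorial_succ]
      congr 1
      push_cast
      field_simp
    · simp
  rw [mul_sub]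
  nth_rewrite 1 [IsNilpotent.exp_eq_sum hK1]
  rw [IsNilpotent.exp_eq_sum hK, hsum, add_sub_cancel_right, ← IsNilpotent.exp_eq_sum hK1,
    ← IsNilpotent.exp_eq_sum hK]

end Exponential

section BilinearExponential

/-! ### Deforming a bilinear map by the exponential of a nilpotent endomorphism -/

variable {R Q : Type*} [CommRing R] [AddCommGroup Q] [Module R Q]

/-- The operator `B ↦ k ∘ B ∘ (f × g)` on bilinear maps. -/
def bilinConj (f g k : Module.End R Q) : Module.End R (Q →ₗ[R] Q →ₗ[R] Q) where
  toFun B := (B.compl₁₂ f g).compr₂ k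
  map_add' B C := by ext; simp
  map_smul' c B := by ext; simp

theorem bilinConj_apply (f g k : Module.End R Q) (B : Q →ₗ[R] Q →ₗ[R] Q) (x y : Q) :
    bilinConj f g k B x y = k (B (f x) (g y)) := rfl

theorem bilinConj_mul (f g k f' g' k' : Module.End R Q) :
    bilinConj f g k * bilinConj f' g' k' = bilinConj (f' * f) (g' * g) (k * k') := rfl

theorem bilinConj_pow (f g k : Module.End R Q) (n : ℕ) :
    bilinConj f g k ^ n = bilinConj (f ^ n) (g ^ n) (k ^ n) := by
  induction n with
  | zero => rfl
  | succ n ih => rw [pow_succ', ih, bilinConj_mul, ← pow_succ, ← pow_succ, ← pow_succ']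

variable [Module ℚ Q]

/-- Acting on one slot of a bilinear map is compatible with powers, hence with exponentials. Actions
on different slots commute, so the exponential of their sum factors. -/
theorem exp_bilinConj_left {N : Module.End R Q} (hN : IsNilpotent N) :
    IsNilpotent (bilinConj N 1 1) ∧
      IsNilpotent.exp (bilinConj N 1 1) = bilinConj (IsNilpotent.exp N) 1 1 := by
  obtain ⟨K, hK⟩ := hN
  have h : bilinConj N 1 1 ^ K = 0 := by
    rw [bilinConj_pow, hK]
    ext
    simp [bilinConj_apply]
  refine ⟨⟨K, h⟩, ?_⟩
  rw [IsNilpotent.exp_eq_sum h, IsNilpotent.exp_eq_sum hK]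
  ext B x y
  simp [bilinConj_pow, bilinConj_apply, LinearMap.sum_apply, map_sum, map_rat_smul]

theorem exp_bilinConj_middle {N : Module.End R Q} (hN : IsNilpotent N) :
    IsNilpotent (bilinConj 1 N 1) ∧
      IsNilpotent.exp (bilinConj 1 N 1) = bilinConj 1 (IsNilpotent.exp N) 1 := by
  obtain ⟨K, hK⟩ := hN
  have h : bilinConj 1 N 1 ^ K = 0 := by
    rw [bilinConj_pow, hK]
    ext
    simp [bilinConj_apply]
  refine ⟨⟨K, h⟩, ?_⟩
  rw [IsNilpotent.exp_eq_sum h, IsNilpotent.exp_eq_sum hK]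
  ext B x y
  simp [bilinConj_pow, bilinConj_apply, LinearMap.sum_apply, map_sum, map_rat_smul]

theorem exp_bilinConj_right {N : Module.End R Q} (hN : IsNilpotent N) :
    IsNilpotent (bilinConj 1 1 N) ∧
      IsNilpotent.exp (bilinConj 1 1 N) = bilinConj 1 1 (IsNilpotent.exp N) := by
  obtain ⟨K, hK⟩ := hN
  have h : bilinConj 1 1 N ^ K = 0 := by
    rw [bilinConj_pow, hK]
    ext
    simp [bilinConj_apply]
  refine ⟨⟨K, h⟩, ?_⟩
  rw [IsNilpotent.exp_eq_sum h, IsNilpotent.exp_eq_sum hK]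
  ext B x y
  simp [bilinConj_pow, bilinConj_apply, LinearMap.sum_apply]

/-- If `(n + 1) Bₙ₊₁ = Bₙ(N x, y) + Bₙ(x, N y) - N Bₙ(x, y)`, then
`∑ Bₙ(x, y) = e^{-N} B₀(e^N x, e^N y)`. -/
theorem sum_bilin_eq_exp {N : Module.End R Q} (hN : IsNilpotent N)
    (B : ℕ → Q →ₗ[R] Q →ₗ[R] Q)
    (hB : ∀ n x y, ((n + 1 : ℕ) : ℚ) • B (n + 1) x y = B n (N x) y + B n x (N y) - N (B n x y))
    {K : ℕ} (hK : B K = 0) (x y : Q) :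
    ∑ n ∈ Finset.range K, B n x y =
      IsNilpotent.exp (-N) (B 0 (IsNilpotent.exp N x) (IsNilpotent.exp N y)) := by
  -- The recursion reads `T Bₙ = (n + 1) Bₙ₊₁`, that is `Bₙ = Tⁿ B₀ / n!`, so the sum of all `Bₙ` is
  -- `exp(T) B₀`.
  set T := bilinConj N 1 1 + bilinConj 1 N 1 + bilinConj 1 1 (-N) with hT
  have hTB : ∀ n, T (B n) = ((n + 1 : ℕ) : ℚ) • B (n + 1) := by
    intro n
    ext x y
    rw [LinearMap.smul_apply, LinearMap.smul_apply, hB]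
    simp [hT, bilinConj_apply, sub_eq_add_neg]
  have hTpow : ∀ n, (T ^ n) (B 0) = (n.factorial : ℚ) • B n := by
    intro n
    induction n with
    | zero => simp
    | succ n ih =>
      rw [pow_succ', Module.End.mul_apply, ih, Nat.cast_smul_eq_nsmul, map_nsmul,
        ← Nat.cast_smul_eq_nsmul ℚ, hTB, smul_smul, Nat.factorial_succ]
      congr 1
      push_cast
      ring
  obtain ⟨h1, e1⟩ := exp_bilinConj_left hN
  obtain ⟨h2, e2⟩ := exp_bilinConj_middle hN
  obtain ⟨h3, e3⟩ := exp_bilinConj_right hN.neg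
  have c12 : Commute (bilinConj N 1 1) (bilinConj 1 N 1) := rfl
  have c3 : Commute (bilinConj N 1 1 + bilinConj 1 N 1) (bilinConj 1 1 (-N)) :=
    Commute.add_left rfl rfl
  have h12 := c12.isNilpotent_add h1 h2
  have hexp : IsNilpotent.exp T =
      bilinConj (IsNilpotent.exp N) (IsNilpotent.exp N) (IsNilpotent.exp (-N)) := by
    rw [hT, IsNilpotent.exp_add_of_commute c3 h12 h3, IsNilpotent.exp_add_of_commute c12 h1 h2,
      e1, e2, e3]
    rfl
  -- Only the powers of `T` applied to `B 0` matter, so the exponential series may be cut at `K`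
  -- even if `T ^ K` is not zero.
  have hTK : (T ^ K) • B 0 = 0 := by
    change (T ^ K) (B 0) = 0
    rw [hTpow, hK, smul_zero]
  have hTn : IsNilpotent T := c3.isNilpotent_add h12 h3
  have hs := IsNilpotent.exp_smul_eq_sum (A := Module.End R (Q →ₗ[R] Q →ₗ[R] Q))
    (M := Q →ₗ[R] Q →ₗ[R] Q) (a := T) (m := B 0) (k := K) hTK hTn
  rw [hexp] at hs
  have hs' := congrArg (fun B => B x y) hs
  change IsNilpotent.exp (-N) (B 0 (IsNilpotent.exp N x) (IsNilpotent.exp N y)) = _ at hs'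
  rw [hs', LinearMap.sum_apply, LinearMap.sum_apply]
  refine Finset.sum_congr rfl fun n _ => ?_
  change _ = ((n.factorial : ℚ)⁻¹ • (T ^ n) (B 0)) x y
  rw [hTpow, smul_smul, inv_mul_cancel₀ (by exact_mod_cast n.factorial_ne_zero), one_smul]

end BilinearExponential

section Coefficients

/-! ### Polynomials with coefficients in a vector space -/

variable {V W : Type*} [AddCommGroup V] [Module ℝ V] [AddCommGroup W] [Module ℝ W]

/-- The coefficient of `hᵖ` of an element of `V[h]`. -/
noncomputable def tcoeff (p : ℕ) : ℝ[X] ⊗[ℝ] V →ₗ[ℝ] V :=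
  TensorProduct.lift (LinearMap.lsmul ℝ V ∘ₗ Polynomial.lcoeff ℝ p)

theorem tcoeff_tmul (p : ℕ) (f : ℝ[X]) (v : V) : tcoeff p (f ⊗ₜ[ℝ] v) = f.coeff p • v := rfl

theorem tcoeff_X_pow_tmul (p q : ℕ) (v : V) :
    tcoeff p ((Polynomial.X ^ q : ℝ[X]) ⊗ₜ[ℝ] v) = if p = q then v else 0 := by
  rw [tcoeff_tmul, Polynomial.coeff_X_pow]
  split_ifs <;> simp

theorem tcoeff_succ_X_smul (p : ℕ) (x : ℝ[X] ⊗[ℝ] V) :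
    tcoeff (p + 1) ((Polynomial.X : ℝ[X]) • x) = tcoeff p x := by
  induction x using TensorProduct.induction_on with
  | zero => simp
  | tmul f v => rw [TensorProduct.smul_tmul', tcoeff_tmul, tcoeff_tmul, smul_eq_mul,
      Polynomial.coeff_X_mul]
  | add x y hx hy => rw [smul_add, map_add, map_add, hx, hy]

theorem tcoeff_zero_X_smul (x : ℝ[X] ⊗[ℝ] V) :
    tcoeff 0 ((Polynomial.X : ℝ[X]) • x) = 0 := by
  induction x using TensorProduct.induction_on with
  | zero => simp
  | tmul f v => rw [TensorProduct.smul_tmul', tcoeff_tmul, smul_eq_mul,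
      Polynomial.mul_coeff_zero, Polynomial.coeff_X_zero, zero_mul, zero_smul]
  | add x y hx hy => rw [smul_add, map_add, hx, hy, add_zero]

theorem tcoeff_zero_smul (f : ℝ[X]) (x : ℝ[X] ⊗[ℝ] V) :
    tcoeff 0 (f • x) = f.coeff 0 • tcoeff 0 x := by
  induction x using TensorProduct.induction_on with
  | zero => simp
  | tmul g v => rw [TensorProduct.smul_tmul', tcoeff_tmul, tcoeff_tmul, smul_eq_mul,
      Polynomial.mul_coeff_zero, smul_smul]
  | add x y hx hy => rw [smul_add, map_add, map_add, hx, hy, smul_add]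

/-- Every sufficiently large bound is allowed, so that two elements can be expanded with a common
one. -/
theorem exists_eq_sum_tcoeff (x : ℝ[X] ⊗[ℝ] V) :
    ∃ n, ∀ m, n ≤ m → x = ∑ p ∈ Finset.range m, (Polynomial.X ^ p : ℝ[X]) ⊗ₜ[ℝ] tcoeff p x := by
  induction x using TensorProduct.induction_on with
  | zero => exact ⟨0, fun m _ => by simp⟩
  | tmul f v =>
    refine ⟨f.natDegree + 1, fun m hm => ?_⟩
    conv_lhs => rw [f.as_sum_range_C_mul_X_pow' (n := m) (by omega), TensorProduct.sum_tmul]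
    refine Finset.sum_congr rfl fun p _ => ?_
    rw [tcoeff_tmul, TensorProduct.tmul_smul, TensorProduct.smul_tmul', Polynomial.smul_eq_C_mul]
  | add x y hx hy =>
    obtain ⟨n, hn⟩ := hx
    obtain ⟨n', hn'⟩ := hy
    refine ⟨max n n', fun m hm => ?_⟩
    simp only [map_add, TensorProduct.tmul_add, Finset.sum_add_distrib]
    rw [← hn m (by omega), ← hn' m (by omega)]

theorem tcoeff_ext {x y : ℝ[X] ⊗[ℝ] V} (h : ∀ p, tcoeff p x = tcoeff p y) : x = y := by
  obtain ⟨n, hn⟩ := exists_eq_sum_tcoeff x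
  obtain ⟨n', hn'⟩ := exists_eq_sum_tcoeff y
  rw [hn (max n n') (by omega), hn' (max n n') (by omega)]
  simp only [h]

theorem tcoeff_baseChange (T : V →ₗ[ℝ] W) (p : ℕ) (x : ℝ[X] ⊗[ℝ] V) :
    tcoeff p (T.baseChange ℝ[X] x) = T (tcoeff p x) := by
  induction x using TensorProduct.induction_on with
  | zero => simp
  | tmul f v => rw [LinearMap.baseChange_tmul, tcoeff_tmul, tcoeff_tmul, map_smul]
  | add x y hx hy => rw [map_add, map_add, map_add, map_add, hx, hy]

/-- An element with vanishing constant term is divisible by `h`. -/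
theorem exists_X_smul_eq {x : ℝ[X] ⊗[ℝ] V} (hx : tcoeff 0 x = 0) :
    ∃ y : ℝ[X] ⊗[ℝ] V, x = (Polynomial.X : ℝ[X]) • y := by
  obtain ⟨n, hn⟩ := exists_eq_sum_tcoeff x
  have h := hn (n + 1) (by omega)
  rw [Finset.sum_range_succ', hx, TensorProduct.tmul_zero, add_zero] at h
  refine ⟨∑ p ∈ Finset.range n, (Polynomial.X ^ p : ℝ[X]) ⊗ₜ[ℝ] tcoeff (p + 1) x, h.trans ?_⟩
  rw [Finset.smul_sum]
  refine Finset.sum_congr rfl fun p _ => ?_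
  rw [TensorProduct.smul_tmul', smul_eq_mul, pow_succ']

end Coefficients

/-! ### Transport of structure along an automorphism -/

section Transport

/-- A differential graded algebra structure transported along an automorphism of the underlying
graded module that fixes the unit. -/
theorem IsDGA.transport {k R K : Type*} [Field k] [CommRing R] [Algebra k R] [AddCommGroup K]
    [Module k K] [Module R K] [IsScalarTower k R K] {gr : ℤ → Submodule k K} {D : K →ₗ[R] K}
    {mul : K →ₗ[R] K →ₗ[R] K} {one : K} {s : K →ₗ[R] K} (h : IsDGA k gr D mul one s)
    {U U' : K →ₗ[R] K} (hU : ∀ x, U (U' x) = x) (hU' : ∀ x, U' (U x) = x)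
    (hgr : ∀ {n x}, x ∈ gr n → U x ∈ gr n) (hgr' : ∀ {n x}, x ∈ gr n → U' x ∈ gr n)
    (hone : U one = one) (hs : ∀ x, U (s x) = s (U x)) {D' : K →ₗ[R] K}
    {mul' : K →ₗ[R] K →ₗ[R] K} (hD : ∀ x, D' x = U' (D (U x)))
    (hmul : ∀ x y, mul' x y = U' (mul (U x) (U y))) : IsDGA k gr D' mul' one s where
  internal := h.internal
  one_mem := h.one_mem
  mul_mem hx hy := by
    rw [hmul]
    exact hgr' (h.mul_mem (hgr hx) (hgr hy))
  one_mul x := by rw [hmul, hone, h.one_mul, hU']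
  mul_one x := by rw [hmul, hone, h.mul_one, hU']
  mul_assoc x y z := by simp only [hmul, hU, h.mul_assoc]
  D_mem hx := by
    rw [hD]
    exact hgr' (h.D_mem (hgr hx))
  D_D x := by rw [hD, hD, hU, h.D_D, map_zero]
  s_apply := h.s_apply
  leibniz x y := by simp only [hD, hmul, hU, hs, h.leibniz, map_add]

end Transport

section PolynomialForms

/-! ### The de Rham algebra with coefficients in `ℝ[h]` -/

variable {V : Type*} [AddCommGroup V] [Module ℝ V]

/-- The `ℝ[h]`-bilinear extension of `hⁿ B`, where `B` is a bilinear map. -/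
noncomputable def polyBilin (n : ℕ) (B : V →ₗ[ℝ] V →ₗ[ℝ] V) :
    ℝ[X] ⊗[ℝ] V →ₗ[ℝ[X]] ℝ[X] ⊗[ℝ] V →ₗ[ℝ[X]] ℝ[X] ⊗[ℝ] V :=
  LinearMap.liftBaseChange ℝ[X]
    ((LinearMap.liftBaseChangeEquiv ℝ[X]).toLinearMap.restrictScalars ℝ ∘ₗ
      B.compr₂ (TensorProduct.mk ℝ ℝ[X] V (Polynomial.X ^ n)))

theorem polyBilin_tmul (n : ℕ) (B : V →ₗ[ℝ] V →ₗ[ℝ] V) (f g : ℝ[X]) (a b : V) :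
    polyBilin n B (f ⊗ₜ[ℝ] a) (g ⊗ₜ[ℝ] b) = (f * g * Polynomial.X ^ n) ⊗ₜ[ℝ] B a b := by
  simp [polyBilin, TensorProduct.smul_tmul', mul_assoc]

theorem tcoeff_zero_polyBilin (B : V →ₗ[ℝ] V →ₗ[ℝ] V) (x y : ℝ[X] ⊗[ℝ] V) :
    tcoeff 0 (polyBilin 0 B x y) = B (tcoeff 0 x) (tcoeff 0 y) := by
  induction x using TensorProduct.induction_on with
  | zero => simp
  | add x x' hx hx' => simp only [map_add, LinearMap.add_apply, hx, hx']
  | tmul f a =>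
    induction y using TensorProduct.induction_on with
    | zero => simp
    | add y y' hy hy' => simp only [map_add, hy, hy']
    | tmul g b =>
      simp only [polyBilin_tmul, tcoeff_tmul, pow_zero, mul_one, Polynomial.mul_coeff_zero,
        map_smul, LinearMap.smul_apply, smul_smul]
      rw [mul_comm]

variable {E : Type*} [NormedAddCommGroup E] [NormedSpace ℝ E]
  {M : Type*} [TopologicalSpace M] [ChartedSpace E M] [FiniteDimensional ℝ E]

theorem mem_dblComplex_of_neg {p q : ℤ} (hp : p < 0) {x : QForm E M}
    (hx : x ∈ dblComplex E M p q) : x = 0 := by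
  rw [dblComplex, if_neg (by omega)] at hx
  exact hx

theorem X_pow_tmul_mem_dblComplex (p : ℕ) {q : ℤ} {α : Form E M} (hα : α ∈ formDeg E M (q - p)) :
    (Polynomial.X ^ p : ℝ[X]) ⊗ₜ[ℝ] α ∈ dblComplex E M p q := by
  rw [dblComplex, if_pos (by omega), Int.toNat_natCast]
  exact ⟨α, hα, rfl⟩

theorem tcoeff_of_mem_dblComplex {p q : ℤ} {x : QForm E M} (hx : x ∈ dblComplex E M p q) (j : ℕ) :
    tcoeff j x ∈ formDeg E M (p + q - 2 * j) ∧ ((j : ℤ) < p → tcoeff j x = 0) := by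
  rcases lt_or_ge p 0 with hp | hp
  · rw [mem_dblComplex_of_neg hp hx, map_zero]
    exact ⟨zero_mem _, fun _ => rfl⟩
  · rw [dblComplex, if_pos hp] at hx
    obtain ⟨α, hα, rfl⟩ := hx
    rw [TensorProduct.mk_apply, tcoeff_X_pow_tmul]
    split_ifs with hj
    · refine ⟨?_, fun h => by omega⟩
      rw [show p + q - 2 * j = q - p by omega]
      exact hα
    · exact ⟨zero_mem _, fun _ => rfl⟩

/-- As `h` has degree two, the coefficient of `hʲ` in total degree `n` has form degree `n - 2j`, and
being in the `p`-th step means divisibility by `hᵖ`. Later arguments about the filtration go through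
this description. -/
theorem mem_filt_dblComplex {p n : ℤ} {x : QForm E M} :
    x ∈ filt (dblComplex E M) p n ↔
      ∀ j : ℕ, tcoeff j x ∈ formDeg E M (n - 2 * j) ∧ ((j : ℤ) < p → tcoeff j x = 0) := by
  constructor
  · intro hx j
    have h : filt (dblComplex E M) p n ≤ (formDeg E M (n - 2 * j)).comap (tcoeff j) ⊓
        (if (j : ℤ) < p then LinearMap.ker (tcoeff j) else ⊤) := by
      refine iSup₂_le fun p' hp' y hy => ⟨?_, ?_⟩
      · have := (tcoeff_of_mem_dblComplex hy j).1
        rwa [add_sub_cancel] at this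
      · split_ifs with hj
        · exact (tcoeff_of_mem_dblComplex hy j).2 (by omega)
        · trivial
    obtain ⟨h1, h2⟩ := h hx
    refine ⟨h1, fun hj => ?_⟩
    rwa [if_pos hj] at h2
  · intro h
    obtain ⟨N, hN⟩ := exists_eq_sum_tcoeff x
    rw [hN N le_rfl]
    refine Submodule.sum_mem _ fun j _ => ?_
    rcases lt_or_ge (j : ℤ) p with hj | hj
    · rw [(h j).2 hj, TensorProduct.tmul_zero]
      exact zero_mem _
    · refine Submodule.mem_iSup_of_mem (j : ℤ) (Submodule.mem_iSup_of_mem hj ?_)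
      refine X_pow_tmul_mem_dblComplex j ?_
      rw [sub_sub, ← two_mul]
      exact (h j).1

theorem mem_qDeg {n : ℤ} {x : QForm E M} :
    x ∈ qDeg E M n ↔ ∀ j : ℕ, tcoeff j x ∈ formDeg E M (n - 2 * j) := by
  constructor
  · intro hx j
    have h : qDeg E M n ≤ (formDeg E M (n - 2 * j)).comap (tcoeff j) := by
      refine iSup_le fun p y hy => ?_
      have := (tcoeff_of_mem_dblComplex hy j).1
      rwa [add_sub_cancel] at this
    exact h hx
  · intro h
    obtain ⟨N, hN⟩ := exists_eq_sum_tcoeff x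
    rw [hN N le_rfl]
    refine Submodule.sum_mem _ fun j _ => Submodule.mem_iSup_of_mem (j : ℤ) ?_
    refine X_pow_tmul_mem_dblComplex j ?_
    rw [sub_sub, ← two_mul]
    exact h j

theorem X_pow_tmul_mem_qDeg (p : ℕ) {i n : ℤ} (hn : i + 2 * p = n) {α : Form E M}
    (hα : α ∈ formDeg E M i) : (Polynomial.X ^ p : ℝ[X]) ⊗ₜ[ℝ] α ∈ qDeg E M n := by
  rw [mem_qDeg]
  intro j
  rw [tcoeff_X_pow_tmul]
  split_ifs with hj
  · rwa [show n - 2 * j = i by omega]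
  · exact zero_mem _

/-- The degree `n` part is detected by extracting, for every `j`, the component of degree `n - 2j`
of the coefficient of `hʲ`. -/
theorem isInternal_qDeg : DirectSum.IsInternal (qDeg E M) := by
  refine isInternal_of_separating _
    (fun n => LinearMap.pi fun j : ℕ => formComp (n - 2 * j) ∘ₗ tcoeff j)
    (fun m n hmn x hx => funext fun j => formComp_of_mem_ne (by omega) (mem_qDeg.1 hx j))
    (fun n x hx h => tcoeff_ext fun j => ?_) fun x => ?_
  · rw [map_zero, ← formComp_of_mem (mem_qDeg.1 hx j)]
    exact congrFun h j
  · obtain ⟨N, hN⟩ := exists_eq_sum_tcoeff x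
    rw [hN N le_rfl]
    refine Submodule.sum_mem _ fun j _ => ?_
    rw [← sum_formComp (tcoeff j x), TensorProduct.tmul_sum]
    exact Submodule.sum_mem _ fun k _ => Submodule.mem_iSup_of_mem _
      (X_pow_tmul_mem_qDeg j rfl (formComp_mem _ _))

theorem polyBilin_formWedge_mem {i j : ℤ} {x y : QForm E M} (hx : x ∈ qDeg E M i)
    (hy : y ∈ qDeg E M j) : polyBilin 0 formWedge x y ∈ qDeg E M (i + j) := by
  obtain ⟨N, hN⟩ := exists_eq_sum_tcoeff x
  obtain ⟨N', hN'⟩ := exists_eq_sum_tcoeff y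
  rw [hN N le_rfl, hN' N' le_rfl, map_sum]
  refine Submodule.sum_mem _ fun q _ => ?_
  rw [map_sum, LinearMap.sum_apply]
  refine Submodule.sum_mem _ fun p _ => ?_
  rw [polyBilin_tmul, pow_zero, mul_one, ← pow_add]
  refine X_pow_tmul_mem_qDeg (p + q) ?_ (formWedge_mem (mem_qDeg.1 hx p) (mem_qDeg.1 hy q))
  push_cast
  ring

variable [IsManifold 𝓘(ℝ, E) ∞ M]

variable (E M) in
/-- The de Rham algebra with coefficients in `ℝ[h]` is a differential graded algebra. -/
theorem isDGA_polyForm : IsDGA ℝ (qDeg E M) (extDer.baseChange ℝ[X]) (polyBilin 0 formWedge) qOne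
    qParity where
  internal := isInternal_qDeg
  one_mem := by
    have := X_pow_tmul_mem_qDeg 0 (n := 0) (by simp) (isDGA_form E M).one_mem
    rwa [pow_zero] at this
  mul_mem := polyBilin_formWedge_mem
  one_mul x := by
    induction x using TensorProduct.induction_on with
    | zero => simp
    | tmul f a => rw [qOne, polyBilin_tmul, (isDGA_form E M).one_mul]; simp
    | add x y hx hy => rw [map_add, hx, hy]
  mul_one x := by
    induction x using TensorProduct.induction_on with
    | zero => simp
    | tmul f a => rw [qOne, polyBilin_tmul, (isDGA_form E M).mul_one]; simp
    | add x y hx hy => rw [map_add, LinearMap.add_apply, hx, hy]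
  mul_assoc x y z := by
    induction x using TensorProduct.induction_on with
    | zero => simp
    | add x x' hx hx' => simp only [map_add, LinearMap.add_apply, hx, hx']
    | tmul f a =>
      induction y using TensorProduct.induction_on with
      | zero => simp
      | add y y' hy hy' => simp only [map_add, LinearMap.add_apply, hy, hy']
      | tmul g b =>
        induction z using TensorProduct.induction_on with
        | zero => simp
        | add z z' hz hz' => simp only [map_add, hz, hz']
        | tmul e c => simp only [polyBilin_tmul, (isDGA_form E M).mul_assoc, pow_zero, mul_one,
            mul_assoc]
  D_mem {n x} hx := by
    rw [mem_qDeg] at hx ⊢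
    intro j
    rw [tcoeff_baseChange, show n + 1 - 2 * j = n - 2 * j + 1 by ring]
    exact extDer_mem (hx j)
  D_D x := tcoeff_ext fun j => by
    rw [tcoeff_baseChange, tcoeff_baseChange, extDer_extDer, map_zero]
  s_apply {n x} hx := tcoeff_ext fun j => by
    rw [qParity, tcoeff_baseChange, parity_of_mem (mem_qDeg.1 hx j), map_smul,
      zpow_sub₀ (by norm_num), zpow_mul]
    simp
  leibniz x y := by
    induction x using TensorProduct.induction_on with
    | zero => simp
    | add x x' hx hx' =>
      simp only [map_add, LinearMap.add_apply, hx, hx']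
      abel
    | tmul f a =>
      induction y using TensorProduct.induction_on with
      | zero => simp
      | add y y' hy hy' =>
        simp only [map_add, hy, hy']
        abel
      | tmul g b =>
        simp only [qParity, polyBilin_tmul, LinearMap.baseChange_tmul, extDer_formWedge,
          TensorProduct.tmul_add]

end PolynomialForms

section Conjugation

/-! ### The quantum de Rham algebra is conjugate to the de Rham algebra over `ℝ[h]` -/

/-- The subspace is over `k` rather than over `R` because the graded and filtered pieces of
`Ω(M)[h]` of a fixed degree are not stable under `h`. -/
theorem exp_mem {R Q : Type*} [CommRing R] [AddCommGroup Q] [Module R Q] [Module ℚ Q]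
    {k : Type*} [Field k] [CharZero k] [Module k Q] {N : Module.End R Q} (S : Submodule k Q)
    (hS : ∀ x ∈ S, N x ∈ S) {x : Q} (hx : x ∈ S) : IsNilpotent.exp N x ∈ S := by
  have hpow : ∀ n : ℕ, (N ^ n) x ∈ S := by
    intro n
    induction n with
    | zero => exact hx
    | succ n ih =>
      rw [pow_succ', Module.End.mul_apply]
      exact hS _ ih
  rw [IsNilpotent.exp, LinearMap.sum_apply]
  refine Submodule.sum_mem _ fun n _ => ?_
  rw [LinearMap.smul_apply, ← Rat.cast_smul_eq_qsmul k]
  exact S.smul_mem _ (hpow n)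

theorem exp_apply_of_apply_eq_zero {R Q : Type*} [CommRing R] [AddCommGroup Q] [Module R Q]
    [Module ℚ Q] {N : Module.End R Q} (hN : IsNilpotent N) {x : Q} (hx : N x = 0) :
    IsNilpotent.exp N x = x := by
  have h := IsNilpotent.exp_smul_eq_sum (A := Module.End R Q) (M := Q) (a := N) (m := x) (k := 1)
    (by rw [pow_one]; exact hx) hN
  simpa using h

variable {E : Type*} [NormedAddCommGroup E] [NormedSpace ℝ E] [FiniteDimensional ℝ E]
  {M : Type*} [TopologicalSpace M] [ChartedSpace E M] [IsManifold 𝓘(ℝ, E) ∞ M]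
  (w : BivectorField E M)

/-- The operator `α ↦ h (w ⊢ α)`. -/
noncomputable def qContr : Module.End ℝ[X] (QForm E M) :=
  (Polynomial.X : ℝ[X]) • (formContr w).baseChange ℝ[X]

theorem qContr_apply (x : QForm E M) :
    qContr w x = (Polynomial.X : ℝ[X]) • (formContr w).baseChange ℝ[X] x := rfl

theorem isNilpotent_qContr : IsNilpotent (qContr w) := by
  refine ⟨Module.finrank ℝ E + 1, ?_⟩
  have h : ∀ n : ℕ, ∀ x, (qContr w ^ n) x =
      (Polynomial.X ^ n : ℝ[X]) • (formContr w ^ n).baseChange ℝ[X] x := by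
    intro n
    induction n with
    | zero => intro x; simp
    | succ n ih =>
      intro x
      rw [pow_succ', Module.End.mul_apply, ih, map_smul, qContr_apply, smul_smul, ← pow_succ,
        pow_succ' (formContr w), Module.End.mul_eq_comp, LinearMap.baseChange_comp]
      rfl
  refine LinearMap.ext fun x => ?_
  rw [h, formContr_pow_eq_zero, LinearMap.baseChange_zero]
  simp

theorem tcoeff_zero_qContr (x : QForm E M) : tcoeff 0 (qContr w x) = 0 :=
  tcoeff_zero_X_smul _

theorem tcoeff_succ_qContr (j : ℕ) (x : QForm E M) :
    tcoeff (j + 1) (qContr w x) = formContr w (tcoeff j x) := by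
  rw [qContr_apply, tcoeff_succ_X_smul, tcoeff_baseChange]

/-- The automorphism `exp(h (w ⊢ ·))` of `Ω(M)[h]`. -/
noncomputable def qExp : QForm E M →ₗ[ℝ[X]] QForm E M := IsNilpotent.exp (qContr w)

/-- The inverse `exp(-h (w ⊢ ·))`. -/
noncomputable def qExpNeg : QForm E M →ₗ[ℝ[X]] QForm E M := IsNilpotent.exp (-qContr w)

theorem qExp_qExpNeg (x : QForm E M) : qExp w (qExpNeg w x) = x :=
  LinearMap.congr_fun (IsNilpotent.exp_mul_exp_neg_self (A := Module.End ℝ[X] (QForm E M))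
    (a := qContr w) (isNilpotent_qContr w)) x

theorem qExpNeg_qExp (x : QForm E M) : qExpNeg w (qExp w x) = x :=
  LinearMap.congr_fun (IsNilpotent.exp_neg_mul_exp_self (A := Module.End ℝ[X] (QForm E M))
    (a := qContr w) (isNilpotent_qContr w)) x

/-- The degree two of `h` makes up for the two degrees lost in the contraction. -/
theorem qContr_mem_qDeg {n : ℤ} {x : QForm E M} (hx : x ∈ qDeg E M n) :
    qContr w x ∈ qDeg E M n := by
  rw [mem_qDeg] at hx ⊢
  rintro (_ | j)
  · rw [tcoeff_zero_qContr]
    exact zero_mem _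
  · rw [tcoeff_succ_qContr, show n - 2 * ((j + 1 : ℕ) : ℤ) = n - 2 * j - 2 by push_cast; ring]
    exact formContr_mem w (hx j)

theorem qContr_mem_filt {p n : ℤ} {x : QForm E M} (hx : x ∈ filt (dblComplex E M) p n) :
    qContr w x ∈ filt (dblComplex E M) p n := by
  rw [mem_filt_dblComplex] at hx ⊢
  rintro (_ | j)
  · rw [tcoeff_zero_qContr]
    exact ⟨zero_mem _, fun _ => rfl⟩
  · rw [tcoeff_succ_qContr, show n - 2 * ((j + 1 : ℕ) : ℤ) = n - 2 * j - 2 by push_cast; ring]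
    refine ⟨formContr_mem w (hx j).1, fun hj => ?_⟩
    rw [(hx j).2 (by push_cast at hj; omega), map_zero]

theorem qExp_mem_qDeg {n : ℤ} {x : QForm E M} (hx : x ∈ qDeg E M n) : qExp w x ∈ qDeg E M n :=
  exp_mem _ (fun _ => qContr_mem_qDeg w) hx

theorem qExpNeg_mem_qDeg {n : ℤ} {x : QForm E M} (hx : x ∈ qDeg E M n) :
    qExpNeg w x ∈ qDeg E M n :=
  exp_mem _ (fun _ hy => neg_mem (qContr_mem_qDeg w hy)) hx

theorem qExp_mem_filt {p n : ℤ} {x : QForm E M} (hx : x ∈ filt (dblComplex E M) p n) :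
    qExp w x ∈ filt (dblComplex E M) p n :=
  exp_mem _ (fun _ => qContr_mem_filt w) hx

theorem qExpNeg_mem_filt {p n : ℤ} {x : QForm E M} (hx : x ∈ filt (dblComplex E M) p n) :
    qExpNeg w x ∈ filt (dblComplex E M) p n :=
  exp_mem _ (fun _ hy => neg_mem (qContr_mem_filt w hy)) hx

/-- `exp(-h (w ⊢ ·))` is the identity modulo `h`. -/
theorem tcoeff_zero_qExpNeg (x : QForm E M) : tcoeff 0 (qExpNeg w x) = tcoeff 0 x := by
  obtain ⟨K, hK⟩ := IsNilpotent.neg (R := Module.End ℝ[X] (QForm E M)) (x := qContr w)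
    (isNilpotent_qContr w)
  rw [qExpNeg, IsNilpotent.exp_eq_sum (k := K + 1) (by rw [pow_succ, hK, zero_mul]),
    LinearMap.sum_apply, map_sum, Finset.sum_range_succ', Finset.sum_eq_zero, zero_add]
  · simp
  · intro n _
    rw [LinearMap.smul_apply, ← Rat.cast_smul_eq_qsmul ℝ, map_smul, pow_succ',
      Module.End.mul_apply, LinearMap.neg_apply, map_neg, tcoeff_zero_qContr, neg_zero, smul_zero]

theorem qExp_qOne : qExp w qOne = qOne := by
  refine exp_apply_of_apply_eq_zero (isNilpotent_qContr w) ?_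
  rw [qContr_apply, qOne, LinearMap.baseChange_tmul, formContr_oneForm, TensorProduct.tmul_zero,
    smul_zero]

theorem qExp_qParity (x : QForm E M) : qExp w (qParity x) = qParity (qExp w x) := by
  refine LinearMap.congr_fun (Module.End.commute_exp_left_of_commute (g := qParity)
    (isNilpotent_qContr w) (isNilpotent_qContr w) ?_) x
  refine LinearMap.ext fun x => ?_
  refine tcoeff_ext ?_
  rintro (_ | j)
  · simp only [LinearMap.comp_apply, qParity, tcoeff_baseChange, tcoeff_zero_qContr, map_zero]
  · simp only [LinearMap.comp_apply, qParity, tcoeff_baseChange, tcoeff_succ_qContr,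
      formContr_parity]

/-- The quantum differential is conjugate to the exterior derivative. -/
theorem qD_eq_conj (hw : Commute (formContr w) (codiff w)) (x : QForm E M) :
    qD w x = qExpNeg w (extDer.baseChange ℝ[X] (qExp w x)) := by
  set C : Module.End ℝ[X] (QForm E M) := (Polynomial.X : ℝ[X]) • (codiff w).baseChange ℝ[X]
    with hC
  -- This is the definition of Koszul's codifferential, multiplied by `h`.
  have hlie : qContr w * extDer.baseChange ℝ[X] - extDer.baseChange ℝ[X] * qContr w = C := by
    refine LinearMap.ext fun x => ?_
    change (Polynomial.X : ℝ[X]) • (formContr w).baseChange ℝ[X] (extDer.baseChange ℝ[X] x) -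
      extDer.baseChange ℝ[X] ((Polynomial.X : ℝ[X]) • (formContr w).baseChange ℝ[X] x) =
      (Polynomial.X : ℝ[X]) • (codiff w).baseChange ℝ[X] x
    rw [map_smul]
    refine tcoeff_ext ?_
    rintro (_ | j)
    · simp only [map_sub, tcoeff_zero_X_smul, sub_self]
    · simp only [map_sub, tcoeff_succ_X_smul, tcoeff_baseChange]
      rfl
  have hcomm : Commute (qContr w) C := by
    change qContr w * C = C * qContr w
    refine LinearMap.ext fun x => ?_
    change (Polynomial.X : ℝ[X]) • (formContr w).baseChange ℝ[X]
      ((Polynomial.X : ℝ[X]) • (codiff w).baseChange ℝ[X] x) = (Polynomial.X : ℝ[X]) •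
      (codiff w).baseChange ℝ[X] ((Polynomial.X : ℝ[X]) • (formContr w).baseChange ℝ[X] x)
    rw [map_smul, map_smul]
    congr 2
    refine tcoeff_ext fun j => ?_
    simp only [tcoeff_baseChange]
    exact LinearMap.congr_fun hw.eq _
  have h := LinearMap.congr_fun (exp_mul_sub_lie (A := Module.End ℝ[X] (QForm E M))
    (N := qContr w) (isNilpotent_qContr w) hlie hcomm) x
  change qExp w (qD w x) = extDer.baseChange ℝ[X] (qExp w x) at h
  rw [← h, qExpNeg_qExp]

theorem qWedge_eq_sum : qWedge w =
    ∑ n ∈ Finset.range (Module.finrank ℝ E + 1), polyBilin n (formWedgeCoeff w n) := by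
  refine LinearMap.ext fun x => LinearMap.ext fun y => ?_
  rw [LinearMap.sum_apply, LinearMap.sum_apply]
  induction x using TensorProduct.induction_on with
  | zero => simp
  | add x x' hx hx' =>
    simp only [map_add, LinearMap.add_apply, hx, hx', Finset.sum_add_distrib]
  | tmul f a =>
    induction y using TensorProduct.induction_on with
    | zero => simp
    | add y y' hy hy' => simp only [map_add, hy, hy', Finset.sum_add_distrib]
    | tmul g b =>
      simp [polyBilin_tmul, qWedge, qWedgeAux, LinearMap.sum_apply, Finset.smul_sum,
        TensorProduct.smul_tmul', mul_assoc]

/-- The operator `qContr` supplies one factor `h` wherever it acts, so all terms carry the same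
power `hⁿ⁺¹` and the recursion for forms applies. -/
theorem polyBilin_formWedgeCoeff_succ_tmul (n : ℕ) (f g : ℝ[X]) (a b : Form E M) :
    (n + 1) • polyBilin (n + 1) (formWedgeCoeff w (n + 1)) (f ⊗ₜ[ℝ] a) (g ⊗ₜ[ℝ] b) =
      polyBilin n (formWedgeCoeff w n) (qContr w (f ⊗ₜ[ℝ] a)) (g ⊗ₜ[ℝ] b) +
        polyBilin n (formWedgeCoeff w n) (f ⊗ₜ[ℝ] a) (qContr w (g ⊗ₜ[ℝ] b)) -
        qContr w (polyBilin n (formWedgeCoeff w n) (f ⊗ₜ[ℝ] a) (g ⊗ₜ[ℝ] b)) := by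
  have hN : ∀ (f : ℝ[X]) (a : Form E M),
      qContr w (f ⊗ₜ[ℝ] a) = (Polynomial.X * f) ⊗ₜ[ℝ] formContr w a := fun f a => by
    rw [qContr_apply, LinearMap.baseChange_tmul, TensorProduct.smul_tmul', smul_eq_mul]
  have h1 : Polynomial.X * f * g * Polynomial.X ^ n = f * g * Polynomial.X ^ (n + 1) := by ring
  have h2 : f * (Polynomial.X * g) * Polynomial.X ^ n = f * g * Polynomial.X ^ (n + 1) := by ring
  have h3 : Polynomial.X * (f * g * Polynomial.X ^ n) = f * g * Polynomial.X ^ (n + 1) := by ring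
  rw [hN, hN, polyBilin_tmul, polyBilin_tmul, polyBilin_tmul, polyBilin_tmul, hN, h1, h2, h3,
    ← TensorProduct.tmul_add, ← TensorProduct.tmul_sub, ← formWedgeCoeff_succ,
    Nat.cast_smul_eq_nsmul ℝ, TensorProduct.tmul_smul]

theorem polyBilin_formWedgeCoeff_succ (n : ℕ) (x y : QForm E M) :
    (n + 1) • polyBilin (n + 1) (formWedgeCoeff w (n + 1)) x y =
      polyBilin n (formWedgeCoeff w n) (qContr w x) y +
        polyBilin n (formWedgeCoeff w n) x (qContr w y) -
        qContr w (polyBilin n (formWedgeCoeff w n) x y) := by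
  induction x using TensorProduct.induction_on with
  | zero => simp
  | add x x' hx hx' =>
    simp only [map_add, LinearMap.add_apply, smul_add, hx, hx']
    abel
  | tmul f a =>
    induction y using TensorProduct.induction_on with
    | zero => simp
    | add y y' hy hy' =>
      simp only [map_add, smul_add, hy, hy']
      abel
    | tmul g b => exact polyBilin_formWedgeCoeff_succ_tmul w n f g a b

theorem polyBilin_zero (n : ℕ) {V : Type*} [AddCommGroup V] [Module ℝ V] :
    polyBilin n (0 : V →ₗ[ℝ] V →ₗ[ℝ] V) = 0 := by
  refine LinearMap.ext fun x => LinearMap.ext fun y => ?_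
  rw [LinearMap.zero_apply, LinearMap.zero_apply]
  induction x using TensorProduct.induction_on with
  | zero => rw [map_zero, LinearMap.zero_apply]
  | add x x' hx hx' => rw [map_add, LinearMap.add_apply, hx, hx', add_zero]
  | tmul f a =>
    induction y using TensorProduct.induction_on with
    | zero => rw [map_zero]
    | add y y' hy hy' => rw [map_add, hy, hy', add_zero]
    | tmul g b =>
      rw [polyBilin_tmul, LinearMap.zero_apply, LinearMap.zero_apply, TensorProduct.tmul_zero]

/-- The quantum exterior product is conjugate to the exterior product. -/
theorem qWedge_eq_conj (x y : QForm E M) :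
    qWedge w x y = qExpNeg w (polyBilin 0 formWedge (qExp w x) (qExp w y)) := by
  rw [qWedge_eq_sum, LinearMap.sum_apply, LinearMap.sum_apply, ← formWedgeCoeff_zero w]
  refine sum_bilin_eq_exp (isNilpotent_qContr w) (fun n => polyBilin n (formWedgeCoeff w n))
    (fun n x y => ?_) (K := Module.finrank ℝ E + 1) ?_ x y
  · rw [Nat.cast_smul_eq_nsmul]
    exact polyBilin_formWedgeCoeff_succ w n x y
  · rw [formWedgeCoeff_eq_zero w (Nat.lt_succ_self _), polyBilin_zero]

/-- Associativity and the Leibniz rule for the quantum operations come from conjugation by `qExp`,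
with no expansion in powers of `h`. -/
theorem isDGA_qForm (hw : Commute (formContr w) (codiff w)) :
    IsDGA ℝ (qDeg E M) (qD w) (qWedge w) qOne qParity :=
  (isDGA_polyForm E M).transport (qExp_qExpNeg w) (qExpNeg_qExp w) (qExp_mem_qDeg w)
    (qExpNeg_mem_qDeg w) (qExp_qOne w) (qExp_qParity w) (qD_eq_conj w hw) (qWedge_eq_conj w)

end Conjugation

section GradedCohomology

/-! ### The cohomology of a differential graded algebra is a graded algebra -/

namespace IsDGA

variable {k R K : Type*} [Field k] [CommRing R] [Algebra k R] [AddCommGroup K] [Module k K]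
  [Module R K] [IsScalarTower k R K] {gr : ℤ → Submodule k K} {D : K →ₗ[R] K}
  {mul : K →ₗ[R] K →ₗ[R] K} {one : K} {s : K →ₗ[R] K}

theorem mem_iSup (h : IsDGA k gr D mul one s) (x : K) : x ∈ ⨆ n, gr n := by
  rw [h.internal.submodule_iSup_eq_top]
  trivial

variable (h : IsDGA k gr D mul one s)

/-- The component of degree `n`. -/
noncomputable def proj (n : ℤ) : K →ₗ[k] K :=
  (gr n).subtype ∘ₗ DirectSum.component k ℤ (fun n => gr n) n ∘ₗ
    (LinearEquiv.ofBijective (DirectSum.coeLinearMap gr) h.internal).symm.toLinearMap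

theorem proj_of_mem {n : ℤ} {x : K} (hx : x ∈ gr n) : h.proj n x = x := by
  have h1 : (LinearEquiv.ofBijective (DirectSum.coeLinearMap gr) h.internal).symm x =
      DirectSum.lof k ℤ (fun n => gr n) n ⟨x, hx⟩ := by
    rw [LinearEquiv.symm_apply_eq]
    exact (DirectSum.coeLinearMap_lof gr _ ⟨x, hx⟩).symm
  simp only [proj, LinearMap.comp_apply, LinearEquiv.coe_coe, h1]
  rw [DirectSum.component.lof_self]
  rfl

theorem proj_of_mem_ne {m n : ℤ} (hmn : m ≠ n) {x : K} (hx : x ∈ gr m) : h.proj n x = 0 := by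
  have h1 : (LinearEquiv.ofBijective (DirectSum.coeLinearMap gr) h.internal).symm x =
      DirectSum.lof k ℤ (fun n => gr n) m ⟨x, hx⟩ := by
    rw [LinearEquiv.symm_apply_eq]
    exact (DirectSum.coeLinearMap_lof gr _ ⟨x, hx⟩).symm
  simp only [proj, LinearMap.comp_apply, LinearEquiv.coe_coe, h1]
  rw [DirectSum.component.of, dif_neg hmn]
  exact map_zero _

theorem proj_mem (n : ℤ) (x : K) : h.proj n x ∈ gr n := Subtype.property _

theorem D_proj (n : ℤ) (x : K) : D (h.proj n x) = h.proj (n + 1) (D x) := by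
  have hx := h.mem_iSup x
  induction hx using Submodule.iSup_induction' with
  | mem m x hx =>
    by_cases hmn : m = n
    · subst hmn
      rw [h.proj_of_mem hx, h.proj_of_mem (h.D_mem hx)]
    · rw [h.proj_of_mem_ne hmn hx, h.proj_of_mem_ne (by omega) (h.D_mem hx), map_zero]
  | zero => simp
  | add x y _ _ hx hy => simp only [map_add, hx, hy]

theorem exists_sum_proj (x : K) : ∃ t : Finset ℤ, x = ∑ n ∈ t, h.proj n x := by
  classical
  -- Allowing all larger finite sets makes the claim stable under addition.
  have key : ∀ x : K, ∃ t : Finset ℤ, ∀ t', t ⊆ t' → x = ∑ n ∈ t', h.proj n x := by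
    intro x
    have hx := h.mem_iSup x
    induction hx using Submodule.iSup_induction' with
    | mem m x hx =>
      refine ⟨{m}, fun t' ht' => ?_⟩
      rw [Finset.sum_eq_single m, h.proj_of_mem hx]
      · exact fun n _ hn => h.proj_of_mem_ne (Ne.symm hn) hx
      · exact fun hm => absurd (ht' (Finset.mem_singleton_self m)) hm
    | zero => exact ⟨∅, fun t' _ => by simp⟩
    | add x y _ _ hx hy =>
      obtain ⟨t, ht⟩ := hx
      obtain ⟨t₁, ht₁⟩ := hy
      refine ⟨t ∪ t₁, fun t' ht' => ?_⟩
      simp only [map_add, Finset.sum_add_distrib]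
      rw [← ht t' (Finset.union_subset_left ht'), ← ht₁ t' (Finset.union_subset_right ht')]
  obtain ⟨t, ht⟩ := key x
  exact ⟨t, ht t subset_rfl⟩

theorem cls_mem_deg {n : ℤ} {x : LinearMap.ker D} (hx : (x : K) ∈ gr n) : h.cls x ∈ h.deg n :=
  ⟨x, hx, rfl⟩

/-- The differential commutes with the projections up to the shift of degree. Degree `n` is
separated by the classes having a representative whose degree `n` component is exact. -/
theorem isInternal_deg : DirectSum.IsInternal h.deg := by
  refine isInternal_of_submodule _ (fun n => (((LinearMap.range D).restrictScalars k).comap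
    (h.proj n ∘ₗ (LinearMap.ker D).subtype.restrictScalars k)).map (h.cls.restrictScalars k))
    ?_ ?_ ?_
  · rintro m n hmn _ ⟨x, hx, rfl⟩
    refine ⟨x, ?_, rfl⟩
    change h.proj n x ∈ LinearMap.range D
    have hx' : (x : K) ∈ gr m := hx
    rw [h.proj_of_mem_ne hmn hx']
    exact zero_mem _
  · rintro n _ ⟨x, hx, rfl⟩ ⟨x', ⟨y, hy⟩, hxx'⟩
    replace hx : (x : K) ∈ gr n := hx
    change D y = h.proj n x' at hy
    have h0 : h.cls (x - x') = 0 := by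
      rw [map_sub]
      exact sub_eq_zero.2 hxx'.symm
    obtain ⟨z, hz⟩ := h.cls_eq_zero.1 h0
    -- The primitive combines `y`, for the degree `n` component of `x'`, with the part of `z` that
    -- bounds the degree `n` component of `x - x'`.
    refine h.cls_eq_zero.2 ⟨y + h.proj (n - 1) z, ?_⟩
    rw [map_add, h.D_proj, sub_add_cancel, hz, hy, ← map_add]
    refine Eq.trans ?_ (h.proj_of_mem hx)
    congr 1
    exact add_sub_cancel _ _
  · intro c
    obtain ⟨x, rfl⟩ := h.cls_surjective c
    obtain ⟨t, ht⟩ := h.exists_sum_proj (x : K)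
    have hD : ∀ n, D (h.proj n x) = 0 := fun n => by
      rw [h.D_proj, LinearMap.mem_ker.1 x.2, map_zero]
    have hx : x = ∑ n ∈ t, (⟨h.proj n x, hD n⟩ : LinearMap.ker D) :=
      Subtype.ext (by rw [AddSubmonoidClass.coe_finsetSum]; exact ht)
    rw [hx, map_sum]
    exact Submodule.sum_mem _ fun n _ => Submodule.mem_iSup_of_mem n
      (h.cls_mem_deg (h.proj_mem n x))

theorem gradedMonoid_deg : SetLike.GradedMonoid h.deg where
  one_mem := ⟨⟨one, h.D_one⟩, h.one_mem, rfl⟩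
  mul_mem := by
    rintro i j _ _ ⟨x, hx, rfl⟩ ⟨y, hy, rfl⟩
    exact ⟨h.mulCocycle x y, h.mul_mem hx hy, rfl⟩

end IsDGA

end GradedCohomology

/-! ### The first page and the degeneration of the spectral sequence -/

section SpectralSequence

/-- The indices are free variables tied by equations, so that the shifts of `p` and `q` need not
match syntactically. -/
theorem mem_cycles_iff {k K : Type*} [Field k] [AddCommGroup K] [Module k K]
    {C : ℤ → ℤ → Submodule k K} {D : K →ₗ[k] K} {r p q p' n n' : ℤ} (hp : p + r = p')
    (hn : p + q = n) (hn' : n + 1 = n') {x : K} :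
    x ∈ cycles C D r p q ↔ x ∈ filt C p n ∧ D x ∈ filt C p' n' := by
  subst hp hn hn'
  rfl

variable {E : Type*} [NormedAddCommGroup E] [NormedSpace ℝ E] [FiniteDimensional ℝ E]
  {M : Type*} [TopologicalSpace M] [ChartedSpace E M] [IsManifold 𝓘(ℝ, E) ∞ M]
  {w : BivectorField E M}

theorem filt_mono {p p' n : ℤ} (h : p' ≤ p) :
    filt (dblComplex E M) p n ≤ filt (dblComplex E M) p' n := fun x hx => by
  rw [mem_filt_dblComplex] at hx ⊢
  exact fun j => ⟨(hx j).1, fun hj => (hx j).2 (by omega)⟩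

theorem filt_of_le_zero {p p' n : ℤ} (h : p ≤ 0) {x : QForm E M}
    (hx : x ∈ filt (dblComplex E M) p' n) : x ∈ filt (dblComplex E M) p n := by
  rw [mem_filt_dblComplex] at hx ⊢
  exact fun j => ⟨(hx j).1, fun hj => by omega⟩

theorem mem_filt_succ {p : ℕ} {n : ℤ} {x : QForm E M} (hx : x ∈ filt (dblComplex E M) p n)
    (h0 : tcoeff p x = 0) : x ∈ filt (dblComplex E M) (p + 1) n := by
  rw [mem_filt_dblComplex] at hx ⊢
  refine fun j => ⟨(hx j).1, fun hj => ?_⟩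
  rcases (show j < p ∨ j = p by omega) with hj | rfl
  · exact (hx j).2 (by exact_mod_cast hj)
  · exact h0

theorem X_pow_tmul_mem_filt (p : ℕ) {i n : ℤ} (hn : i + 2 * p = n) {α : Form E M}
    (hα : α ∈ formDeg E M i) :
    (Polynomial.X ^ p : ℝ[X]) ⊗ₜ[ℝ] α ∈ filt (dblComplex E M) p n := by
  refine mem_filt_dblComplex.2 fun j => ?_
  rw [tcoeff_X_pow_tmul]
  split_ifs with hj
  · subst hj
    refine ⟨?_, fun h => absurd h (lt_irrefl _)⟩
    rwa [show n - 2 * j = i by omega]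
  · exact ⟨zero_mem _, fun _ => rfl⟩

theorem baseChange_extDer_mem_filt {p n : ℤ} {x : QForm E M}
    (hx : x ∈ filt (dblComplex E M) p n) :
    extDer.baseChange ℝ[X] x ∈ filt (dblComplex E M) p (n + 1) := by
  rw [mem_filt_dblComplex] at hx ⊢
  intro j
  rw [tcoeff_baseChange]
  refine ⟨?_, fun hj => by rw [(hx j).2 hj, map_zero]⟩
  rw [show n + 1 - 2 * j = n - 2 * j + 1 by ring]
  exact extDer_mem (hx j).1

theorem qD_mem_filt (hw : Commute (formContr w) (codiff w)) {p n : ℤ} {x : QForm E M}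
    (hx : x ∈ filt (dblComplex E M) p n) : qD w x ∈ filt (dblComplex E M) p (n + 1) := by
  rw [qD_eq_conj w hw]
  exact qExpNeg_mem_filt w (baseChange_extDer_mem_filt (qExp_mem_filt w hx))

theorem tcoeff_zero_qD (x : QForm E M) : tcoeff 0 (qD w x) = extDer (tcoeff 0 x) := by
  rw [qD, LinearMap.sub_apply, map_sub, tcoeff_baseChange, LinearMap.smul_apply,
    tcoeff_zero_X_smul, sub_zero]

/-- The leading coefficient of `d_h x` is the exterior derivative of that of `x`. -/
theorem tcoeff_qD {p : ℕ} {n : ℤ} {x : QForm E M} (hx : x ∈ filt (dblComplex E M) p n) :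
    tcoeff p (qD w x) = extDer (tcoeff p x) := by
  rcases p with _ | p
  · exact tcoeff_zero_qD x
  · rw [qD, LinearMap.sub_apply, map_sub, tcoeff_baseChange, LinearMap.smul_apply,
      tcoeff_succ_X_smul, tcoeff_baseChange, (mem_filt_dblComplex.1 hx p).2 (by push_cast; omega),
      map_zero, sub_zero]

/-- A cocycle of degree `q - p` gives an element of `Z₁^{p,q}`. -/
theorem X_pow_tmul_mem_cycles (hw : Commute (formContr w) (codiff w)) (p : ℕ) {q : ℤ}
    {α : Form E M} (hα : α ∈ formDeg E M (q - p)) (hd : extDer α = 0) :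
    (Polynomial.X ^ p : ℝ[X]) ⊗ₜ[ℝ] α ∈
      cycles (dblComplex E M) ((qD w).restrictScalars ℝ) 1 p q := by
  have h1 : (Polynomial.X ^ p : ℝ[X]) ⊗ₜ[ℝ] α ∈ filt (dblComplex E M) p (p + q) :=
    X_pow_tmul_mem_filt p (by ring) hα
  refine (mem_cycles_iff rfl rfl rfl).2 ⟨h1, mem_filt_succ (qD_mem_filt hw h1) ?_⟩
  change tcoeff p (qD w _) = 0
  rw [tcoeff_qD h1, tcoeff_X_pow_tmul, if_pos rfl, hd]

/-- The map `Z₁^{p,q} → H^{q-p}(M)` that takes the class of the leading coefficient. -/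
noncomputable def leadingClass (w : BivectorField E M) (p : ℕ) (q : ℤ) :
    cycles (dblComplex E M) ((qD w).restrictScalars ℝ) 1 p q →ₗ[ℝ]
      (isDGA_form E M).deg (q - p) :=
  LinearMap.codRestrict _ ((isDGA_form E M).cls ∘ₗ
    LinearMap.codRestrict (LinearMap.ker extDer) (tcoeff p ∘ₗ Submodule.subtype _)
      fun x => by
        have hx := (mem_cycles_iff (k := ℝ) rfl rfl rfl).1 x.2
        have h2 := (mem_filt_dblComplex.1 hx.2 p).2 (by omega)
        exact (tcoeff_qD hx.1).symm.trans h2)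
    fun x => (isDGA_form E M).cls_mem_deg (by
      have hx := (mem_filt_dblComplex.1 x.2.1 p).1
      rw [show (p : ℤ) + q - 2 * p = q - p by ring] at hx
      exact hx)

theorem leadingClass_eq {p : ℕ} {q : ℤ}
    (x : cycles (dblComplex E M) ((qD w).restrictScalars ℝ) 1 p q) {α : Form E M}
    (hα : α ∈ LinearMap.ker extDer) (h : tcoeff p (x : QForm E M) = α) :
    (leadingClass w p q x : (isDGA_form E M).Cohomology) = (isDGA_form E M).cls ⟨α, hα⟩ :=
  congrArg (isDGA_form E M).cls (Subtype.ext h)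

theorem leadingClass_surjective (hw : Commute (formContr w) (codiff w)) (p : ℕ) (q : ℤ) :
    Function.Surjective (leadingClass w p q) := by
  rintro ⟨_, ⟨⟨α, hd⟩, hα, rfl⟩⟩
  refine ⟨⟨_, X_pow_tmul_mem_cycles hw p hα hd⟩, Subtype.ext (leadingClass_eq _ hd ?_)⟩
  change tcoeff p ((Polynomial.X ^ p : ℝ[X]) ⊗ₜ[ℝ] α) = α
  rw [tcoeff_X_pow_tmul, if_pos rfl]

/-- Boundaries have exact leading coefficient by `tcoeff_qD`. Conversely, if the leading coefficient
is `dβ`, subtracting `d_h (hᵖ β)` removes it and leaves an element one step deeper in the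
filtration. -/
theorem ker_leadingClass (hw : Commute (formContr w) (codiff w)) (p : ℕ) (q : ℤ) :
    (boundaries (dblComplex E M) ((qD w).restrictScalars ℝ) 1 p q).submoduleOf
      (cycles (dblComplex E M) ((qD w).restrictScalars ℝ) 1 p q) =
      LinearMap.ker (leadingClass w p q) := by
  ext ⟨x, hx⟩
  rw [LinearMap.mem_ker, ← Subtype.coe_inj]
  have hx' := (mem_cycles_iff (k := ℝ) rfl rfl rfl).1 hx
  have hd : tcoeff p x ∈ LinearMap.ker extDer := by
    have h2 := (mem_filt_dblComplex.1 hx'.2 p).2 (by omega)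
    exact (tcoeff_qD hx'.1).symm.trans h2
  rw [leadingClass_eq _ hd rfl]
  change x ∈ boundaries (dblComplex E M) ((qD w).restrictScalars ℝ) 1 p q ↔ _
  refine Iff.trans ?_ (isDGA_form E M).cls_eq_zero.symm
  constructor
  · intro hb
    obtain ⟨a, ha, b, ⟨y, hy, rfl⟩, rfl⟩ := Submodule.mem_sup.1 hb
    have ha' := ((mem_cycles_iff (k := ℝ) rfl rfl rfl).1 ha).1
    have hy' := ((mem_cycles_iff (k := ℝ) rfl rfl rfl).1 hy).1
    rw [sub_add_cancel] at hy'
    have key : extDer (tcoeff p y) = tcoeff p (a + qD w y) := by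
      rw [map_add, (mem_filt_dblComplex.1 ha' p).2 (by omega), zero_add]
      exact (tcoeff_qD hy').symm
    exact ⟨_, key⟩
  · rintro ⟨β, hβ⟩
    have hα : tcoeff p x ∈ formDeg E M (q - p) := by
      have := (mem_filt_dblComplex.1 hx'.1 p).1
      rwa [show (p : ℤ) + q - 2 * p = q - p by ring] at this
    -- A primitive need not be homogeneous; its component of degree `q - p - 1` is still a primitive
    -- and has the correct bidegree.
    set β' := (isDGA_form E M).proj (q - p - 1) β with hβ'
    have hd' : extDer β' = tcoeff p x := by
      rw [hβ', (isDGA_form E M).D_proj, hβ, sub_add_cancel]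
      exact (isDGA_form E M).proj_of_mem hα
    have hy : (Polynomial.X ^ p : ℝ[X]) ⊗ₜ[ℝ] β' ∈ filt (dblComplex E M) p (p + q - 1) :=
      X_pow_tmul_mem_filt p (by ring) ((isDGA_form E M).proj_mem _ _)
    have hDy := qD_mem_filt hw hy
    rw [sub_add_cancel] at hDy
    refine Submodule.mem_sup.2 ⟨x - qD w ((Polynomial.X ^ p : ℝ[X]) ⊗ₜ[ℝ] β'), ?_, _,
      ⟨(Polynomial.X ^ p : ℝ[X]) ⊗ₜ[ℝ] β', ?_, rfl⟩, sub_add_cancel _ _⟩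
    · refine (mem_cycles_iff (p' := p + 1) (n := p + q) (n' := p + q + 1) (by ring) (by ring)
        rfl).2 ⟨mem_filt_succ (sub_mem hx'.1 hDy) ?_, ?_⟩
      · rw [map_sub, tcoeff_qD hy, tcoeff_X_pow_tmul, if_pos rfl, hd', sub_self]
      · have h2 : (qD w).restrictScalars ℝ (x - qD w ((Polynomial.X ^ p : ℝ[X]) ⊗ₜ[ℝ] β')) =
            (qD w).restrictScalars ℝ x := by
          change qD w (x - qD w _) = qD w x
          rw [map_sub, (isDGA_qForm w hw).D_D, sub_zero]
        rw [h2]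
        exact hx'.2
    · refine (mem_cycles_iff (p' := p) (n := p + q - 1) (n' := p + q) (by ring) (by ring)
        (by ring)).2 ⟨?_, hDy⟩
      rwa [sub_add_cancel]

/-- After conjugation the differential is `d`, which does not mix powers of `h`. An element whose
differential lies in step `p + r` can therefore be replaced, without changing the differential, by
its part in that step; this exhibits `d_h x` as a boundary. -/
theorem pageD_eq_zero (hw : Commute (formContr w) (codiff w)) {r : ℤ} (hr : 1 ≤ r) (p q : ℤ)
    (hD : ∀ x, (qD w).restrictScalars ℝ ((qD w).restrictScalars ℝ x) = 0) :
    pageD (dblComplex E M) (D := (qD w).restrictScalars ℝ) hD r p q = 0 := by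
  refine Submodule.linearMap_qext _ (LinearMap.ext ?_)
  rintro ⟨x, hx⟩
  have hx' := (mem_cycles_iff (k := ℝ) rfl rfl rfl).1 hx
  refine (Submodule.Quotient.mk_eq_zero _).2 ?_
  change qD w x ∈ boundaries (dblComplex E M) ((qD w).restrictScalars ℝ) r (p + r) (q - r + 1)
  have hy := qExp_mem_filt w hx'.1
  have hdy : extDer.baseChange ℝ[X] (qExp w x) ∈ filt (dblComplex E M) (p + r) (p + q + 1) := by
    have h := qExp_mem_filt w hx'.2
    change qExp w (qD w x) ∈ _ at h
    rwa [qD_eq_conj w hw, qExp_qExpNeg] at h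
  obtain ⟨N, hN⟩ := exists_eq_sum_tcoeff (qExp w x)
  have hN := hN N le_rfl
  set y := qExp w x
  set z : QForm E M := ∑ j ∈ (Finset.range N).filter (fun j : ℕ => p + r ≤ j),
    (Polynomial.X ^ j : ℝ[X]) ⊗ₜ[ℝ] tcoeff j y with hz
  -- The discarded coefficients are closed, because those of `dy` vanish below `p + r`.
  have hdz : extDer.baseChange ℝ[X] z = extDer.baseChange ℝ[X] y := by
    conv_rhs => rw [hN]
    rw [hz, map_sum, map_sum, Finset.sum_filter]
    refine Finset.sum_congr rfl fun j _ => ?_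
    split_ifs with hj
    · rfl
    · have := (mem_filt_dblComplex.1 hdy j).2 (by omega)
      rw [tcoeff_baseChange] at this
      rw [LinearMap.baseChange_tmul, this, TensorProduct.tmul_zero]
  have hzf : z ∈ filt (dblComplex E M) (p + r) (p + q) := by
    refine Submodule.sum_mem _ fun j hj => ?_
    refine filt_mono (Finset.mem_filter.1 hj).2 ?_
    exact X_pow_tmul_mem_filt j (sub_add_cancel _ _) (mem_filt_dblComplex.1 hy j).1
  have hDz : qD w (qExpNeg w z) = qD w x := by
    rw [qD_eq_conj w hw, qD_eq_conj w hw, qExp_qExpNeg, hdz]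
  -- Boundaries at the target of `d_r` contain the differentials of `Z_{r-1}^{p+1,q-1}`. The new
  -- element lies there, since `r ≥ 1` puts step `p + r` inside step `p + 1`.
  refine Submodule.mem_sup_right ⟨qExpNeg w z, ?_, hDz⟩
  refine (mem_cycles_iff (p' := p + r) (n := p + q) (n' := p + q + 1) (by ring) (by ring)
    rfl).2 ⟨filt_mono (by omega) (qExpNeg_mem_filt w hzf), ?_⟩
  change qD w (qExpNeg w z) ∈ _
  rw [hDz]
  exact hx'.2

/-- The columns of negative index are zero, so steps `p` and `p + 1` of the filtration coincide and
every cycle already lies in `Z₀^{p+1,q-1}`. -/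
theorem subsingleton_page_of_neg {p q : ℤ} (hp : p < 0) :
    Subsingleton (page (dblComplex E M) ((qD w).restrictScalars ℝ) 1 p q) := by
  refine Submodule.Quotient.subsingleton_iff.2 (eq_top_iff.2 ?_)
  rintro ⟨x, hx⟩ -
  have hx' := (mem_cycles_iff (k := ℝ) rfl rfl rfl).1 hx
  refine Submodule.mem_sup_left ((mem_cycles_iff (p' := p + 1) (n := p + q) (n' := p + q + 1)
    (by ring) (by ring) rfl).2 ⟨filt_of_le_zero (by omega) hx'.1, hx'.2⟩)

end SpectralSequence

/-- A semilinear map on cocycles that vanishes on coboundaries descends to cohomology. -/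
noncomputable def IsDGA.lift {k R K : Type*} [Field k] [CommRing R] [Algebra k R] [AddCommGroup K]
    [Module k K] [Module R K] [IsScalarTower k R K] {gr : ℤ → Submodule k K} {D : K →ₗ[R] K}
    {mul : K →ₗ[R] K →ₗ[R] K} {one : K} {s : K →ₗ[R] K} (h : IsDGA k gr D mul one s)
    {R' P : Type*} [CommRing R'] [AddCommGroup P] [Module R' P] {σ : R →+* R'}
    (f : LinearMap.ker D →ₛₗ[σ] P)
    (hf : (LinearMap.range D).submoduleOf (LinearMap.ker D) ≤ LinearMap.ker f) :
    h.Cohomology →ₛₗ[σ] P :=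
  Submodule.liftQ _ f hf

/-! ### Quantum cohomology as a deformation of de Rham cohomology -/

section Deformation

variable {E : Type*} [NormedAddCommGroup E] [NormedSpace ℝ E] [FiniteDimensional ℝ E]
  {M : Type*} [TopologicalSpace M] [ChartedSpace E M] [IsManifold 𝓘(ℝ, E) ∞ M]
  {w : BivectorField E M}

/-- The isomorphism is inverse to taking the class of the leading coefficient, and the leading
coefficient of `hᵖ α` is `α`. -/
theorem exists_equiv_page (hw : Commute (formContr w) (codiff w)) {p : ℤ} (hp : 0 ≤ p) (q : ℤ) :
    ∃ e : (isDGA_form E M).deg (q - p) ≃ₗ[ℝ]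
        page (dblComplex E M) ((qD w).restrictScalars ℝ) 1 p q,
      ∀ (α : Form E M) (hα : α ∈ LinearMap.ker extDer), α ∈ formDeg E M (q - p) →
        ∃ hz : (Polynomial.X ^ p.toNat : Polynomial ℝ) ⊗ₜ[ℝ] α ∈
            cycles (dblComplex E M) ((qD w).restrictScalars ℝ) 1 p q,
          ∀ c : (isDGA_form E M).deg (q - p),
            (c : (isDGA_form E M).Cohomology) = (isDGA_form E M).cls ⟨α, hα⟩ →
              e c = Submodule.Quotient.mk ⟨_, hz⟩ := by
  lift p to ℕ using hp
  refine ⟨((Submodule.quotEquivOfEq _ _ (ker_leadingClass hw p q)).trans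
    ((leadingClass w p q).quotKerEquivOfSurjective (leadingClass_surjective hw p q))).symm, ?_⟩
  intro α hα hdeg
  refine ⟨X_pow_tmul_mem_cycles hw p hdeg hα, fun c hc => ?_⟩
  rw [LinearEquiv.symm_apply_eq]
  refine Subtype.ext (hc.trans (leadingClass_eq ⟨_, X_pow_tmul_mem_cycles hw p hdeg hα⟩ hα ?_).symm)
  change tcoeff p ((Polynomial.X ^ p : ℝ[X]) ⊗ₜ[ℝ] α) = α
  rw [tcoeff_X_pow_tmul, if_pos rfl]

theorem qD_qExpNeg (hw : Commute (formContr w) (codiff w)) (x : QForm E M) :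
    qD w (qExpNeg w x) = qExpNeg w (extDer.baseChange ℝ[X] x) := by
  rw [qD_eq_conj w hw, qExp_qExpNeg]

variable (hw : Commute (formContr w) (codiff w))

/-- The cocycle `exp(-h w ⊢) α` for a closed form `α`. -/
noncomputable def quantumCocycle : LinearMap.ker (extDer (E := E) (M := M)) →ₗ[ℝ]
    LinearMap.ker (qD w) where
  toFun α := ⟨qExpNeg w (1 ⊗ₜ α), by
    rw [LinearMap.mem_ker, qD_qExpNeg hw, LinearMap.baseChange_tmul, LinearMap.mem_ker.1 α.2,
      TensorProduct.tmul_zero, map_zero]⟩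
  map_add' α β := Subtype.ext (by simp [TensorProduct.tmul_add])
  map_smul' c α := Subtype.ext (by
    change qExpNeg w (1 ⊗ₜ (c • (α : Form E M))) = c • qExpNeg w (1 ⊗ₜ (α : Form E M))
    rw [TensorProduct.tmul_smul, LinearMap.map_smul_of_tower])

/-- The map `[α] ↦ [exp(-h w ⊢) α]`. -/
noncomputable def quantumClass :
    (isDGA_form E M).Cohomology →ₗ[ℝ] (isDGA_qForm w hw).Cohomology :=
  (isDGA_form E M).lift ((isDGA_qForm w hw).cls.restrictScalars ℝ ∘ₗ quantumCocycle hw) (by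
      rintro x ⟨y, hy⟩
      refine (isDGA_qForm w hw).cls_eq_zero.2 ⟨qExpNeg w (1 ⊗ₜ y), ?_⟩
      rw [qD_qExpNeg hw, LinearMap.baseChange_tmul, hy]
      rfl)

theorem quantumClass_cls (α : LinearMap.ker (extDer (E := E) (M := M))) :
    quantumClass hw ((isDGA_form E M).cls α) = (isDGA_qForm w hw).cls (quantumCocycle hw α) := rfl

/-- The `ℝ[h]`-linear extension of `[α] ↦ [exp(-h w ⊢) α]`. -/
noncomputable def quantumMap :
    ℝ[X] ⊗[ℝ] (isDGA_form E M).Cohomology →ₗ[ℝ[X]] (isDGA_qForm w hw).Cohomology :=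
  (quantumClass hw).liftBaseChange ℝ[X]

theorem quantumMap_tmul (f : ℝ[X]) (a : (isDGA_form E M).Cohomology) :
    quantumMap hw (f ⊗ₜ a) = f • quantumClass hw a :=
  LinearMap.liftBaseChange_tmul ..

theorem sum_X_pow_tmul_mem_ker (hw : Commute (formContr w) (codiff w)) (N : ℕ) (α : ℕ → LinearMap.ker (extDer (E := E) (M := M))) :
    qExpNeg w (∑ p ∈ Finset.range N, (Polynomial.X ^ p : ℝ[X]) ⊗ₜ[ℝ] (α p : Form E M)) ∈
      LinearMap.ker (qD w) := by
  rw [LinearMap.mem_ker, qD_qExpNeg hw, map_sum, Finset.sum_eq_zero, map_zero]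
  intro p _
  rw [LinearMap.baseChange_tmul, LinearMap.mem_ker.1 (α p).2, TensorProduct.tmul_zero]

/-- The image is represented by the single cocycle `exp(-hΛ) ∑ hᵖ αₚ`, which lets bijectivity be
tested on the coefficients `αₚ`. -/
theorem quantumMap_sum (N : ℕ) (α : ℕ → LinearMap.ker (extDer (E := E) (M := M))) :
    quantumMap hw (∑ p ∈ Finset.range N, (Polynomial.X ^ p : ℝ[X]) ⊗ₜ (isDGA_form E M).cls (α p)) =
      (isDGA_qForm w hw).cls ⟨_, sum_X_pow_tmul_mem_ker hw N α⟩ := by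
  rw [map_sum]
  simp only [quantumMap_tmul, quantumClass_cls, ← map_smul]
  rw [← map_sum]
  refine congrArg _ (Subtype.ext ?_)
  rw [AddSubmonoidClass.coe_finsetSum]
  refine Eq.trans ?_ (map_sum (qExpNeg w) _ _).symm
  refine Finset.sum_congr rfl fun p _ => ?_
  change (Polynomial.X ^ p : ℝ[X]) • qExpNeg w (1 ⊗ₜ (α p : Form E M)) = _
  rw [← map_smul, TensorProduct.smul_tmul', smul_eq_mul, mul_one]

/-- Applying `exp(hΛ)` to a relation `d_h y = exp(-hΛ) ∑ hᵖ αₚ` makes each `αₚ` the exterior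
derivative of a coefficient of `exp(hΛ) y`. -/
theorem quantumMap_injective : Function.Injective (quantumMap hw) := by
  refine (injective_iff_map_eq_zero _).2 fun z hz => ?_
  obtain ⟨N, hN⟩ := exists_eq_sum_tcoeff z
  have hN := hN N le_rfl
  choose α hα using fun p => (isDGA_form E M).cls_surjective (tcoeff p z)
  simp only [← hα] at hN
  rw [hN, quantumMap_sum] at hz
  obtain ⟨y, hy⟩ := (isDGA_qForm w hw).cls_eq_zero.1 hz
  rw [qD_eq_conj w hw] at hy
  have hy := congrArg (qExp w) hy
  rw [qExp_qExpNeg, qExp_qExpNeg] at hy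
  rw [hN]
  refine Finset.sum_eq_zero fun p hp => ?_
  rw [(isDGA_form E M).cls_eq_zero.2 ⟨tcoeff p (qExp w y), ?_⟩, TensorProduct.tmul_zero]
  rw [← tcoeff_baseChange, hy, map_sum, Finset.sum_eq_single p]
  · rw [tcoeff_X_pow_tmul, if_pos rfl]
  · intro j _ hj
    rw [tcoeff_X_pow_tmul, if_neg (by tauto)]
  · exact fun h => absurd hp h

/-- For a quantum cocycle `x`, the coefficients of `exp(hΛ) x` are closed, and their classes give a
preimage. -/
theorem quantumMap_surjective : Function.Surjective (quantumMap hw) := by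
  intro c
  obtain ⟨⟨x, hx⟩, rfl⟩ := (isDGA_qForm w hw).cls_surjective c
  have hy : extDer.baseChange ℝ[X] (qExp w x) = 0 := by
    have h := congrArg (qExp w) (LinearMap.mem_ker.1 hx)
    rwa [qD_eq_conj w hw, qExp_qExpNeg, map_zero] at h
  obtain ⟨N, hN⟩ := exists_eq_sum_tcoeff (qExp w x)
  have hα : ∀ p, tcoeff p (qExp w x) ∈ LinearMap.ker (extDer (E := E) (M := M)) := fun p => by
    rw [LinearMap.mem_ker, ← tcoeff_baseChange, hy, map_zero]
  refine ⟨_, (quantumMap_sum hw N fun p => ⟨_, hα p⟩).trans (congrArg _ (Subtype.ext ?_))⟩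
  change qExpNeg w (∑ p ∈ Finset.range N, _) = x
  rw [← hN N le_rfl, qExpNeg_qExp]

theorem quantumMap_X_pow_tmul_mem_deg {i : ℤ} (p : ℕ) {a : (isDGA_form E M).Cohomology}
    (ha : a ∈ (isDGA_form E M).deg i) :
    quantumMap hw ((Polynomial.X ^ p : ℝ[X]) ⊗ₜ a) ∈ (isDGA_qForm w hw).deg (i + 2 * p) := by
  obtain ⟨α, hα, rfl⟩ := ha
  refine ⟨(Polynomial.X ^ p : ℝ[X]) • quantumCocycle hw α, ?_, ?_⟩
  · change (Polynomial.X ^ p : ℝ[X]) • qExpNeg w (1 ⊗ₜ (α : Form E M)) ∈ qDeg E M (i + 2 * p)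
    rw [← map_smul, TensorProduct.smul_tmul', smul_eq_mul, mul_one]
    exact qExpNeg_mem_qDeg w (X_pow_tmul_mem_qDeg p rfl hα)
  · change (isDGA_qForm w hw).cls ((Polynomial.X ^ p : ℝ[X]) • quantumCocycle hw α) =
      quantumMap hw ((Polynomial.X ^ p : ℝ[X]) ⊗ₜ (isDGA_form E M).cls α)
    rw [quantumMap_tmul, quantumClass_cls, map_smul]

theorem X_smul_mem_qDeg {n : ℤ} {x : QForm E M} (hx : x ∈ qDeg E M n) :
    (Polynomial.X : ℝ[X]) • x ∈ qDeg E M (n + 2) := by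
  rw [mem_qDeg] at hx ⊢
  rintro (_ | j)
  · rw [tcoeff_zero_X_smul]
    exact zero_mem _
  · rw [tcoeff_succ_X_smul]
    convert hx j using 1
    push_cast
    congr 1
    ring

theorem tcoeff_zero_qExp (x : QForm E M) : tcoeff 0 (qExp w x) = tcoeff 0 x := by
  rw [← tcoeff_zero_qExpNeg w, qExpNeg_qExp]

/-- Both exponentials are the identity modulo `h`, so evaluation at `h = 0` is multiplicative on
cochains. -/
theorem tcoeff_zero_qWedge (x y : QForm E M) :
    tcoeff 0 (qWedge w x y) = formWedge (tcoeff 0 x) (tcoeff 0 y) := by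
  rw [qWedge_eq_conj, tcoeff_zero_qExpNeg, tcoeff_zero_polyBilin, tcoeff_zero_qExp,
    tcoeff_zero_qExp]

theorem tcoeff_zero_mem_ker (x : LinearMap.ker (qD w)) :
    tcoeff 0 (x : QForm E M) ∈ LinearMap.ker (extDer (E := E) (M := M)) := by
  rw [LinearMap.mem_ker, ← tcoeff_zero_qD (w := w), LinearMap.mem_ker.1 x.2, map_zero]

/-- Evaluation of cocycles at `h = 0`. -/
noncomputable def classicalCocycle : LinearMap.ker (qD w) →ₛₗ[Polynomial.constantCoeff (R := ℝ)]
    LinearMap.ker (extDer (E := E) (M := M)) where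
  toFun x := ⟨tcoeff 0 (x : QForm E M), tcoeff_zero_mem_ker x⟩
  map_add' x y := Subtype.ext (map_add (tcoeff 0) (x : QForm E M) y)
  map_smul' f x := Subtype.ext (tcoeff_zero_smul f (x : QForm E M))

/-- Evaluation of cocycles at `h = 0`, in cohomology. -/
noncomputable def classicalClass :
    LinearMap.ker (qD w) →ₛₗ[Polynomial.constantCoeff (R := ℝ)] (isDGA_form E M).Cohomology :=
  (isDGA_form E M).cls.comp classicalCocycle

theorem range_le_ker_classicalClass :
    (LinearMap.range (qD w)).submoduleOf (LinearMap.ker (qD w)) ≤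
      LinearMap.ker (classicalClass (E := E) (M := M) (w := w)) := by
  rintro x ⟨y, hy⟩
  refine (isDGA_form E M).cls_eq_zero.2 ⟨tcoeff 0 y, ?_⟩
  rw [← tcoeff_zero_qD (w := w), hy]
  rfl

/-- Evaluation at `h = 0` in cohomology, as a semilinear map. -/
noncomputable def classicalLimitAux :
    (isDGA_qForm w hw).Cohomology →ₛₗ[Polynomial.constantCoeff (R := ℝ)]
      (isDGA_form E M).Cohomology :=
  (isDGA_qForm w hw).lift classicalClass range_le_ker_classicalClass

/-- Evaluation at `h = 0` in cohomology. -/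
noncomputable def classicalLimit :
    (isDGA_qForm w hw).Cohomology →+* (isDGA_form E M).Cohomology where
  toFun := classicalLimitAux hw
  map_zero' := map_zero _
  map_add' := map_add _
  map_one' := by
    refine congrArg (isDGA_form E M).cls (Subtype.ext ?_)
    change tcoeff 0 (qOne : QForm E M) = oneForm
    rw [qOne, tcoeff_tmul, Polynomial.coeff_one_zero, one_smul]
  map_mul' x y := by
    obtain ⟨x, rfl⟩ := (isDGA_qForm w hw).cls_surjective x
    obtain ⟨y, rfl⟩ := (isDGA_qForm w hw).cls_surjective y
    exact congrArg (isDGA_form E M).cls (Subtype.ext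
      (tcoeff_zero_qWedge (x : QForm E M) y) : classicalCocycle ((isDGA_qForm w hw).mulCocycle x y) =
        (isDGA_form E M).mulCocycle (classicalCocycle x) (classicalCocycle y))

theorem classicalLimit_cls (x : LinearMap.ker (qD w)) :
    classicalLimit hw ((isDGA_qForm w hw).cls x) =
      (isDGA_form E M).cls (classicalCocycle x) := rfl

theorem classicalLimit_quantumClass (a : (isDGA_form E M).Cohomology) :
    classicalLimit hw (quantumClass hw a) = a := by
  obtain ⟨α, rfl⟩ := (isDGA_form E M).cls_surjective a
  rw [quantumClass_cls, classicalLimit_cls]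
  refine congrArg _ (Subtype.ext ?_)
  change tcoeff 0 (qExpNeg w (1 ⊗ₜ (α : Form E M))) = α
  rw [tcoeff_zero_qExpNeg, tcoeff_tmul, Polynomial.coeff_one_zero, one_smul]

theorem classicalLimit_smul (f : ℝ[X]) (b : (isDGA_qForm w hw).Cohomology) :
    classicalLimit hw (f • b) = f.coeff 0 • classicalLimit hw b :=
  (classicalLimitAux hw).map_smulₛₗ f b

theorem classicalLimit_quantumMap
    (z : ℝ[X] ⊗[ℝ] (isDGA_form E M).Cohomology) :
    classicalLimit hw (quantumMap hw z) = tcoeff 0 z := by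
  induction z using TensorProduct.induction_on with
  | zero => simp
  | tmul f a => rw [quantumMap_tmul, classicalLimit_smul, classicalLimit_quantumClass, tcoeff_tmul]
  | add x y hx hy => rw [map_add, map_add, map_add, hx, hy]

/-- Under `quantumMap`, evaluation at `h = 0` is the constant coefficient, and a polynomial with
zero constant coefficient is divisible by `h`. -/
theorem classicalLimit_eq_zero {b : (isDGA_qForm w hw).Cohomology} :
    classicalLimit hw b = 0 ↔ ∃ b', b = (Polynomial.X : ℝ[X]) • b' := by
  constructor
  · intro hb
    obtain ⟨z, rfl⟩ := quantumMap_surjective hw b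
    rw [classicalLimit_quantumMap] at hb
    obtain ⟨y, rfl⟩ := exists_X_smul_eq hb
    exact ⟨quantumMap hw y, map_smul _ _ _⟩
  · rintro ⟨b, rfl⟩
    rw [classicalLimit_smul, Polynomial.coeff_X_zero, zero_smul]

theorem isGradedDeformationQuantization_deg :
    IsGradedDeformationQuantization (isDGA_form E M).deg (isDGA_qForm w hw).deg where
  internal_A := (isDGA_form E M).isInternal_deg
  graded_A := (isDGA_form E M).gradedMonoid_deg
  internal_B := (isDGA_qForm w hw).isInternal_deg
  graded_B := (isDGA_qForm w hw).gradedMonoid_deg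
  X_smul_mem := by
    rintro i _ ⟨x, hx, rfl⟩
    exact ⟨(Polynomial.X : ℝ[X]) • x, X_smul_mem_qDeg hx,
      map_smul (isDGA_qForm w hw).cls (Polynomial.X : ℝ[X]) x⟩
  exists_equiv := ⟨LinearEquiv.ofBijective (quantumMap hw)
    ⟨quantumMap_injective hw, quantumMap_surjective hw⟩, classicalLimit hw,
    fun p _ ha => quantumMap_X_pow_tmul_mem_deg hw p ha,
    fun a => ⟨quantumClass hw a, classicalLimit_quantumClass hw a⟩,
    classicalLimit_smul hw, fun _ => classicalLimit_eq_zero hw, fun a =>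
      (congrArg (classicalLimit hw) ((quantumMap_tmul hw 1 a).trans (one_smul _ _))).trans
        (classicalLimit_quantumClass hw a)⟩

end Deformation

end QuantumDeRham
theorem theorem1 {E : Type*} [NormedAddCommGroup E] [NormedSpace ℂ E] [FiniteDimensional ℂ E]
    {M : Type*} [TopologicalSpace M] [T2Space M] [CompactSpace M] [ChartedSpace E M]
    [IsManifold 𝓘(ℂ, E) ∞ M] (σ : KahlerForm E M) :
    ∃ (h₀ : IsDGA ℝ (formDeg E M) extDer formWedge oneForm parity)
      (h₁ : IsDGA ℝ (qDeg E M) (qD σ.bivector) (qWedge σ.bivector) qOne qParity),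
      (∀ p q : ℤ, 0 ≤ p →
        ∃ e : h₀.deg (q - p) ≃ₗ[ℝ]
            page (dblComplex E M) ((qD σ.bivector).restrictScalars ℝ) 1 p q,
          ∀ (α : Form E M) (hα : α ∈ LinearMap.ker extDer), α ∈ formDeg E M (q - p) →
            ∃ hz : (Polynomial.X ^ p.toNat : Polynomial ℝ) ⊗ₜ[ℝ] α ∈
                cycles (dblComplex E M) ((qD σ.bivector).restrictScalars ℝ) 1 p q,
              ∀ c : h₀.deg (q - p), (c : h₀.Cohomology) = h₀.cls ⟨α, hα⟩ →
                e c = Submodule.Quotient.mk ⟨_, hz⟩) ∧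
      (∀ p q : ℤ, p < 0 →
        Subsingleton (page (dblComplex E M) ((qD σ.bivector).restrictScalars ℝ) 1 p q)) ∧
      (∀ r p q : ℤ, 1 ≤ r → pageD (dblComplex E M) (D := (qD σ.bivector).restrictScalars ℝ)
        h₁.D_D r p q = 0) ∧
      IsGradedDeformationQuantization h₀.deg h₁.deg := by
  -- Closedness of the Kähler form and its nondegeneracy, which comes from positivity on `u` and
  -- `Ju`, supply the commutation on which the conjugation of `d_h` to `d` depends.
  have hw : Commute (formContr σ.bivector) (codiff σ.bivector) :=
    commute_formContr_codiff σ.deg_two σ.closed σ.isInvertible fun _ => rfl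
  exact ⟨isDGA_form E M, isDGA_qForm _ hw, fun p q hp => exists_equiv_page hw hp q,
    fun p q hp => subsingleton_page_of_neg hp, fun r p q hr => pageD_eq_zero hw hr p q _,
    isGradedDeformationQuantization_deg hw⟩
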